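/- **Setting.** Let $2\le n\le 4$ and let $a>0$. Let $(M,g_0)$ be a closed (compact, without boundary) smooth Riemannian manifold of dimension $n$, and let $N\subset\mathbb R^L$ be a smoothly embedded submanifold (of any dimension) with the induced metric. Let $A$ be its second fundamental form, with the sign $A(y)=-\nabla^2\Pi(y)$ on $T_yN$, where $\Pi$ is the nearest point projection onto $N$; equivalently $A(v,w)=-(D_vP)\,w$, where $P(y)$ is the orthogonal projection of $\mathbb R^L$ onto $T_yN$. Let $C_N\ge 0$ satisfy $\|A\|\le C_N$ on $N$, and let $b>0$ be such that $C_b:=\frac{nb}{2}-C_N-2C_N^2>0$. Let $\varepsilon\in[0,1]$ and write $e_2(f)=\varepsilon+|df|^2$. All norms, divergences, balls and integrals on $M$ are with respect to $g_0$. The regularized $n$-conformal heat flow is the system $$ f_t=e^{-nu}\Big(\operatorname{Div}\big(e_2(f)^{\frac n2-1}df\big)+e_2(f)^{\frac n2-1}A(f)(df,df)\Big),\qquad u_t=b\,e^{-nu}e_2(f)^{\frac n2}-a,\qquad u(0)=0, $$ for $f(t):M\to N$ and $u(t):M\to\mathbb R$, and $E^\varepsilon(0)=\frac1n\int_M e_2(f(0))^{\frac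 n2}$ is the initial energy. **Lemma.** Let $0\le t_1<t_2$, $0<r\le R$ and $x_0\in M$. Let $(f,u)$ be a solution of the regularized $n$-conformal heat flow which is smooth on $M\times[0,t_2)$ and on $B_R(x_0)\times[t_1,t_2]$, that is, on the union of these two sets. Let $\varphi\in C_0^\infty(B_r(x_0))$ be a cut-off function, with $0\le\varphi\le1$ and $|\nabla\varphi|\le\frac4r$. Put $t_1'=\frac{t_1+t_2}2$. Then, for every $t\in[t_1',t_2]$, $$ \int_{B_r(x_0)}e^{nu}|f_t|^n\varphi^n\,(t)\le C_{12} \qquad\text{and}\qquad \int_{B_r(x_0)}e^{nu}|f_t|^{n+\frac18}\varphi^n\,(t)\le C_{12}, $$ both integrals being finite, for a constant $C_{12}$ that depends only on $n$, $a$, $C_b$, $r$, $R$, $t_1$, $t_2$ and an upper bound for $E^\varepsilon(0)$. (It does not depend on $\varepsilon$, on $(M,g_0)$, $N$, $b$, $C_N$, $x_0$ or $\varphi$, or otherwise on $f$ and $u$.) -/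

import Mathlib

open MeasureTheory Bundle Set
open scoped Manifold ContDiff ENNReal

namespace RegCHF

/-- The differential `dF_p : T_pM → ℝ^L` of a map `F` from a manifold to a Euclidean space. -/
noncomputable def diffAt {m L : ℕ} {M : Type*} [TopologicalSpace M]
    [ChartedSpace (EuclideanSpace ℝ (Fin m)) M] (F : M → EuclideanSpace ℝ (Fin L)) (p : M) :
    TangentSpace (𝓡 m) p →L[ℝ] EuclideanSpace ℝ (Fin L) :=
  mfderiv (𝓡 m) 𝓘(ℝ, EuclideanSpace ℝ (Fin L)) F p

/-! ### Riemannian geometry of the domain `(M, g₀)` in local coordinates -/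

section Domain

variable {n : ℕ} {M : Type*} [TopologicalSpace M] [ChartedSpace (EuclideanSpace ℝ (Fin n)) M]

/-- The coordinate vector field `∂ᵢ` of the chart around `x`, at the point of `M` with
coordinates `y`. -/
noncomputable def coordVec (x : M) (y : EuclideanSpace ℝ (Fin n)) (i : Fin n) :
    TangentSpace (𝓡 n) ((extChartAt (𝓡 n) x).symm y) :=
  mfderiv 𝓘(ℝ, EuclideanSpace ℝ (Fin n)) (𝓡 n) (extChartAt (𝓡 n) x).symm y
    (EuclideanSpace.single i (1 : ℝ) : EuclideanSpace ℝ (Fin n))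

variable [RiemannianBundle (fun x : M => TangentSpace (𝓡 n) x)]

/-- The matrix `g_{ij} = ⟨∂ᵢ, ∂ⱼ⟩` of the metric in the chart around `x`, as a function of the
coordinates `y`. -/
noncomputable def gramMatrix (x : M) (y : EuclideanSpace ℝ (Fin n)) :
    Matrix (Fin n) (Fin n) ℝ :=
  Matrix.of fun i j => inner ℝ (coordVec x y i) (coordVec x y j)

/-- The density `√|g|` of the Riemannian volume in the chart around `x`. -/
noncomputable def volDensity (x : M) (y : EuclideanSpace ℝ (Fin n)) : ℝ :=
  Real.sqrt (gramMatrix x y).det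

/-- The measure `√|g| dy` on the domain of the chart around `x` (zero outside that domain). -/
noncomputable def chartVolume [MeasurableSpace M] (x : M) : Measure M :=
  ((volume.restrict (extChartAt (𝓡 n) x).target).withDensity
    (fun y => ENNReal.ofReal (volDensity x y))).map (extChartAt (𝓡 n) x).symm

variable (n M) in
/-- The Riemannian volume measure `dvol`: it agrees with `√|g| dy` on the domain of each chart,
and it is the least measure which is at least `√|g| dy` on each of them. -/
noncomputable def riemVolume [MeasurableSpace M] : Measure M :=
  ⨆ x : M, chartVolume (n := n) x

variable {L : ℕ}

/-- The trace `∑ₖ B(eₖ, eₖ)` of a function of two tangent vectors at `p`, over an orthonormal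
basis `eₖ` of `T_pM` (this is `g^{ij} B(∂ᵢ, ∂ⱼ)` for bilinear `B`). -/
noncomputable def metricTrace {V : Type*} [AddCommMonoid V] (p : M)
    (B : TangentSpace (𝓡 n) p → TangentSpace (𝓡 n) p → V) : V :=
  haveI : FiniteDimensional ℝ (TangentSpace (𝓡 n) p) :=
    inferInstanceAs (FiniteDimensional ℝ (EuclideanSpace ℝ (Fin n)))
  ∑ k, B (stdOrthonormalBasis ℝ (TangentSpace (𝓡 n) p) k)
    (stdOrthonormalBasis ℝ (TangentSpace (𝓡 n) p) k)

/-- `|dF|²` at `p`, for a map `F` from `M` to a Euclidean space. -/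
noncomputable def normSqDiff (F : M → EuclideanSpace ℝ (Fin L)) (p : M) : ℝ :=
  metricTrace (n := n) p fun v w => inner ℝ (diffAt F p v) (diffAt F p w)

/-- `e₂ = ε + |dF|²`. -/
noncomputable def e2 (n : ℕ) {M : Type*} [TopologicalSpace M]
    [ChartedSpace (EuclideanSpace ℝ (Fin n)) M]
    [RiemannianBundle (fun x : M => TangentSpace (𝓡 n) x)]
    (ε : ℝ) (F : M → EuclideanSpace ℝ (Fin L)) (p : M) : ℝ :=
  ε + normSqDiff (n := n) F p

/-- The regularized `n`-energy `(1/n) ∫_M (ε + |dF|²)^{n/2} dvol`. -/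
noncomputable def energy (n : ℕ) {M : Type*} [TopologicalSpace M]
    [ChartedSpace (EuclideanSpace ℝ (Fin n)) M]
    [RiemannianBundle (fun x : M => TangentSpace (𝓡 n) x)] [MeasurableSpace M]
    (ε : ℝ) (F : M → EuclideanSpace ℝ (Fin L)) : ℝ :=
  (1 / (n : ℝ)) * ∫ p, e2 n ε F p ^ ((n : ℝ) / 2) ∂(riemVolume n M)

/-- The regularized `n`-Laplacian `Div (e₂^{n/2-1} dF)` at `p`, computed in the chart around `x`:
`(1/√|g|) ∑ᵢ ∂ᵢ (√|g| e₂^{n/2-1} ∑ⱼ g^{ij} ∂ⱼF)`. -/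
noncomputable def regLaplacian (ε : ℝ) (F : M → EuclideanSpace ℝ (Fin L)) (x p : M) :
    EuclideanSpace ℝ (Fin L) :=
  (volDensity x (extChartAt (𝓡 n) x p))⁻¹ •
    ∑ i : Fin n, fderiv ℝ
      (fun y : EuclideanSpace ℝ (Fin n) =>
        (volDensity x y *
            e2 n ε F ((extChartAt (𝓡 n) x).symm y) ^ ((n : ℝ) / 2 - 1)) •
          ∑ j : Fin n, (gramMatrix x y)⁻¹ i j •
            fderiv ℝ (F ∘ (extChartAt (𝓡 n) x).symm) y (EuclideanSpace.single j (1 : ℝ)))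
      (extChartAt (𝓡 n) x p) (EuclideanSpace.single i (1 : ℝ))

end Domain

/-! ### The target `N`, embedded in `ℝ^L` -/

section Target

variable {k L : ℕ} {N : Type*} [TopologicalSpace N] [ChartedSpace (EuclideanSpace ℝ (Fin k)) N]

/-- The orthogonal projection of `ℝ^L` onto the tangent space `dι(T_qN)`. -/
noncomputable def tangentProj (k : ℕ) {L : ℕ} {N : Type*} [TopologicalSpace N]
    [ChartedSpace (EuclideanSpace ℝ (Fin k)) N] (ι : N → EuclideanSpace ℝ (Fin L)) (q : N) :
    EuclideanSpace ℝ (Fin L) →L[ℝ] EuclideanSpace ℝ (Fin L) :=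
  (LinearMap.range (diffAt (m := k) ι q).toLinearMap).starProjection

/-- The derivative `D_v P` at `q` of the projection onto the tangent space. -/
noncomputable def tangentProjDiff (ι : N → EuclideanSpace ℝ (Fin L)) (q : N) :
    TangentSpace (𝓡 k) q →L[ℝ] EuclideanSpace ℝ (Fin L) →L[ℝ] EuclideanSpace ℝ (Fin L) :=
  mfderiv (𝓡 k) 𝓘(ℝ, EuclideanSpace ℝ (Fin L) →L[ℝ] EuclideanSpace ℝ (Fin L))
    (tangentProj k ι) q

/-- The second fundamental form `A(v, w) = -(D_v P) w` of `N` in `ℝ^L`, where `P` is the orthogonal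
projection onto the tangent space. Up to the sign, `A(v, v)` is the normal part of the acceleration
of a curve with velocity `v`; the sign is the one for which `Δf + A(df, df)` is tangent to `N`
(on the unit sphere, `A(v, v) = |v|² y`). With the nearest point projection `Π` onto `N`, whose
derivative on `N` is `P`, it is `-∇²Π`. -/
noncomputable def secondFund (ι : N → EuclideanSpace ℝ (Fin L)) (q : N)
    (v w : TangentSpace (𝓡 k) q) : EuclideanSpace ℝ (Fin L) :=
  -(tangentProjDiff ι q v (diffAt ι q w))

/-- `‖A‖ ≤ C` on all of `N`, with the metric on `N` induced from `ℝ^L`. -/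
def SecondFundBound (k : ℕ) {L : ℕ} {N : Type*} [TopologicalSpace N]
    [ChartedSpace (EuclideanSpace ℝ (Fin k)) N]
    (ι : N → EuclideanSpace ℝ (Fin L)) (C : ℝ) : Prop :=
  ∀ (q : N) (v w : TangentSpace (𝓡 k) q),
    ‖secondFund ι q v w‖ ≤ C * ‖diffAt ι q v‖ * ‖diffAt ι q w‖

end Target

/-! ### The flow -/

section Flow

/-- The time derivative at `(t, p)`, one-sided at the ends of the interval `[0, t₂]`. -/
noncomputable def timeDeriv {M V : Type*} [NormedAddCommGroup V] [NormedSpace ℝ V]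
    (t₂ : ℝ) (F : ℝ → M → V) (t : ℝ) (p : M) : V :=
  derivWithin (fun s => F s p) (Icc 0 t₂) t

/-- `(f, u)` is a smooth solution on `Ω ⊆ [0, t₂] × M`, starting from `u(0) = 0`, of
`f_t = e^{-nu} (Div(e₂^{n/2-1} df) + e₂^{n/2-1} A(f)(df, df))`, `u_t = b e^{-nu} e₂^{n/2} - a`,
for maps `f(t) : M → N` into `N ⊆ ℝ^L`. The first equation is required in every local chart. -/
structure IsSmoothSolution (n k : ℕ) {L : ℕ} {M N : Type*}
    [TopologicalSpace M] [ChartedSpace (EuclideanSpace ℝ (Fin n)) M]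
    [RiemannianBundle (fun x : M => TangentSpace (𝓡 n) x)]
    [TopologicalSpace N] [ChartedSpace (EuclideanSpace ℝ (Fin k)) N]
    (ι : N → EuclideanSpace ℝ (Fin L)) (a b ε t₂ : ℝ) (Ω : Set (ℝ × M))
    (f : ℝ → M → N) (u : ℝ → M → ℝ) : Prop where
  smooth_f : ContMDiffOn (𝓘(ℝ, ℝ).prod (𝓡 n)) (𝓡 k) ∞ (fun z : ℝ × M => f z.1 z.2) Ω
  smooth_u : ContMDiffOn (𝓘(ℝ, ℝ).prod (𝓡 n)) 𝓘(ℝ, ℝ) ∞ (fun z : ℝ × M => u z.1 z.2) Ω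
  init_u : ∀ p, u 0 p = 0
  eq_f : ∀ t p, (t, p) ∈ Ω → ∀ x, p ∈ (chartAt (EuclideanSpace ℝ (Fin n)) x).source →
    timeDeriv t₂ (fun s q => ι (f s q)) t p =
      Real.exp (-(n * u t p)) •
        (regLaplacian (n := n) ε (fun q => ι (f t q)) x p +
          e2 n ε (fun q => ι (f t q)) p ^ ((n : ℝ) / 2 - 1) •
            metricTrace (n := n) p fun v w =>
              secondFund (k := k) ι (f t p)
                (mfderiv (𝓡 n) (𝓡 k) (f t) p v) (mfderiv (𝓡 n) (𝓡 k) (f t) p w))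
  eq_u : ∀ t p, (t, p) ∈ Ω →
    timeDeriv t₂ u t p =
      b * Real.exp (-(n * u t p)) * e2 n ε (fun q => ι (f t q)) p ^ ((n : ℝ) / 2) - a

/-- `φ` is a cut-off function on the ball `B_r(x₀)`: smooth, with values in `[0, 1]`, supported in
the ball, and `|∇φ| ≤ 4/r`. -/
structure IsCutoff (n : ℕ) {M : Type*} [EMetricSpace M]
    [ChartedSpace (EuclideanSpace ℝ (Fin n)) M]
    [RiemannianBundle (fun x : M => TangentSpace (𝓡 n) x)]
    (x₀ : M) (r : ℝ) (φ : M → ℝ) : Prop where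
  smooth : ContMDiff (𝓡 n) 𝓘(ℝ, ℝ) ∞ φ
  mem_Icc : ∀ p, φ p ∈ Icc (0 : ℝ) 1
  compact : HasCompactSupport φ
  support : tsupport φ ⊆ Metric.eball x₀ (ENNReal.ofReal r)
  grad_le : ∀ p (v : TangentSpace (𝓡 n) p),
    |(show ℝ from mfderiv (𝓡 n) 𝓘(ℝ, ℝ) φ p v)| ≤ 4 / r * ‖v‖

end Flow

end RegCHF

set_option linter.unusedSectionVars false

/-! Write F = ι ∘ f, w = F_t, s = n/2 − 1, and let A be the curvature term. The system reads e^{nu}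
w = Div(e₂^s dF) + e₂^s A and (e^{nu})_t = n (b e₂^{n/2} − a e^{nu}). Before t₂ the flow is smooth
on the whole closed manifold, so the bound is proved for integrals over all of M, without
localising. The ball matters only at t = t₂, which is reached by Fatou's lemma.

For γ ∈ [0, 17/16] put h = (1 + |w|²)^γ and consider X_γ = ∫ e^{nu} |w|² h (`velMass`), Z_γ = ∫
e^{nu} ∫₀^{|w|²} (1 + σ)^γ dσ (`velPrim`), which is comparable to X_γ, and G_γ = ∫ e₂^{n/2} |w|² h +
e₂^s h |dw|² (`velDissip`).

Dissipation (`RegFlow.exists_hasDerivAt_velPrim`): Z' ≤ 4na Z − min(1, 2C_b) G. This comes from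
differentiating the equation in time and testing with 2hw. The factor (e^{nu})_t supplies −nb ∫
e₂^{n/2} |w|² h, up to a multiple of Z. The linearised diffusion is coercive for γ ≤ 17/16 and n ≤ 4
(`coercivity`) and supplies −∫ e₂^s h |dw|². As A is normal and w is tangent, ⟨A_t, w⟩ = −⟨A, w_t⟩,
which costs at most C_N² |dF|² |w|²; the condition on b absorbs this.

Gain of integrability (`RegFlow.velMass_add_half_le`): testing the undifferentiated equation with (1
+ |w|²)^{γ+1/2} w removes A, and Cauchy–Schwarz gives X_{γ+1/2} ≤ 6 G_γ + 12 n E, with E the energy.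

Iteration (`exists_bound_of_gain`): the energy identity E' = −X₀ bounds ∫ X₀ dt. If ∫ (t − s₀)^j X_γ
dt is bounded, where s₀ is now the starting time, the dissipation inequality multiplied by (t −
s₀)^{j+1} bounds Z_γ pointwise for t > s₀, and bounds ∫ (t − s₀)^{j+1} G_γ dt, hence the next ∫ (t −
s₀)^{j+1} X_{γ+1/2} dt. The exponents 0, 1/2, 1 lead to X_{3/2} ≥ X_{17/16}, and one last step
bounds Z_{17/16}. As 2 + 2 · 17/16 = 4 + 1/8, this controls |w|^n and |w|^{n+1/8} for n ≤ 4.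

Since ε = 0 is allowed, e₂ may vanish and e₂^s need not be smooth. The equation is therefore used
only in weak form (`RegFlow.weak`), and the derivatives of e₂^s dF are shown to exist and to be
bounded, not to be continuous. -/

namespace RegCHF

/-! ### Orthogonal projection onto the range of an injective linear map -/

section Projection

variable {U V : Type*} [NormedAddCommGroup U] [InnerProductSpace ℝ U] [FiniteDimensional ℝ U]
  [NormedAddCommGroup V] [InnerProductSpace ℝ V] [FiniteDimensional ℝ V]

theorem isInvertible_adjoint_comp_self (J : U →L[ℝ] V) (hJ : Function.Injective J) :
    ((ContinuousLinearMap.adjoint J).comp J).IsInvertible := by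
  have hinj : Function.Injective ((ContinuousLinearMap.adjoint J).comp J) := by
    rw [injective_iff_map_eq_zero]
    intro x hx
    have h1 : inner ℝ (J x) (J x) = 0 := by
      rw [← ContinuousLinearMap.adjoint_inner_left]
      simp only [ContinuousLinearMap.comp_apply] at hx
      rw [hx, inner_zero_left]
    exact (injective_iff_map_eq_zero J).1 hJ x (inner_self_eq_zero.1 h1)
  refine ⟨ContinuousLinearEquiv.ofBijective _ (LinearMap.ker_eq_bot.2 hinj)
    (LinearMap.range_eq_top.2 ?_), ?_⟩
  · exact LinearMap.surjective_of_injective (f := ((ContinuousLinearMap.adjoint J).comp J).toLinearMap) hinj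
  · ext x; rfl

/-- The orthogonal projection onto the range of an injective map `J` is `J (J* J)⁻¹ J*`. -/
theorem starProjection_range_eq (J : U →L[ℝ] V) (hJ : Function.Injective J) :
    (LinearMap.range J.toLinearMap).starProjection =
      J.comp ((((ContinuousLinearMap.adjoint J).comp J).inverse).comp
        (ContinuousLinearMap.adjoint J)) := by
  ext1 v
  have hinv := isInvertible_adjoint_comp_self J hJ
  refine Submodule.eq_starProjection_of_mem_of_inner_eq_zero ?_ ?_
  · exact ⟨_, rfl⟩
  · rintro _ ⟨x, rfl⟩
    have key : (ContinuousLinearMap.adjoint J) (J ((((ContinuousLinearMap.adjoint J).comp J).inverse)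
        ((ContinuousLinearMap.adjoint J) v))) = (ContinuousLinearMap.adjoint J) v := by
      have := hinv.self_comp_inverse
      exact congrArg (fun T : U →L[ℝ] U => T ((ContinuousLinearMap.adjoint J) v)) this
    change inner ℝ (v - _) (J x) = 0
    rw [← ContinuousLinearMap.adjoint_inner_left]
    simp only [ContinuousLinearMap.comp_apply, map_sub] at key ⊢
    rw [key, sub_self, inner_zero_left]

/-- In the formula J (J* J)⁻¹ J* every operation is smooth, inversion being smooth at an invertible
map. -/
theorem contDiffAt_starProjection_range {X : Type*} [NormedAddCommGroup X] [NormedSpace ℝ X]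
    {J : X → U →L[ℝ] V} {x : X} {m : WithTop ℕ∞} (hJ : ContDiffAt ℝ m J x)
    (hinj : ∀ᶠ y in nhds x, Function.Injective (J y)) :
    ContDiffAt ℝ m (fun y => (LinearMap.range (J y).toLinearMap).starProjection) x := by
  have hadj : ContDiffAt ℝ m (fun y => ContinuousLinearMap.adjoint (J y)) x :=
    (ContinuousLinearMap.adjoint (𝕜 := ℝ) (E := U) (F := V)).toContinuousLinearEquiv.contDiff.contDiffAt.comp x hJ
  have hinv : ContDiffAt ℝ m
      (fun y => ((ContinuousLinearMap.adjoint (J y)).comp (J y)).inverse) x := by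
    obtain ⟨e, he⟩ := isInvertible_adjoint_comp_self (J x) hinj.self_of_nhds
    have h2 : ContDiffAt ℝ m ContinuousLinearMap.inverse
        ((ContinuousLinearMap.adjoint (J x)).comp (J x)) := by
      rw [← he]; exact contDiffAt_map_inverse e
    exact h2.comp x (hadj.clm_comp hJ)
  refine (hJ.clm_comp (hinv.clm_comp hadj)).congr_of_eventuallyEq ?_
  exact hinj.mono fun y hy => starProjection_range_eq (J y) hy

end Projection

/-! ### Smoothness of the tangent projection of N -/

section Target

variable {k L : ℕ} {N : Type*} [TopologicalSpace N] [ChartedSpace (EuclideanSpace ℝ (Fin k)) N]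
  [IsManifold (𝓡 k) ∞ N] {ι : N → EuclideanSpace ℝ (Fin L)}

/-- In suitable charts an immersion is x ↦ e (x, 0) with e a linear equivalence, and charts have
injective derivatives. -/
theorem diffAt_injective
    (hι : Manifold.IsSmoothEmbedding (𝓡 k) 𝓘(ℝ, EuclideanSpace ℝ (Fin L)) ∞ ι) (q : N) :
    Function.Injective (diffAt (m := k) ι q) := by
  have h := hι.isImmersion.isImmersionAt q
  set φ := h.domChart
  set c := h.codChart
  let e := h.equiv
  have hφ : MDifferentiableAt (𝓡 k) 𝓘(ℝ, EuclideanSpace ℝ (Fin k)) φ q :=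
    mdifferentiableAt_of_mem_maximalAtlas
      (IsManifold.maximalAtlas_subset_of_le (by simp) h.domChart_mem_maximalAtlas)
      h.mem_domChart_source
  have hc : MDifferentiableAt 𝓘(ℝ, EuclideanSpace ℝ (Fin L)) 𝓘(ℝ, EuclideanSpace ℝ (Fin L)) c (ι q) :=
    mdifferentiableAt_of_mem_maximalAtlas
      (IsManifold.maximalAtlas_subset_of_le (by simp) h.codChart_mem_maximalAtlas)
      h.mem_codChart_source
  have hιd : MDifferentiableAt (𝓡 k) 𝓘(ℝ, EuclideanSpace ℝ (Fin L)) ι q :=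
    (hι.contMDiff q).mdifferentiableAt (by simp)
  have heq : (fun p => e (φ p, 0)) =ᶠ[nhds q] c ∘ ι := by
    filter_upwards [φ.open_source.mem_nhds h.mem_domChart_source] with p hp
    have h1 := h.writtenInCharts (show φ p ∈ _ by simpa [φ] using φ.map_source hp)
    simp only [Function.comp, OpenPartialHomeomorph.extend_coe, OpenPartialHomeomorph.extend_coe_symm, modelWithCornersSelf_coe,
      modelWithCornersSelf_coe_symm, id] at h1
    rw [show h.domChart.symm (φ p) = p from φ.left_inv hp] at h1
    exact h1.symm
  rw [injective_iff_map_eq_zero]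
  intro v hv
  have hφinj : Function.Injective (mfderiv (𝓡 k) 𝓘(ℝ, EuclideanSpace ℝ (Fin k)) φ q) := by
    have h2 : MDifferentiableAt 𝓘(ℝ, EuclideanSpace ℝ (Fin k)) (𝓡 k) φ.symm (φ q) :=
      mdifferentiableAt_symm_of_mem_maximalAtlas
        (IsManifold.maximalAtlas_subset_of_le (by simp) h.domChart_mem_maximalAtlas)
        (φ.map_source h.mem_domChart_source)
    have h3 : mfderiv (𝓡 k) (𝓡 k) (φ.symm ∘ φ) q =
      (mfderiv 𝓘(ℝ, EuclideanSpace ℝ (Fin k)) (𝓡 k) φ.symm (φ q)).comp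
        (mfderiv (𝓡 k) 𝓘(ℝ, EuclideanSpace ℝ (Fin k)) φ q) := mfderiv_comp q h2 hφ
    have h4 : φ.symm ∘ φ =ᶠ[nhds q] id := by
      filter_upwards [φ.open_source.mem_nhds h.mem_domChart_source] with p hp
      exact φ.left_inv hp
    rw [h4.mfderiv_eq, mfderiv_id] at h3
    intro a b hab
    have h5 := congrArg (fun T => T a) h3
    have h6 := congrArg (fun T => T b) h3
    simp only [ContinuousLinearMap.comp_apply] at h5 h6
    rw [hab] at h5
    exact h5.trans h6.symm
  apply hφinj
  rw [map_zero]
  have h7 : mfderiv (𝓡 k) 𝓘(ℝ, EuclideanSpace ℝ (Fin L)) (c ∘ ι) q v = 0 := by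
    rw [mfderiv_comp q hc hιd, ContinuousLinearMap.comp_apply]
    have : mfderiv (𝓡 k) 𝓘(ℝ, EuclideanSpace ℝ (Fin L)) ι q v = 0 := hv
    rw [this]; exact map_zero _
  let T : EuclideanSpace ℝ (Fin k) →L[ℝ] EuclideanSpace ℝ (Fin L) :=
    e.toContinuousLinearMap.comp (ContinuousLinearMap.inl ℝ _ _)
  have h8 : mfderiv (𝓡 k) 𝓘(ℝ, EuclideanSpace ℝ (Fin L)) (T ∘ φ) q v =
      T (mfderiv (𝓡 k) 𝓘(ℝ, EuclideanSpace ℝ (Fin k)) φ q v) := by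
    rw [mfderiv_comp q T.mdifferentiableAt hφ, ContinuousLinearMap.comp_apply, T.mfderiv_eq]
    rfl
  have h10 : mfderiv (𝓡 k) 𝓘(ℝ, EuclideanSpace ℝ (Fin L)) (T ∘ φ) q v = 0 :=
    (congrArg (fun S : EuclideanSpace ℝ (Fin k) →L[ℝ] EuclideanSpace ℝ (Fin L) => S v)
      heq.mfderiv_eq).trans h7
  have h9 := e.injective ((h8.symm.trans h10).trans (map_zero e).symm)
  exact (Prod.ext_iff.1 h9).1

/-- The tangent space is also the range of the derivative of ι read in a chart. That derivative
takes values in a fixed space of linear maps and is smooth in the coordinates, so the projection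
formula applies. -/
theorem contMDiff_tangentProj
    (hι : Manifold.IsSmoothEmbedding (𝓡 k) 𝓘(ℝ, EuclideanSpace ℝ (Fin L)) ∞ ι) :
    ContMDiff (𝓡 k) 𝓘(ℝ, EuclideanSpace ℝ (Fin L) →L[ℝ] EuclideanSpace ℝ (Fin L)) ∞
      (tangentProj k ι) := by
  intro q
  set φ := extChartAt (𝓡 k) q
  have hopen : IsOpen φ.target := isOpen_extChartAt_target q
  have hs : ContDiffOn ℝ ∞ (ι ∘ φ.symm) φ.target := by
    rw [← contMDiffOn_iff_contDiffOn]
    exact hι.contMDiff.comp_contMDiffOn (contMDiffOn_extChartAt_symm q)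
  have hsymm : ∀ y ∈ φ.target, MDifferentiableAt 𝓘(ℝ, EuclideanSpace ℝ (Fin k)) (𝓡 k) φ.symm y :=
    fun y hy => ((contMDiffOn_extChartAt_symm (n := ∞) q).contMDiffAt
      (hopen.mem_nhds hy)).mdifferentiableAt (by simp)
  have hιd : ∀ p, MDifferentiableAt (𝓡 k) 𝓘(ℝ, EuclideanSpace ℝ (Fin L)) ι p :=
    fun p => (hι.contMDiff p).mdifferentiableAt (by simp)
  have hchain : ∀ y ∈ φ.target, fderiv ℝ (ι ∘ φ.symm) y =
      (diffAt (m := k) ι (φ.symm y)).comp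
        (mfderiv 𝓘(ℝ, EuclideanSpace ℝ (Fin k)) (𝓡 k) φ.symm y) := by
    intro y hy
    rw [← mfderiv_eq_fderiv]
    exact mfderiv_comp y (hιd _) (hsymm y hy)
  have hbij : ∀ y ∈ φ.target, Function.Bijective
      (mfderiv 𝓘(ℝ, EuclideanSpace ℝ (Fin k)) (𝓡 k) φ.symm y) := by
    intro y hy
    have := isInvertible_mfderivWithin_extChartAt_symm (I := 𝓡 k) hy
    rw [ModelWithCorners.range_eq_univ, mfderivWithin_univ] at this
    exact this.bijective
  have hinj : ∀ y ∈ φ.target, Function.Injective (fderiv ℝ (ι ∘ φ.symm) y) := by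
    intro y hy
    rw [hchain y hy]
    exact (diffAt_injective hι _).comp (hbij y hy).1
  have hrange : ∀ y ∈ φ.target,
      LinearMap.range (fderiv ℝ (ι ∘ φ.symm) y).toLinearMap =
      LinearMap.range (diffAt (m := k) ι (φ.symm y)).toLinearMap := by
    intro y hy
    rw [hchain y hy]
    ext v
    constructor
    · rintro ⟨x, rfl⟩; exact ⟨_, rfl⟩
    · rintro ⟨x, rfl⟩
      obtain ⟨z, hz⟩ := (hbij y hy).2 x
      exact ⟨z, congrArg (diffAt (m := k) ι (φ.symm y)) hz⟩
  have hq : φ q ∈ φ.target := mem_extChartAt_target q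
  have hJ : ContDiffAt ℝ ∞ (fderiv ℝ (ι ∘ φ.symm)) (φ q) :=
    (hs.fderiv_of_isOpen hopen (by simp)).contDiffAt (hopen.mem_nhds hq)
  have hP : ContDiffAt ℝ ∞ (fun y => (LinearMap.range
      (fderiv ℝ (ι ∘ φ.symm) y).toLinearMap).starProjection) (φ q) :=
    contDiffAt_starProjection_range hJ
      (by filter_upwards [hopen.mem_nhds hq] with y hy using hinj y hy)
  refine (hP.contMDiffAt.comp q (contMDiffAt_extChartAt (n := ∞))).congr_of_eventuallyEq ?_
  filter_upwards [extChartAt_source_mem_nhds (I := 𝓡 k) q] with p hp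
  have h1 := hrange (φ p) (φ.map_source hp)
  rw [φ.left_inv hp] at h1
  simp only [tangentProj, Function.comp]
  congr 1
  exact h1.symm

end Target

/-! ### The second fundamental form: normality and acceleration of curves -/

section SecondFundamentalForm

variable {k L : ℕ} {N : Type*} [TopologicalSpace N] [ChartedSpace (EuclideanSpace ℝ (Fin k)) N]
  {ι : N → EuclideanSpace ℝ (Fin L)}

theorem tangentProj_diffAt (q : N) (v : TangentSpace (𝓡 k) q) :
    tangentProj k ι q (diffAt ι q v) = diffAt ι q v :=
  Submodule.starProjection_eq_self_iff.2 ⟨v, rfl⟩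

theorem tangentProj_tangentProj (q : N) (v : EuclideanSpace ℝ (Fin L)) :
    tangentProj k ι q (tangentProj k ι q v) = tangentProj k ι q v :=
  Submodule.starProjection_eq_self_iff.2 (Submodule.starProjection_apply_mem _ v)

theorem inner_tangentProj (q : N) (v w : EuclideanSpace ℝ (Fin L)) :
    inner ℝ (tangentProj k ι q v) w = inner ℝ v (tangentProj k ι q w) :=
  Submodule.inner_starProjection_left_eq_right _ v w

variable [IsManifold (𝓡 k) ∞ N]

theorem hasMFDerivAt_tangentProj
    (hι : Manifold.IsSmoothEmbedding (𝓡 k) 𝓘(ℝ, EuclideanSpace ℝ (Fin L)) ∞ ι) (q : N) :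
    HasMFDerivAt (𝓡 k) 𝓘(ℝ, EuclideanSpace ℝ (Fin L) →L[ℝ] EuclideanSpace ℝ (Fin L))
      (tangentProj k ι) q (tangentProjDiff ι q) :=
  ((contMDiff_tangentProj hι q).mdifferentiableAt (by simp)).hasMFDerivAt

/-- The derivative of a projection `P` satisfies `P' = P' P + P P'`. -/
theorem tangentProjDiff_eq
    (hι : Manifold.IsSmoothEmbedding (𝓡 k) 𝓘(ℝ, EuclideanSpace ℝ (Fin L)) ∞ ι) (q : N)
    (v : TangentSpace (𝓡 k) q) (z : EuclideanSpace ℝ (Fin L)) :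
    tangentProjDiff ι q v z = tangentProj k ι q (tangentProjDiff ι q v z) +
      tangentProjDiff ι q v (tangentProj k ι q z) := by
  have hP := hasMFDerivAt_tangentProj hι q
  have hG : HasFDerivAt (fun A : EuclideanSpace ℝ (Fin L) →L[ℝ] EuclideanSpace ℝ (Fin L) => A.comp A)
      _ (tangentProj k ι q) := (hasFDerivAt_id _).clm_comp (hasFDerivAt_id _)
  have hc := HasMFDerivAt.comp q hG.hasMFDerivAt hP
  have heq : (fun A : EuclideanSpace ℝ (Fin L) →L[ℝ] EuclideanSpace ℝ (Fin L) => A.comp A) ∘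
      tangentProj k ι = tangentProj k ι := by
    funext p
    ext1 x
    exact tangentProj_tangentProj p x
  rw [heq] at hc
  have h1 := hasMFDerivAt_unique hP hc
  exact congrArg (fun S : EuclideanSpace ℝ (Fin k) →L[ℝ]
    (EuclideanSpace ℝ (Fin L) →L[ℝ] EuclideanSpace ℝ (Fin L)) => S v z) h1

/-- For tangent z the identity P' = P P' + P' P reads P' z = P P' z + P' z, so P P' z = 0: the
second fundamental form is normal. -/
theorem tangentProj_secondFund
    (hι : Manifold.IsSmoothEmbedding (𝓡 k) 𝓘(ℝ, EuclideanSpace ℝ (Fin L)) ∞ ι) (q : N)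
    (v w : TangentSpace (𝓡 k) q) : tangentProj k ι q (secondFund ι q v w) = 0 := by
  have h := tangentProjDiff_eq hι q v (diffAt ι q w)
  rw [tangentProj_diffAt] at h
  rw [secondFund, map_neg, neg_eq_zero]
  simpa using h

theorem inner_secondFund_diffAt
    (hι : Manifold.IsSmoothEmbedding (𝓡 k) 𝓘(ℝ, EuclideanSpace ℝ (Fin L)) ∞ ι) (q : N)
    (v w z : TangentSpace (𝓡 k) q) : inner ℝ (secondFund ι q v w) (diffAt ι q z) = 0 := by
  rw [← tangentProj_diffAt, ← inner_tangentProj, tangentProj_secondFund hι, inner_zero_left]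

variable {γ : ℝ → N} {t : ℝ}

theorem hasDerivAt_comp_curve
    (hι : Manifold.IsSmoothEmbedding (𝓡 k) 𝓘(ℝ, EuclideanSpace ℝ (Fin L)) ∞ ι)
    (hγ : MDifferentiableAt 𝓘(ℝ, ℝ) (𝓡 k) γ t) :
    HasDerivAt (fun s => ι (γ s))
      (diffAt ι (γ t) (mfderiv 𝓘(ℝ, ℝ) (𝓡 k) γ t (1 : ℝ))) t := by
  have h := HasMFDerivAt.comp t
    ((hι.contMDiff (γ t)).mdifferentiableAt (by simp)).hasMFDerivAt hγ.hasMFDerivAt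
  have h' : HasFDerivAt (fun s => ι (γ s)) (show ℝ →L[ℝ] EuclideanSpace ℝ (Fin L) from
    (diffAt ι (γ t)).comp (mfderiv 𝓘(ℝ, ℝ) (𝓡 k) γ t)) t := hasMFDerivAt_iff_hasFDerivAt.1 h
  exact h'.hasDerivAt

theorem hasDerivAt_tangentProj_curve
    (hι : Manifold.IsSmoothEmbedding (𝓡 k) 𝓘(ℝ, EuclideanSpace ℝ (Fin L)) ∞ ι)
    (hγ : MDifferentiableAt 𝓘(ℝ, ℝ) (𝓡 k) γ t) :
    HasDerivAt (fun s => tangentProj k ι (γ s))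
      (tangentProjDiff ι (γ t) (mfderiv 𝓘(ℝ, ℝ) (𝓡 k) γ t (1 : ℝ))) t := by
  have h := HasMFDerivAt.comp t (hasMFDerivAt_tangentProj hι (γ t)) hγ.hasMFDerivAt
  have h' : HasFDerivAt (fun s => tangentProj k ι (γ s))
    (show ℝ →L[ℝ] EuclideanSpace ℝ (Fin L) →L[ℝ] EuclideanSpace ℝ (Fin L) from
    (tangentProjDiff ι (γ t)).comp (mfderiv 𝓘(ℝ, ℝ) (𝓡 k) γ t)) t :=
    hasMFDerivAt_iff_hasFDerivAt.1 h
  exact h'.hasDerivAt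

/-- The normal part of the acceleration of a curve on `N` is controlled by the second
fundamental form. -/
theorem abs_inner_secondFund_accel_le
    (hι : Manifold.IsSmoothEmbedding (𝓡 k) 𝓘(ℝ, EuclideanSpace ℝ (Fin L)) ∞ ι) {C : ℝ}
    (hC : SecondFundBound k ι C)
    (hγ : ∀ᶠ s in nhds t, MDifferentiableAt 𝓘(ℝ, ℝ) (𝓡 k) γ s) {w : ℝ → EuclideanSpace ℝ (Fin L)}
    (hw : ∀ᶠ s in nhds t, HasDerivAt (fun s => ι (γ s)) (w s) s)
    {w' : EuclideanSpace ℝ (Fin L)} (hw' : HasDerivAt w w' t) (v : TangentSpace (𝓡 k) (γ t)) :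
    |inner ℝ (secondFund ι (γ t) v v) w'| ≤
      C ^ 2 * ‖diffAt ι (γ t) v‖ ^ 2 * ‖w t‖ ^ 2 := by
  have hwt : w t = diffAt ι (γ t) (mfderiv 𝓘(ℝ, ℝ) (𝓡 k) γ t (1 : ℝ)) :=
    hw.self_of_nhds.unique (hasDerivAt_comp_curve hι hγ.self_of_nhds)
  -- The velocity is tangent, so w = P w along the curve and w' = P' w + P w'. A normal vector sees
  -- only P' w = −A(w, w), which is where the square of C comes from.
  have hPw : (fun s => tangentProj k ι (γ s) (w s)) =ᶠ[nhds t] w := by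
    filter_upwards [hγ, hw] with s h1 h2
    rw [h2.unique (hasDerivAt_comp_curve hι h1), tangentProj_diffAt]
  have h1 := ((hasDerivAt_tangentProj_curve hι hγ.self_of_nhds).clm_apply hw').congr_of_eventuallyEq
    hPw.symm
  have h2 := hw'.unique h1
  have h3 : inner ℝ (secondFund ι (γ t) v v) w' =
      - inner ℝ (secondFund ι (γ t) v v) (secondFund ι (γ t)
        (mfderiv 𝓘(ℝ, ℝ) (𝓡 k) γ t (1 : ℝ)) (mfderiv 𝓘(ℝ, ℝ) (𝓡 k) γ t (1 : ℝ))) := by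
    rw [h2, inner_add_right, ← inner_tangentProj, tangentProj_secondFund hι, inner_zero_left,
      add_zero, hwt]
    conv_rhs => arg 1; arg 3; rw [secondFund]
    rw [inner_neg_right, neg_neg]
  rw [h3, abs_neg]
  refine (abs_real_inner_le_norm _ _).trans ?_
  refine (mul_le_mul (hC _ _ _) (hC _ _ _) (norm_nonneg _)
    ((norm_nonneg _).trans (hC _ _ _))).trans (le_of_eq ?_)
  rw [hwt]; ring

end SecondFundamentalForm

/-- With c = m b for the change of frame m, the Gram matrix is m mᵀ, and mᵀ G⁻¹ m = 1. This passes
from `metricTrace` to g^{ij} in coordinates, where smoothness is visible; the orthonormal bases are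
chosen pointwise with no regularity in p. -/
theorem sum_inner_orthonormalBasis_eq_gram {V W κ κ' : Type*} [NormedAddCommGroup V]
    [InnerProductSpace ℝ V] [NormedAddCommGroup W] [InnerProductSpace ℝ W] [Fintype κ] [Fintype κ']
    [DecidableEq κ'] [DecidableEq κ]
    (b : OrthonormalBasis κ ℝ V) (c : κ' → V) (hc : LinearIndependent ℝ c)
    (hcard : Fintype.card κ' = Fintype.card κ) (f g : V →ₗ[ℝ] W) :
    ∑ k, inner ℝ (f (b k)) (g (b k)) =
      ∑ i, ∑ j, (Matrix.gram ℝ c)⁻¹ i j * inner ℝ (f (c i)) (g (c j)) := by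
  set m : Matrix κ' κ ℝ := Matrix.of fun i k => inner ℝ (b k) (c i) with hm
  have hci : ∀ i, c i = ∑ k, m i k • b k := fun i => (b.sum_repr' (c i)).symm
  have hG : Matrix.gram ℝ c = m * m.transpose := by
    ext i j
    simp only [Matrix.gram_apply, Matrix.mul_apply, Matrix.transpose_apply, hm, Matrix.of_apply]
    rw [← b.sum_inner_mul_inner]
    simp only [real_inner_comm]
  have hunit : IsUnit (Matrix.gram ℝ c).det :=
    (Matrix.posDef_gram_of_linearIndependent hc).det_pos.ne'.isUnit
  have h1 : m * (m.transpose * (Matrix.gram ℝ c)⁻¹) = 1 := by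
    rw [← Matrix.mul_assoc, ← hG, Matrix.mul_nonsing_inv _ hunit]
  have h2 := (Matrix.mul_eq_one_comm_of_card_eq _ _ _ hcard).1 h1
  have h3 : ∀ i j, inner ℝ (f (c i)) (g (c j)) =
      ∑ k, ∑ l, m i k * m j l * inner ℝ (f (b k)) (g (b l)) := by
    intro i j
    rw [hci i, hci j]
    simp only [map_sum, map_smul, sum_inner, inner_sum, inner_smul_left, inner_smul_right]
    simp only [Finset.mul_sum, conj_trivial]
    rw [Finset.sum_comm]
    exact Finset.sum_congr rfl fun k _ => Finset.sum_congr rfl fun l _ => by ring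
  have h4 : ∀ k l, ∑ i, ∑ j, (Matrix.gram ℝ c)⁻¹ i j * (m i k * m j l) = if l = k then 1 else 0 := by
    intro k l
    have h5 : m.transpose * ((Matrix.gram ℝ c)⁻¹ * m) = 1 := by rw [← Matrix.mul_assoc]; exact h2
    have := congrFun (congrFun h5 k) l
    rw [Matrix.one_apply] at this
    rw [show (if l = k then (1:ℝ) else 0) = if k = l then 1 else 0 by simp [eq_comm], ← this]
    simp only [Matrix.mul_apply, Matrix.transpose_apply, Finset.mul_sum]
    exact Finset.sum_congr rfl fun i _ => Finset.sum_congr rfl fun j _ => by ring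
  calc ∑ k, inner ℝ (f (b k)) (g (b k))
      = ∑ k, ∑ l, (if l = k then (1:ℝ) else 0) * inner ℝ (f (b k)) (g (b l)) := by simp
    _ = ∑ k, ∑ l, ∑ i, ∑ j, (Matrix.gram ℝ c)⁻¹ i j * (m i k * m j l) *
          inner ℝ (f (b k)) (g (b l)) := by
        refine Finset.sum_congr rfl fun k _ => Finset.sum_congr rfl fun l _ => ?_
        rw [← h4]; simp only [Finset.sum_mul]
    _ = ∑ k, ∑ i, ∑ j, ∑ l, (Matrix.gram ℝ c)⁻¹ i j * (m i k * m j l) *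
          inner ℝ (f (b k)) (g (b l)) := by
        refine Finset.sum_congr rfl fun k _ => ?_
        rw [Finset.sum_comm]
        exact Finset.sum_congr rfl fun i _ => Finset.sum_comm
    _ = ∑ i, ∑ j, ∑ k, ∑ l, (Matrix.gram ℝ c)⁻¹ i j * (m i k * m j l) *
          inner ℝ (f (b k)) (g (b l)) := by
        rw [Finset.sum_comm]
        exact Finset.sum_congr rfl fun i _ => Finset.sum_comm
    _ = _ := by
        refine Finset.sum_congr rfl fun i _ => Finset.sum_congr rfl fun j _ => ?_
        rw [h3, Finset.mul_sum]
        refine Finset.sum_congr rfl fun k _ => ?_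
        rw [Finset.mul_sum]
        exact Finset.sum_congr rfl fun l _ => by ring

/-! ### The metric and the gradient product in a chart -/

section Chart

variable {n : ℕ} {M : Type*} [TopologicalSpace M] [ChartedSpace (EuclideanSpace ℝ (Fin n)) M]
  [IsManifold (𝓡 n) ∞ M]

theorem mdifferentiableAt_extChartAt_symm {x : M} {y : EuclideanSpace ℝ (Fin n)}
    (hy : y ∈ (extChartAt (𝓡 n) x).target) :
    MDifferentiableAt 𝓘(ℝ, EuclideanSpace ℝ (Fin n)) (𝓡 n) (extChartAt (𝓡 n) x).symm y :=
  ((contMDiffOn_extChartAt_symm (n := ∞) x).contMDiffAt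
    ((isOpen_extChartAt_target x).mem_nhds hy)).mdifferentiableAt (by simp)

theorem isInvertible_mfderiv_extChartAt_symm {x : M} {y : EuclideanSpace ℝ (Fin n)}
    (hy : y ∈ (extChartAt (𝓡 n) x).target) :
    (mfderiv 𝓘(ℝ, EuclideanSpace ℝ (Fin n)) (𝓡 n) (extChartAt (𝓡 n) x).symm y).IsInvertible := by
  have := isInvertible_mfderivWithin_extChartAt_symm (I := 𝓡 n) hy
  rwa [ModelWithCorners.range_eq_univ, mfderivWithin_univ] at this

theorem coordVec_linearIndependent {x : M} {y : EuclideanSpace ℝ (Fin n)}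
    (hy : y ∈ (extChartAt (𝓡 n) x).target) : LinearIndependent ℝ (coordVec x y) := by
  have hb := (EuclideanSpace.basisFun (Fin n) ℝ).toBasis.linearIndependent
  have hinj := (isInvertible_mfderiv_extChartAt_symm hy).bijective.1
  have := hb.map' (mfderiv 𝓘(ℝ, EuclideanSpace ℝ (Fin n)) (𝓡 n)
    (extChartAt (𝓡 n) x).symm y).toLinearMap (LinearMap.ker_eq_bot.2 hinj)
  have h : coordVec x y = (mfderiv 𝓘(ℝ, EuclideanSpace ℝ (Fin n)) (𝓡 n)
      (extChartAt (𝓡 n) x).symm y).toLinearMap ∘ (EuclideanSpace.basisFun (Fin n) ℝ).toBasis := by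
    funext i
    simp only [coordVec, Function.comp, OrthonormalBasis.coe_toBasis, EuclideanSpace.basisFun_apply]
    rfl
  rw [h]
  exact this

variable {V : Type*} [NormedAddCommGroup V] [NormedSpace ℝ V]

theorem mdifferentiableAt_of_comp_symm {F : M → V} {x : M} {y : EuclideanSpace ℝ (Fin n)}
    (hy : y ∈ (extChartAt (𝓡 n) x).target)
    (hF : DifferentiableAt ℝ (F ∘ (extChartAt (𝓡 n) x).symm) y) :
    MDifferentiableAt (𝓡 n) 𝓘(ℝ, V) F ((extChartAt (𝓡 n) x).symm y) := by
  set φ := extChartAt (𝓡 n) x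
  have hp : φ.symm y ∈ φ.source := φ.map_target hy
  have h1 : MDifferentiableAt (𝓡 n) 𝓘(ℝ, EuclideanSpace ℝ (Fin n)) φ (φ.symm y) :=
    mdifferentiableAt_extChartAt (by simpa [φ] using hp)
  have h2 : MDifferentiableAt 𝓘(ℝ, EuclideanSpace ℝ (Fin n)) 𝓘(ℝ, V) (F ∘ φ.symm) (φ (φ.symm y)) := by
    rw [φ.right_inv hy]; exact hF.mdifferentiableAt
  refine (h2.comp _ h1).congr_of_eventuallyEq ?_
  filter_upwards [(isOpen_extChartAt_source (I := 𝓡 n) x).mem_nhds hp] with p hp'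
  simp only [Function.comp]
  rw [φ.left_inv hp']

theorem mfderiv_coordVec {F : M → V} {x : M} {y : EuclideanSpace ℝ (Fin n)}
    (hy : y ∈ (extChartAt (𝓡 n) x).target)
    (hF : DifferentiableAt ℝ (F ∘ (extChartAt (𝓡 n) x).symm) y) (i : Fin n) :
    mfderiv (𝓡 n) 𝓘(ℝ, V) F ((extChartAt (𝓡 n) x).symm y) (coordVec x y i) =
      fderiv ℝ (F ∘ (extChartAt (𝓡 n) x).symm) y (EuclideanSpace.single i (1 : ℝ)) := by
  have h := mfderiv_comp y (mdifferentiableAt_of_comp_symm hy hF)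
    (mdifferentiableAt_extChartAt_symm hy)
  rw [mfderiv_eq_fderiv] at h
  rw [h]; rfl

variable [RiemannianBundle (fun x : M => TangentSpace (𝓡 n) x)]

theorem gramMatrix_eq_gram (x : M) (y : EuclideanSpace ℝ (Fin n)) :
    gramMatrix x y = Matrix.gram ℝ (coordVec x y) := rfl

theorem gramMatrix_posDef {x : M} {y : EuclideanSpace ℝ (Fin n)}
    (hy : y ∈ (extChartAt (𝓡 n) x).target) : (gramMatrix x y).PosDef := by
  rw [gramMatrix_eq_gram]
  exact Matrix.posDef_gram_of_linearIndependent (coordVec_linearIndependent hy)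

/-- The pointwise inner product `⟨dF, dG⟩` of the differentials of two maps. -/
noncomputable def gradInner (n : ℕ) {L : ℕ} {M : Type*} [TopologicalSpace M]
    [ChartedSpace (EuclideanSpace ℝ (Fin n)) M]
    [RiemannianBundle (fun x : M => TangentSpace (𝓡 n) x)]
    (F G : M → EuclideanSpace ℝ (Fin L)) (p : M) : ℝ :=
  metricTrace (n := n) p fun v w => inner ℝ (diffAt F p v) (diffAt G p w)

theorem gradInner_eq_gram {L : ℕ} {F G : M → EuclideanSpace ℝ (Fin L)} {x : M}
    {y : EuclideanSpace ℝ (Fin n)} (hy : y ∈ (extChartAt (𝓡 n) x).target)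
    (hF : DifferentiableAt ℝ (F ∘ (extChartAt (𝓡 n) x).symm) y)
    (hG : DifferentiableAt ℝ (G ∘ (extChartAt (𝓡 n) x).symm) y) :
    gradInner n F G ((extChartAt (𝓡 n) x).symm y) = ∑ i, ∑ j, (gramMatrix x y)⁻¹ i j *
      inner ℝ (fderiv ℝ (F ∘ (extChartAt (𝓡 n) x).symm) y (EuclideanSpace.single i (1 : ℝ)))
        (fderiv ℝ (G ∘ (extChartAt (𝓡 n) x).symm) y (EuclideanSpace.single j (1 : ℝ))) := by
  have : FiniteDimensional ℝ (TangentSpace (𝓡 n) ((extChartAt (𝓡 n) x).symm y)) :=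
    inferInstanceAs (FiniteDimensional ℝ (EuclideanSpace ℝ (Fin n)))
  have hfr : Module.finrank ℝ (TangentSpace (𝓡 n) ((extChartAt (𝓡 n) x).symm y)) = n :=
    (finrank_euclideanSpace_fin (𝕜 := ℝ) (n := n))
  have h := sum_inner_orthonormalBasis_eq_gram
    (stdOrthonormalBasis ℝ (TangentSpace (𝓡 n) ((extChartAt (𝓡 n) x).symm y)))
    (coordVec x y) (coordVec_linearIndependent hy) (by rw [Fintype.card_fin, Fintype.card_fin]; exact hfr.symm)
    (diffAt F ((extChartAt (𝓡 n) x).symm y)).toLinearMap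
    (diffAt G ((extChartAt (𝓡 n) x).symm y)).toLinearMap
  rw [← gramMatrix_eq_gram] at h
  refine h.trans ?_
  refine Finset.sum_congr rfl fun i _ => Finset.sum_congr rfl fun j _ => ?_
  rw [← mfderiv_coordVec hy hF, ← mfderiv_coordVec hy hG]
  rfl

variable [IsContMDiffRiemannianBundle (𝓡 n) ∞ (EuclideanSpace ℝ (Fin n))
        (fun x : M => TangentSpace (𝓡 n) x)]

/-- The coordinate fields are constant vectors seen through the trivialization of the tangent
bundle, hence smooth sections, and the metric is smooth on pairs of smooth sections. -/
theorem contDiffOn_gramMatrix (x : M) (i j : Fin n) :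
    ContDiffOn ℝ ∞ (fun y => gramMatrix x y i j) (extChartAt (𝓡 n) x).target := by
  set e := trivializationAt (EuclideanSpace ℝ (Fin n)) (TangentSpace (𝓡 n) : M → Type _) x with he
  set φ := extChartAt (𝓡 n) x
  have hsm : ∀ i : Fin n, ContMDiffOn 𝓘(ℝ, EuclideanSpace ℝ (Fin n)) ((𝓡 n).prod 𝓘(ℝ, EuclideanSpace ℝ (Fin n))) ∞
      (fun y => (⟨φ.symm y, coordVec x y i⟩ :
        TotalSpace (EuclideanSpace ℝ (Fin n)) (TangentSpace (𝓡 n) : M → Type _)))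
      φ.target := by
    intro i
    have h1 : ContMDiffOn 𝓘(ℝ, EuclideanSpace ℝ (Fin n))
        ((𝓡 n).prod 𝓘(ℝ, EuclideanSpace ℝ (Fin n))) ∞
        (fun y => (φ.symm y, (EuclideanSpace.single i (1 : ℝ) : EuclideanSpace ℝ (Fin n)))) φ.target :=
      (contMDiffOn_extChartAt_symm x).prodMk contMDiffOn_const
    have h2 := (e.contMDiffOn_symm (IB := 𝓡 n) (n := ∞)).comp h1 (by
      intro y hy
      simpa [e.mem_target, he, φ] using φ.map_target hy)
    refine h2.congr fun y hy => ?_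
    have hp : φ.symm y ∈ (chartAt (EuclideanSpace ℝ (Fin n)) x).source := by
      simpa [φ] using φ.map_target hy
    simp only [Function.comp]
    rw [← e.mk_symm (by simpa [he] using hp)]
    congr 1
    have h3 := TangentBundle.symmL_trivializationAt (𝕜 := ℝ) (I := 𝓡 n) hp
    rw [φ.right_inv hy, ModelWithCorners.range_eq_univ, mfderivWithin_univ] at h3
    exact (congrArg (fun S : EuclideanSpace ℝ (Fin n) →L[ℝ] EuclideanSpace ℝ (Fin n) =>
      S (EuclideanSpace.single i (1 : ℝ))) h3).symm.trans
      (e.symmL_apply (by simpa [he] using hp) _)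
  rw [← contMDiffOn_iff_contDiffOn]
  exact (hsm i).inner_bundle (hsm j)

theorem contDiffOn_det_gramMatrix (x : M) :
    ContDiffOn ℝ ∞ (fun y => (gramMatrix x y).det) (extChartAt (𝓡 n) x).target := by
  simp only [Matrix.det_apply]
  refine ContDiffOn.sum fun σ _ => ContDiffOn.const_smul _ ?_
  exact contDiffOn_prod fun i _ => contDiffOn_gramMatrix x _ _

theorem volDensity_pos {x : M} {y : EuclideanSpace ℝ (Fin n)}
    (hy : y ∈ (extChartAt (𝓡 n) x).target) : 0 < volDensity x y :=
  Real.sqrt_pos.2 (gramMatrix_posDef hy).det_pos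

theorem contDiffOn_volDensity (x : M) :
    ContDiffOn ℝ ∞ (volDensity x) (extChartAt (𝓡 n) x).target :=
  (contDiffOn_det_gramMatrix x).sqrt fun _ hy => (gramMatrix_posDef hy).det_pos.ne'

theorem contDiffOn_inv_gramMatrix (x : M) (i j : Fin n) :
    ContDiffOn ℝ ∞ (fun y => (gramMatrix x y)⁻¹ i j) (extChartAt (𝓡 n) x).target := by
  have h1 : ∀ y, (gramMatrix x y)⁻¹ i j =
      (gramMatrix x y).det⁻¹ * ((gramMatrix x y).updateRow j (Pi.single i 1)).det := by
    intro y
    rw [Matrix.inv_def, Ring.inverse_eq_inv', Matrix.smul_apply, Matrix.adjugate_apply, smul_eq_mul]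
  simp only [h1]
  refine ((contDiffOn_det_gramMatrix x).inv fun _ hy => (gramMatrix_posDef hy).det_pos.ne').mul ?_
  simp only [Matrix.det_apply]
  refine ContDiffOn.sum fun σ _ => ContDiffOn.const_smul _ ?_
  refine contDiffOn_prod fun l _ => ?_
  simp only [Matrix.updateRow_apply]
  split_ifs
  · exact contDiffOn_const
  · exact contDiffOn_gramMatrix x _ _

end Chart

/-! ### The Riemannian volume -/

section Volume

variable {n : ℕ} {M : Type*} [TopologicalSpace M] [ChartedSpace (EuclideanSpace ℝ (Fin n)) M]
  [IsManifold (𝓡 n) ∞ M]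

theorem mfderiv_extChartAt_symm_eq_inverse {x : M} {y : EuclideanSpace ℝ (Fin n)}
    (hy : y ∈ (extChartAt (𝓡 n) x).target) :
    mfderiv 𝓘(ℝ, EuclideanSpace ℝ (Fin n)) (𝓡 n) (extChartAt (𝓡 n) x).symm y =
      (mfderiv (𝓡 n) 𝓘(ℝ, EuclideanSpace ℝ (Fin n)) (extChartAt (𝓡 n) x)
        ((extChartAt (𝓡 n) x).symm y)).inverse := by
  have h1 := mfderiv_extChartAt_comp_mfderivWithin_extChartAt_symm (I := 𝓡 n) hy
  have h2 := mfderivWithin_extChartAt_symm_comp_mfderiv_extChartAt (I := 𝓡 n) hy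
  rw [ModelWithCorners.range_eq_univ, mfderivWithin_univ] at h1 h2
  exact (ContinuousLinearMap.inverse_eq h1 h2).symm

variable [RiemannianBundle (fun x : M => TangentSpace (𝓡 n) x)]

/-- The matrix of the metric at `p` in the chart around `x`. -/
noncomputable def gramAt (x p : M) : Matrix (Fin n) (Fin n) ℝ :=
  Matrix.of fun i j => inner ℝ
    ((mfderiv (𝓡 n) 𝓘(ℝ, EuclideanSpace ℝ (Fin n)) (extChartAt (𝓡 n) x) p).inverse
      (EuclideanSpace.single i (1 : ℝ) : EuclideanSpace ℝ (Fin n)))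
    ((mfderiv (𝓡 n) 𝓘(ℝ, EuclideanSpace ℝ (Fin n)) (extChartAt (𝓡 n) x) p).inverse
      (EuclideanSpace.single j (1 : ℝ) : EuclideanSpace ℝ (Fin n)))

theorem gramMatrix_eq_gramAt {x : M} {y : EuclideanSpace ℝ (Fin n)}
    (hy : y ∈ (extChartAt (𝓡 n) x).target) :
    gramMatrix x y = gramAt x ((extChartAt (𝓡 n) x).symm y) := by
  ext i j
  simp only [gramMatrix, gramAt, Matrix.of_apply, coordVec]
  rw [mfderiv_extChartAt_symm_eq_inverse hy]
  rfl

/-- The differential of the coordinate change between two charts. -/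
noncomputable def coordChangeDiff (x x' p : M) :
    EuclideanSpace ℝ (Fin n) →L[ℝ] EuclideanSpace ℝ (Fin n) :=
  (mfderiv (𝓡 n) 𝓘(ℝ, EuclideanSpace ℝ (Fin n)) (extChartAt (𝓡 n) x') p).comp
    (mfderiv (𝓡 n) 𝓘(ℝ, EuclideanSpace ℝ (Fin n)) (extChartAt (𝓡 n) x) p).inverse

theorem hasFDerivAt_coordChange {x x' : M} {y : EuclideanSpace ℝ (Fin n)}
    (hy : y ∈ (extChartAt (𝓡 n) x).target)
    (hy' : (extChartAt (𝓡 n) x).symm y ∈ (extChartAt (𝓡 n) x').source) :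
    HasFDerivAt (extChartAt (𝓡 n) x' ∘ (extChartAt (𝓡 n) x).symm)
      (coordChangeDiff x x' ((extChartAt (𝓡 n) x).symm y)) y := by
  have h1 : MDifferentiableAt (𝓡 n) 𝓘(ℝ, EuclideanSpace ℝ (Fin n)) (extChartAt (𝓡 n) x')
      ((extChartAt (𝓡 n) x).symm y) := mdifferentiableAt_extChartAt (by simpa using hy')
  have h2 := HasMFDerivAt.comp y h1.hasMFDerivAt (mdifferentiableAt_extChartAt_symm hy).hasMFDerivAt
  rw [mfderiv_extChartAt_symm_eq_inverse hy] at h2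
  exact hasMFDerivAt_iff_hasFDerivAt.1 h2

theorem gramAt_coordChange {x x' p : M}
    (hp' : p ∈ (extChartAt (𝓡 n) x').source) :
    (gramAt (n := n) x p).det = (coordChangeDiff (n := n) x x' p).det ^ 2 * (gramAt (n := n) x' p).det := by
  set D := coordChangeDiff (n := n) x x' p with hD
  set T := mfderiv (𝓡 n) 𝓘(ℝ, EuclideanSpace ℝ (Fin n)) (extChartAt (𝓡 n) x) p with hT
  set T' := mfderiv (𝓡 n) 𝓘(ℝ, EuclideanSpace ℝ (Fin n)) (extChartAt (𝓡 n) x') p with hT'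
  let b := (EuclideanSpace.basisFun (Fin n) ℝ).toBasis
  let J : Matrix (Fin n) (Fin n) ℝ := LinearMap.toMatrix b b D.toLinearMap
  have hT'inv : T'.IsInvertible := isInvertible_mfderiv_extChartAt hp'
  have hcol : ∀ i, T.inverse (EuclideanSpace.single i (1 : ℝ) : EuclideanSpace ℝ (Fin n)) =
      ∑ k, J k i • T'.inverse (EuclideanSpace.single k (1 : ℝ) : EuclideanSpace ℝ (Fin n)) := by
    intro i
    have h1 : D (EuclideanSpace.single i (1 : ℝ)) =
        ∑ k, J k i • (EuclideanSpace.single k (1 : ℝ) : EuclideanSpace ℝ (Fin n)) := by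
      have h2 := b.sum_repr (D (EuclideanSpace.single i (1 : ℝ)))
      rw [← h2]
      refine Finset.sum_congr rfl fun k _ => ?_
      simp [J, LinearMap.toMatrix_apply, b]
    have h3 : T'.inverse (D (EuclideanSpace.single i (1 : ℝ))) =
        T.inverse (EuclideanSpace.single i (1 : ℝ) : EuclideanSpace ℝ (Fin n)) :=
      congrArg (fun S => S (T.inverse (EuclideanSpace.single i (1 : ℝ) : EuclideanSpace ℝ (Fin n))))
        hT'inv.inverse_comp_self
    rw [← h3, h1]
    exact (map_sum _ _ _).trans (Finset.sum_congr rfl fun k _ => map_smul _ _ _)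
  have hmat : gramAt (n := n) x p = J.transpose * (gramAt (n := n) x' p * J) := by
    ext i j
    simp only [gramAt, Matrix.of_apply, Matrix.mul_apply, Matrix.transpose_apply]
    rw [← hT, ← hT', hcol i, hcol j, sum_inner]
    refine Finset.sum_congr rfl fun k _ => ?_
    rw [inner_sum, Finset.mul_sum]
    refine Finset.sum_congr rfl fun l _ => ?_
    rw [real_inner_smul_left, real_inner_smul_right]
    ring
  have hdet : J.det = D.det := LinearMap.det_toMatrix b D.toLinearMap
  rw [hmat, Matrix.det_mul, Matrix.det_mul, Matrix.det_transpose, hdet]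
  ring

theorem volDensity_coordChange {x x' : M} {y : EuclideanSpace ℝ (Fin n)}
    (hy : y ∈ (extChartAt (𝓡 n) x).target)
    (hy' : (extChartAt (𝓡 n) x).symm y ∈ (extChartAt (𝓡 n) x').source) :
    volDensity x y = |(coordChangeDiff (n := n) x x' ((extChartAt (𝓡 n) x).symm y)).det| *
      volDensity x' (extChartAt (𝓡 n) x' ((extChartAt (𝓡 n) x).symm y)) := by
  have h1 := gramMatrix_eq_gramAt ((extChartAt (𝓡 n) x').map_source hy')
  rw [(extChartAt (𝓡 n) x').left_inv hy'] at h1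
  rw [volDensity, volDensity, gramMatrix_eq_gramAt hy, h1, gramAt_coordChange hy',
    Real.sqrt_mul (sq_nonneg _), Real.sqrt_sq_eq_abs]

variable [MeasurableSpace M] [BorelSpace M]

theorem aemeasurable_extChartAt_symm (x : M) :
    AEMeasurable (extChartAt (𝓡 n) x).symm
      ((volume.restrict (extChartAt (𝓡 n) x).target).withDensity
        (fun y => ENNReal.ofReal (volDensity x y))) :=
  ((continuousOn_extChartAt_symm x).aemeasurable (isOpen_extChartAt_target x).measurableSet).mono_ac
    (withDensity_absolutelyContinuous _ _)

theorem chartVolume_apply (x : M) {s : Set M} (hs : MeasurableSet s) :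
    chartVolume (n := n) x s = ∫⁻ y in (extChartAt (𝓡 n) x).symm ⁻¹' s ∩ (extChartAt (𝓡 n) x).target,
      ENNReal.ofReal (volDensity x y) := by
  rw [chartVolume, Measure.map_apply_of_aemeasurable (aemeasurable_extChartAt_symm x) hs,
    withDensity_apply', Measure.restrict_restrict' (isOpen_extChartAt_target x).measurableSet]

theorem measurableSet_preimage_extChartAt_symm (x : M) {s : Set M} (hs : MeasurableSet s) :
    MeasurableSet ((extChartAt (𝓡 n) x).symm ⁻¹' s ∩ (extChartAt (𝓡 n) x).target) := by
  have h := (continuousOn_extChartAt_symm (I := 𝓡 n) x).domRestrict.measurable hs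
  have h2 := (isOpen_extChartAt_target (I := 𝓡 n) x).measurableSet.subtype_image h
  convert h2 using 1
  ext y
  simp only [mem_inter_iff, mem_preimage, mem_image, domRestrict_apply, Subtype.exists, exists_and_left,
    exists_prop, exists_eq_right_right]

/-- The Jacobian of the change of variables is exactly the factor by which √|g| changes between the
two charts. -/
theorem chartVolume_eq_of_subset {x x' : M} {s : Set M} (hs : MeasurableSet s)
    (hx : s ⊆ (extChartAt (𝓡 n) x).source) (hx' : s ⊆ (extChartAt (𝓡 n) x').source) :
    chartVolume (n := n) x s = chartVolume (n := n) x' s := by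
  set φ := extChartAt (𝓡 n) x with hφ
  set φ' := extChartAt (𝓡 n) x' with hφ'
  rw [chartVolume_apply x hs, chartVolume_apply x' hs]
  set A := φ.symm ⁻¹' s ∩ φ.target with hA
  set A' := φ'.symm ⁻¹' s ∩ φ'.target with hA'
  have himg : (φ' ∘ φ.symm) '' A = A' := by
    ext z
    constructor
    · rintro ⟨y, hy, rfl⟩
      have h1 : φ.symm y ∈ φ'.source := hx' hy.1
      refine ⟨?_, φ'.map_source h1⟩
      simp only [mem_preimage, Function.comp]
      rw [φ'.left_inv h1]; exact hy.1
    · intro hz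
      have h1 : φ'.symm z ∈ φ.source := hx hz.1
      refine ⟨φ (φ'.symm z), ⟨?_, φ.map_source h1⟩, ?_⟩
      · simp only [mem_preimage]; rw [φ.left_inv h1]; exact hz.1
      · simp only [Function.comp]; rw [φ.left_inv h1, φ'.right_inv hz.2]
  have hinj : InjOn (φ' ∘ φ.symm) A := by
    intro y hy z hz hyz
    have h1 := φ'.injOn (hx' hy.1) (hx' hz.1) hyz
    have h2 := congrArg φ h1
    rwa [φ.right_inv hy.2, φ.right_inv hz.2] at h2
  rw [← himg, lintegral_image_eq_lintegral_abs_det_fderiv_mul volume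
    (measurableSet_preimage_extChartAt_symm x hs)
    (fun y hy => (hasFDerivAt_coordChange hy.2 (hx' hy.1)).hasFDerivWithinAt) hinj]
  refine setLIntegral_congr_fun (measurableSet_preimage_extChartAt_symm x hs) fun y hy => ?_
  simp only [Function.comp]
  rw [volDensity_coordChange hy.2 (hx' hy.1), ENNReal.ofReal_mul (abs_nonneg _)]

theorem chartVolume_compl_source (x : M) :
    chartVolume (n := n) x (extChartAt (𝓡 n) x).sourceᶜ = 0 := by
  rw [chartVolume_apply x (isOpen_extChartAt_source x).measurableSet.compl]
  have : (extChartAt (𝓡 n) x).symm ⁻¹' (extChartAt (𝓡 n) x).sourceᶜ ∩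
      (extChartAt (𝓡 n) x).target = ∅ := by
    ext y
    simp only [mem_inter_iff, mem_preimage, mem_compl_iff, mem_empty_iff_false, iff_false, not_and]
    intro h1 h2
    exact h1 ((extChartAt (𝓡 n) x).map_target h2)
  rw [this, Measure.restrict_empty, lintegral_zero_measure]

theorem chartVolume_restrict_source (x : M) :
    (chartVolume (n := n) x).restrict (extChartAt (𝓡 n) x).source = chartVolume (n := n) x :=
  Measure.restrict_eq_self_of_ae_mem (by
    rw [ae_iff]; exact chartVolume_compl_source x)

theorem riemVolume_restrict_source (x : M) :
    (riemVolume n M).restrict (extChartAt (𝓡 n) x).source = chartVolume (n := n) x := by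
  have hso : MeasurableSet (extChartAt (𝓡 n) x).source :=
    (isOpen_extChartAt_source x).measurableSet
  have hle : ∀ y : M, chartVolume (n := n) y ≤ riemVolume n M := fun y => le_iSup _ y
  apply le_antisymm
  -- The right side dominates the volume of every chart: inside the source of x all chart volumes
  -- agree on overlaps, outside it they lie below the supremum. Being the least upper bound, the
  -- supremum lies below it too; no countability of the index set is needed.
  · have h1 : riemVolume n M ≤ chartVolume (n := n) x +
        (riemVolume n M).restrict (extChartAt (𝓡 n) x).sourceᶜ := by
      refine iSup_le fun y => ?_
      rw [← Measure.restrict_add_restrict_compl (μ := chartVolume (n := n) y) hso]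
      refine add_le_add ?_ (Measure.restrict_mono le_rfl (hle y))
      refine Measure.le_iff.2 fun s hs => ?_
      rw [Measure.restrict_apply hs, ← chartVolume_restrict_source y,
        Measure.restrict_apply (hs.inter hso)]
      rw [chartVolume_eq_of_subset ((hs.inter hso).inter (isOpen_extChartAt_source y).measurableSet)
        inter_subset_right (x' := x) (fun p hp => hp.1.2)]
      exact measure_mono fun p hp => hp.1.1
    calc (riemVolume n M).restrict (extChartAt (𝓡 n) x).source
        ≤ (chartVolume (n := n) x + (riemVolume n M).restrict
            (extChartAt (𝓡 n) x).sourceᶜ).restrict (extChartAt (𝓡 n) x).source :=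
          Measure.restrict_mono le_rfl h1
      _ = chartVolume (n := n) x := by
          rw [Measure.restrict_add, chartVolume_restrict_source, Measure.restrict_restrict hso,
            inter_compl_self, Measure.restrict_empty, add_zero]
  · rw [← chartVolume_restrict_source x]
    exact Measure.restrict_mono le_rfl (hle x)

variable [IsContMDiffRiemannianBundle (𝓡 n) ∞ (EuclideanSpace ℝ (Fin n))
        (fun x : M => TangentSpace (𝓡 n) x)]

/-- On a compact M this makes the volume finite, so that continuous functions, and bounded
measurable ones, are integrable. -/
instance isLocallyFiniteMeasure_riemVolume : IsLocallyFiniteMeasure (riemVolume n M) := by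
  constructor
  intro x
  set φ := extChartAt (𝓡 n) x with hφ
  have ht : φ.target ∈ nhds (φ x) := extChartAt_target_mem_nhds x
  obtain ⟨K, hK, hKt, hKc⟩ := local_compact_nhds ht
  refine ⟨φ ⁻¹' interior K ∩ φ.source, ?_, ?_⟩
  · exact Filter.inter_mem ((continuousAt_extChartAt x).preimage_mem_nhds (interior_mem_nhds.2 hK))
      (extChartAt_source_mem_nhds x)
  · have hms : MeasurableSet (φ ⁻¹' interior K ∩ φ.source) := by
      rw [inter_comm]
      exact ((continuousOn_extChartAt x).isOpen_inter_preimage (isOpen_extChartAt_source x)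
        isOpen_interior).measurableSet
    have h1 : riemVolume n M (φ ⁻¹' interior K ∩ φ.source) =
        chartVolume (n := n) x (φ ⁻¹' interior K ∩ φ.source) := by
      rw [← riemVolume_restrict_source, Measure.restrict_apply hms, inter_assoc, inter_self]
    rw [h1, chartVolume_apply x hms]
    have hsub : φ.symm ⁻¹' (φ ⁻¹' interior K ∩ φ.source) ∩ φ.target ⊆ K := by
      rintro y ⟨hy, hyt⟩
      have := hy.1
      simp only [mem_preimage] at this
      rw [φ.right_inv hyt] at this
      exact interior_subset this
    refine (lintegral_mono_set hsub).trans_lt ?_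
    have hint : IntegrableOn (volDensity x) K volume :=
      ((contDiffOn_volDensity x).continuousOn.mono hKt).integrableOn_compact hKc
    exact hint.lintegral_lt_top

theorem integral_riemVolume_eq {x : M} {g : M → ℝ} (hg : AEStronglyMeasurable g (riemVolume n M))
    (hsupp : ∀ p, p ∉ (extChartAt (𝓡 n) x).source → g p = 0) :
    ∫ p, g p ∂(riemVolume n M) = ∫ y in (extChartAt (𝓡 n) x).target,
      volDensity x y * g ((extChartAt (𝓡 n) x).symm y) := by
  have hso : MeasurableSet (extChartAt (𝓡 n) x).source :=
    (isOpen_extChartAt_source x).measurableSet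
  have hta : MeasurableSet (extChartAt (𝓡 n) x).target :=
    (isOpen_extChartAt_target x).measurableSet
  rw [← setIntegral_eq_integral_of_forall_compl_eq_zero hsupp, riemVolume_restrict_source]
  have hg' : AEStronglyMeasurable g (chartVolume (n := n) x) := by
    rw [← riemVolume_restrict_source]; exact hg.restrict
  rw [chartVolume] at hg' ⊢
  rw [integral_map (aemeasurable_extChartAt_symm x) hg']
  have h2 : AEMeasurable (volDensity x) (volume.restrict (extChartAt (𝓡 n) x).target) :=
    (contDiffOn_volDensity x).continuousOn.aemeasurable hta
  rw [integral_withDensity_eq_integral_toReal_smul₀ h2.ennreal_ofReal (by simp)]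
  refine setIntegral_congr_fun hta fun y hy => ?_
  simp only [smul_eq_mul]
  rw [ENNReal.toReal_ofReal (volDensity_pos hy).le]

end Volume

/-! ### Product rule at degenerate points and integration by parts -/

section Calculus

variable {X V : Type*} [NormedAddCommGroup X] [NormedSpace ℝ X] [NormedAddCommGroup V]
  [NormedSpace ℝ V]

/-- Since z vanishes at x, it is O(|y − x|) near x, and the variation of c contributes only o(|y −
x|). Continuity of c is thus enough, which lets a power of e₂ fail to be differentiable at the zeros
of e₂. -/
theorem hasFDerivAt_smul_of_eq_zero {c : X → ℝ} {z : X → V} {z' : X →L[ℝ] V} {x : X}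
    (hc : ContinuousAt c x) (hz : HasFDerivAt z z' x) (hzx : z x = 0) :
    HasFDerivAt (fun y => c y • z y) (c x • z') x := by
  rw [hasFDerivAt_iff_isLittleO] at hz ⊢
  simp only [hzx, smul_zero, sub_zero] at hz ⊢
  have h1 : (fun y => c y • (z y - z' (y - x))) =o[nhds x] fun y => y - x := by
    have := (hc.norm.isBoundedUnder_le.isBigO_one ℝ).smul_isLittleO hz
    simpa using this
  have h2 : (fun y => (c y - c x) • z' (y - x)) =o[nhds x] fun y => y - x := by
    have h3 : (fun y => c y - c x) =o[nhds x] (fun _ => (1 : ℝ)) := by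
      rw [Asymptotics.isLittleO_one_iff]
      have h4 : Filter.Tendsto (fun y => c y - c x) (nhds x) (nhds (c x - c x)) :=
        Filter.Tendsto.sub_const hc (c x)
      rwa [sub_self] at h4
    have := h3.smul_isBigO (z'.isBigO_sub (nhds x) x)
    simpa using this
  refine (h1.add h2).congr_left fun y => ?_
  simp only [smul_sub, sub_smul, _root_.smul_apply]
  abel

/-- The product rule for `e ^ s • z`, which persists at zeros of `e` provided `z` vanishes there. -/
theorem hasFDerivAt_rpow_smul {e : X → ℝ} {z : X → V} {e' : X →L[ℝ] ℝ} {z' : X →L[ℝ] V} {x : X}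
    {s : ℝ} (hs : 0 ≤ s) (he : HasFDerivAt e e' x) (hz : HasFDerivAt z z' x)
    (hzx : e x = 0 → z x = 0) :
    HasFDerivAt (fun y => e y ^ s • z y)
      (e x ^ s • z' + ((s * e x ^ (s - 1)) • e').smulRight (z x)) x := by
  by_cases hx : e x = 0
  · have h1 := hasFDerivAt_smul_of_eq_zero (he.continuousAt.rpow_const (Or.inr hs)) hz (hzx hx)
    convert! h1 using 1
    rw [hzx hx]
    ext; simp
  · exact (he.rpow_const (Or.inl hx)).smul hz

variable [MeasurableSpace X] [BorelSpace X] [FiniteDimensional ℝ X] {μ : Measure X}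
  [μ.IsAddHaarMeasure]

/-- Integration by parts against the constant 1. The derivative is assumed bounded rather than
continuous, because that of the flux may be discontinuous at zeros of e₂. -/
theorem integral_fderiv_eq_zero {G : X → ℝ} {K : Set X} (hK : IsCompact K)
    (hG : Differentiable ℝ G) (hGK : ∀ y ∉ K, G y = 0) {C : ℝ}
    (hC : ∀ y ∈ K, ‖fderiv ℝ G y‖ ≤ C) (v : X) :
    Integrable (fun y => fderiv ℝ G y v) μ ∧ ∫ y, fderiv ℝ G y v ∂μ = 0 := by
  have hout : ∀ y ∉ K, fderiv ℝ G y = 0 := by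
    intro y hy
    have : G =ᶠ[nhds y] fun _ => 0 := by
      filter_upwards [hK.isClosed.isOpen_compl.mem_nhds hy] with z hz using hGK z hz
    rw [this.fderiv_eq]; simp
  have hint : Integrable (fun y => fderiv ℝ G y v) μ := by
    have h1 : IntegrableOn (fun y => fderiv ℝ G y v) K μ := by
      refine Measure.integrableOn_of_bounded (M := C * ‖v‖) hK.measure_lt_top.ne
        (measurable_fderiv_apply_const ℝ G v).aestronglyMeasurable ?_
      filter_upwards [ae_restrict_mem hK.measurableSet] with y hy
      exact (ContinuousLinearMap.le_opNorm _ _).trans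
        (mul_le_mul_of_nonneg_right (hC y hy) (norm_nonneg _))
    exact h1.integrable_of_forall_notMem_eq_zero fun y hy => by rw [hout y hy]; rfl
  have hGi : Integrable G μ := by
    have h1 : IntegrableOn G K μ := hG.continuous.continuousOn.integrableOn_compact hK
    exact h1.integrable_of_forall_notMem_eq_zero hGK
  refine ⟨hint, ?_⟩
  have := integral_mul_fderiv_eq_neg_fderiv_mul_of_integrable (μ := μ) (𝕜 := ℝ)
    (f := fun _ : X => (1 : ℝ)) (g := G) (v := v) (by simp) (by simpa using hint)
    (by simpa using hGi) (fun _ _ => differentiableAt_const _) (fun y _ => hG y)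
  simpa using this

variable {W : Type*} [NormedAddCommGroup W] [InnerProductSpace ℝ W]

theorem integral_inner_fderiv_add {U K : Set X} (hU : IsOpen U) (hK : IsCompact K) (hKU : K ⊆ U)
    {F H : X → W} (hF : ∀ y ∈ U, DifferentiableAt ℝ F y) {C : ℝ}
    (hC : ∀ y ∈ K, ‖fderiv ℝ F y‖ ≤ C) (hH : ContDiffOn ℝ 1 H U) (hHK : ∀ y ∉ K, H y = 0) (v : X) :
    Integrable (fun y => inner ℝ (fderiv ℝ F y v) (H y) + inner ℝ (F y) (fderiv ℝ H y v))
        (μ.restrict U) ∧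
      ∫ y in U, (inner ℝ (fderiv ℝ F y v) (H y) + inner ℝ (F y) (fderiv ℝ H y v)) ∂μ = 0 := by
  have hHd : ∀ y ∈ U, DifferentiableAt ℝ H y := fun y hy =>
    (hH.differentiableOn (by simp)).differentiableAt (hU.mem_nhds hy)
  set G : X → ℝ := fun y => inner ℝ (F y) (H y) with hG
  have hGd : ∀ y ∈ U, HasFDerivAt G
      ((fderivInnerCLM ℝ (F y, H y)).comp ((fderiv ℝ F y).prod (fderiv ℝ H y))) y := fun y hy =>
    (hF y hy).hasFDerivAt.inner ℝ (hHd y hy).hasFDerivAt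
  have hGK : ∀ y ∉ K, G y = 0 := fun y hy => by simp [hG, hHK y hy]
  have hdiff : Differentiable ℝ G := by
    intro y
    by_cases hy : y ∈ U
    · exact (hGd y hy).differentiableAt
    · have : G =ᶠ[nhds y] fun _ => 0 := by
        filter_upwards [hK.isClosed.isOpen_compl.mem_nhds (fun h => hy (hKU h))] with z hz
          using hGK z hz
      exact (differentiableAt_const _).congr_of_eventuallyEq this
  have happ : ∀ y ∈ U, ∀ v, fderiv ℝ G y v =
      inner ℝ (fderiv ℝ F y v) (H y) + inner ℝ (F y) (fderiv ℝ H y v) := by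
    intro y hy v
    rw [(hGd y hy).fderiv]
    simp [fderivInnerCLM_apply, add_comm]
  obtain ⟨C1, hC1⟩ := hK.exists_bound_of_continuousOn
    (fun y hy => ((hF y (hKU hy)).continuousAt.continuousWithinAt : ContinuousWithinAt F K y))
  obtain ⟨C2, hC2⟩ := hK.exists_bound_of_continuousOn (hH.continuousOn.mono hKU)
  obtain ⟨C3, hC3⟩ := hK.exists_bound_of_continuousOn
    ((hH.continuousOn_fderiv_of_isOpen hU le_rfl).mono hKU)
  have hbd : ∀ y ∈ K, ‖fderiv ℝ G y‖ ≤ C * C2 + C1 * C3 := by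
    intro y hy
    have hCn : 0 ≤ C := (norm_nonneg _).trans (hC y hy)
    have hC1n : 0 ≤ C1 := (norm_nonneg _).trans (hC1 y hy)
    have hC2n : 0 ≤ C2 := (norm_nonneg _).trans (hC2 y hy)
    have hC3n : 0 ≤ C3 := (norm_nonneg _).trans (hC3 y hy)
    refine ContinuousLinearMap.opNorm_le_bound _ (by positivity) fun v => ?_
    rw [happ y (hKU hy)]
    refine (norm_add_le _ _).trans ?_
    rw [add_mul]
    refine add_le_add ?_ ?_
    · refine (norm_inner_le_norm _ _).trans ?_
      have h1 := (ContinuousLinearMap.le_opNorm (fderiv ℝ F y) v).trans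
        (mul_le_mul_of_nonneg_right (hC y hy) (norm_nonneg _))
      calc _ ≤ (C * ‖v‖) * C2 := mul_le_mul h1 (hC2 y hy) (norm_nonneg _) (by positivity)
        _ = _ := by ring
    · refine (norm_inner_le_norm _ _).trans ?_
      have h1 := (ContinuousLinearMap.le_opNorm (fderiv ℝ H y) v).trans
        (mul_le_mul_of_nonneg_right (hC3 y hy) (norm_nonneg _))
      calc _ ≤ C1 * (C3 * ‖v‖) := mul_le_mul (hC1 y hy) h1 (norm_nonneg _) (by positivity)
        _ = _ := by ring
  obtain ⟨hi, h0⟩ := integral_fderiv_eq_zero (μ := μ) hK hdiff hGK hbd v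
  constructor
  · exact (integrableOn_congr_fun (fun y hy => happ y hy v) hU.measurableSet).1 hi.integrableOn
  · have h1 := setIntegral_congr_fun (μ := μ) hU.measurableSet fun y hy => (happ y hy v).symm
    rw [h1, setIntegral_eq_integral_of_forall_compl_eq_zero, h0]
    intro y hy
    have : G =ᶠ[nhds y] fun _ => 0 := by
      filter_upwards [hK.isClosed.isOpen_compl.mem_nhds (fun h => hy (hKU h))] with z hz
        using hGK z hz
    rw [this.fderiv_eq]; simp

end Calculus

/-! ### Smooth maps on M, their differentials and e₂ -/

section Spatial

variable {n : ℕ} {M : Type*} [TopologicalSpace M] [ChartedSpace (EuclideanSpace ℝ (Fin n)) M]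

/-- Smoothness of a map on a manifold, expressed in the preferred charts. -/
def ChartSmooth (n : ℕ) {M V : Type*} [TopologicalSpace M]
    [ChartedSpace (EuclideanSpace ℝ (Fin n)) M] [NormedAddCommGroup V] [NormedSpace ℝ V]
    (F : M → V) : Prop :=
  ∀ x : M, ContDiffOn ℝ ∞ (F ∘ (extChartAt (𝓡 n) x).symm) (extChartAt (𝓡 n) x).target

variable {V : Type*} [NormedAddCommGroup V] [NormedSpace ℝ V]

theorem ChartSmooth.differentiableAt {F : M → V} (hF : ChartSmooth n F) {x : M}
    {y : EuclideanSpace ℝ (Fin n)} (hy : y ∈ (extChartAt (𝓡 n) x).target) :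
    DifferentiableAt ℝ (F ∘ (extChartAt (𝓡 n) x).symm) y :=
  ((hF x).differentiableOn (by simp)).differentiableAt ((isOpen_extChartAt_target x).mem_nhds hy)

theorem ChartSmooth.contDiffOn_partial {F : M → V} (hF : ChartSmooth n F) (x : M) (i : Fin n) :
    ContDiffOn ℝ ∞ (fun y => fderiv ℝ (F ∘ (extChartAt (𝓡 n) x).symm) y
      (EuclideanSpace.single i (1 : ℝ))) (extChartAt (𝓡 n) x).target :=
  ((hF x).fderiv_of_isOpen (isOpen_extChartAt_target x) (by simp)).clm_apply contDiffOn_const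

variable [IsManifold (𝓡 n) ∞ M]

theorem ChartSmooth.mdifferentiableAt {F : M → V} (hF : ChartSmooth n F) (p : M) :
    MDifferentiableAt (𝓡 n) 𝓘(ℝ, V) F p := by
  have h := mdifferentiableAt_of_comp_symm (mem_extChartAt_target p)
    (hF.differentiableAt (mem_extChartAt_target p))
  rwa [extChartAt_to_inv] at h

theorem ChartSmooth.continuous {F : M → V} (hF : ChartSmooth n F) : Continuous F :=
  continuous_iff_continuousAt.2 fun p => (hF.mdifferentiableAt p).continuousAt

theorem chartSmooth_of_contMDiff {F : M → V} (hF : ContMDiff (𝓡 n) 𝓘(ℝ, V) ∞ F) :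
    ChartSmooth n F := by
  intro x
  rw [← contMDiffOn_iff_contDiffOn]
  exact hF.comp_contMDiffOn (contMDiffOn_extChartAt_symm x)

variable [RiemannianBundle (fun x : M => TangentSpace (𝓡 n) x)] {L : ℕ}

/-- The components of `dF` at `p` in an orthonormal frame. -/
noncomputable def frameDiff (n : ℕ) {L : ℕ} {M : Type*} [TopologicalSpace M]
    [ChartedSpace (EuclideanSpace ℝ (Fin n)) M]
    [RiemannianBundle (fun x : M => TangentSpace (𝓡 n) x)]
    (F : M → EuclideanSpace ℝ (Fin L)) (p : M)
    (k : Fin (Module.finrank ℝ (TangentSpace (𝓡 n) p))) : EuclideanSpace ℝ (Fin L) :=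
  haveI : FiniteDimensional ℝ (TangentSpace (𝓡 n) p) :=
    inferInstanceAs (FiniteDimensional ℝ (EuclideanSpace ℝ (Fin n)))
  diffAt F p (stdOrthonormalBasis ℝ (TangentSpace (𝓡 n) p) k)

omit [IsManifold (𝓡 n) ∞ M] in
theorem gradInner_eq_sum (F G : M → EuclideanSpace ℝ (Fin L)) (p : M) :
    gradInner n F G p = ∑ k, inner ℝ (frameDiff n F p k) (frameDiff n G p k) := rfl

omit [IsManifold (𝓡 n) ∞ M] in
theorem normSqDiff_eq_gradInner (F : M → EuclideanSpace ℝ (Fin L)) :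
    normSqDiff (n := n) F = gradInner n F F := rfl

omit [IsManifold (𝓡 n) ∞ M] in
theorem gradInner_comm (F G : M → EuclideanSpace ℝ (Fin L)) (p : M) :
    gradInner n F G p = gradInner n G F p := by
  simp only [gradInner_eq_sum, real_inner_comm]

omit [IsManifold (𝓡 n) ∞ M] in
theorem normSqDiff_nonneg (F : M → EuclideanSpace ℝ (Fin L)) (p : M) :
    0 ≤ normSqDiff (n := n) F p := by
  rw [normSqDiff_eq_gradInner, gradInner_eq_sum]
  exact Finset.sum_nonneg fun k _ => real_inner_self_nonneg

omit [IsManifold (𝓡 n) ∞ M] in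
theorem norm_diffAt_sq_le (F : M → EuclideanSpace ℝ (Fin L)) (p : M)
    (v : TangentSpace (𝓡 n) p) : ‖diffAt F p v‖ ^ 2 ≤ normSqDiff (n := n) F p * ‖v‖ ^ 2 := by
  have : FiniteDimensional ℝ (TangentSpace (𝓡 n) p) :=
    inferInstanceAs (FiniteDimensional ℝ (EuclideanSpace ℝ (Fin n)))
  set b := stdOrthonormalBasis ℝ (TangentSpace (𝓡 n) p) with hb
  have h1 : ‖diffAt F p v‖ ≤ ∑ k, |inner ℝ (b k) v| * ‖frameDiff n F p k‖ := by
    have h2 : diffAt F p v = ∑ k, (inner ℝ (b k) v) • frameDiff n F p k := by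
      conv_lhs => rw [← b.sum_repr' v]
      rw [map_sum]
      exact Finset.sum_congr rfl fun k _ => map_smul _ _ _
    rw [h2]
    refine (norm_sum_le _ _).trans (le_of_eq (Finset.sum_congr rfl fun k _ => ?_))
    rw [norm_smul, Real.norm_eq_abs]
  have h3 := Finset.sum_mul_sq_le_sq_mul_sq Finset.univ (fun k => |inner ℝ (b k) v|)
    (fun k => ‖frameDiff n F p k‖)
  have h4 : ∑ k, |inner ℝ (b k) v| ^ 2 = ‖v‖ ^ 2 := by
    rw [← b.sum_sq_norm_inner_right v]
    rfl
  have h5 : ∑ k, ‖frameDiff n F p k‖ ^ 2 = normSqDiff (n := n) F p := by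
    rw [normSqDiff_eq_gradInner, gradInner_eq_sum]
    exact Finset.sum_congr rfl fun k _ => (real_inner_self_eq_norm_sq _).symm
  rw [h4, h5] at h3
  calc ‖diffAt F p v‖ ^ 2 ≤ _ := pow_le_pow_left₀ (norm_nonneg _) h1 2
    _ ≤ _ := h3
    _ = _ := mul_comm _ _

variable [IsContMDiffRiemannianBundle (𝓡 n) ∞ (EuclideanSpace ℝ (Fin n))
        (fun x : M => TangentSpace (𝓡 n) x)]

theorem ChartSmooth.gradInner {F G : M → EuclideanSpace ℝ (Fin L)} (hF : ChartSmooth n F)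
    (hG : ChartSmooth n G) : ChartSmooth n (gradInner n F G) := by
  intro x
  have h : ContDiffOn ℝ ∞ (fun y => ∑ i, ∑ j, (gramMatrix x y)⁻¹ i j *
      inner ℝ (fderiv ℝ (F ∘ (extChartAt (𝓡 n) x).symm) y (EuclideanSpace.single i (1 : ℝ)))
        (fderiv ℝ (G ∘ (extChartAt (𝓡 n) x).symm) y (EuclideanSpace.single j (1 : ℝ))))
      (extChartAt (𝓡 n) x).target :=
    ContDiffOn.sum fun i _ => ContDiffOn.sum fun j _ =>
      (contDiffOn_inv_gramMatrix x i j).mul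
        ((hF.contDiffOn_partial x i).inner ℝ (hG.contDiffOn_partial x j))
  exact h.congr fun y hy => gradInner_eq_gram hy (hF.differentiableAt hy) (hG.differentiableAt hy)

theorem ChartSmooth.e2 {F : M → EuclideanSpace ℝ (Fin L)} (hF : ChartSmooth n F) (ε : ℝ) :
    ChartSmooth n (e2 n ε F) := fun x => contDiffOn_const.add ((hF.gradInner hF) x)

omit [IsManifold (𝓡 n) ∞ M] [IsContMDiffRiemannianBundle (𝓡 n) ∞ (EuclideanSpace ℝ (Fin n))
        (fun x : M => TangentSpace (𝓡 n) x)] in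
theorem normSqDiff_le_e2 {ε : ℝ} (hε : 0 ≤ ε) (F : M → EuclideanSpace ℝ (Fin L)) (p : M) :
    normSqDiff (n := n) F p ≤ e2 n ε F p := le_add_of_nonneg_left hε

omit [IsManifold (𝓡 n) ∞ M] [IsContMDiffRiemannianBundle (𝓡 n) ∞ (EuclideanSpace ℝ (Fin n))
        (fun x : M => TangentSpace (𝓡 n) x)] in
theorem e2_nonneg {ε : ℝ} (hε : 0 ≤ ε) (F : M → EuclideanSpace ℝ (Fin L)) (p : M) :
    0 ≤ e2 n ε F p := (normSqDiff_nonneg F p).trans (normSqDiff_le_e2 hε F p)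

/-- The bound `|∂ⱼF| ≤ √g_{jj} |dF|`. -/
theorem norm_partial_le {F : M → EuclideanSpace ℝ (Fin L)} (hF : ChartSmooth n F) {x : M}
    {y : EuclideanSpace ℝ (Fin n)} (hy : y ∈ (extChartAt (𝓡 n) x).target) (j : Fin n) :
    ‖fderiv ℝ (F ∘ (extChartAt (𝓡 n) x).symm) y (EuclideanSpace.single j (1 : ℝ))‖ ≤
      Real.sqrt (gramMatrix x y j j) *
        Real.sqrt (normSqDiff (n := n) F ((extChartAt (𝓡 n) x).symm y)) := by
  rw [← mfderiv_coordVec hy (hF.differentiableAt hy)]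
  have h := norm_diffAt_sq_le F _ (coordVec x y j)
  have h1 : gramMatrix x y j j = ‖coordVec x y j‖ ^ 2 := by
    simp only [gramMatrix, Matrix.of_apply]
    exact real_inner_self_eq_norm_sq _
  rw [h1, Real.sqrt_sq (norm_nonneg _)]
  refine le_of_sq_le_sq ?_ (by positivity)
  rw [mul_pow, Real.sq_sqrt (normSqDiff_nonneg _ _), mul_comm]
  exact h

end Spatial

/-! ### The weak form of the regularized Laplacian -/

section Divergence

variable {n : ℕ} {M : Type*} [TopologicalSpace M] [ChartedSpace (EuclideanSpace ℝ (Fin n)) M]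
  [IsManifold (𝓡 n) ∞ M] [RiemannianBundle (fun x : M => TangentSpace (𝓡 n) x)] {L : ℕ}
  [IsContMDiffRiemannianBundle (𝓡 n) ∞ (EuclideanSpace ℝ (Fin n))
        (fun x : M => TangentSpace (𝓡 n) x)]

/-- The coordinate components of the flux `√|g| e₂^{n/2-1} dF` of the regularized Laplacian. -/
noncomputable def flux (ε : ℝ) (F : M → EuclideanSpace ℝ (Fin L)) (x : M) (i : Fin n)
    (y : EuclideanSpace ℝ (Fin n)) : EuclideanSpace ℝ (Fin L) :=
  (volDensity x y * e2 n ε F ((extChartAt (𝓡 n) x).symm y) ^ ((n : ℝ) / 2 - 1)) •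
    ∑ j : Fin n, (gramMatrix x y)⁻¹ i j •
      fderiv ℝ (F ∘ (extChartAt (𝓡 n) x).symm) y (EuclideanSpace.single j (1 : ℝ))

/-- The flux without the factor `e₂^{n/2-1}`. -/
noncomputable def linFlux (F : M → EuclideanSpace ℝ (Fin L)) (x : M) (i : Fin n)
    (y : EuclideanSpace ℝ (Fin n)) : EuclideanSpace ℝ (Fin L) :=
  volDensity x y • ∑ j : Fin n, (gramMatrix x y)⁻¹ i j •
      fderiv ℝ (F ∘ (extChartAt (𝓡 n) x).symm) y (EuclideanSpace.single j (1 : ℝ))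

omit [IsManifold (𝓡 n) ∞ M] [IsContMDiffRiemannianBundle (𝓡 n) ∞ (EuclideanSpace ℝ (Fin n))
        (fun x : M => TangentSpace (𝓡 n) x)] in
theorem flux_eq (ε : ℝ) (F : M → EuclideanSpace ℝ (Fin L)) (x : M) (i : Fin n) :
    flux ε F x i = fun y => e2 n ε F ((extChartAt (𝓡 n) x).symm y) ^ ((n : ℝ) / 2 - 1) •
      linFlux F x i y := by
  funext y
  rw [flux, linFlux, smul_smul, mul_comm]

variable {ε : ℝ} {F : M → EuclideanSpace ℝ (Fin L)}

theorem contDiffOn_linFlux (hF : ChartSmooth n F) (x : M) (i : Fin n) :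
    ContDiffOn ℝ ∞ (linFlux F x i) (extChartAt (𝓡 n) x).target :=
  (contDiffOn_volDensity x).smul (ContDiffOn.sum fun j _ =>
    (contDiffOn_inv_gramMatrix x i j).smul (hF.contDiffOn_partial x j))

/-- The factor √e₂ has two uses: it makes the flux vanish where e₂ does, so the degenerate product
rule applies, and it compensates the power e₂^{s−1} in the derivative, where s = n/2 − 1. -/
theorem norm_linFlux_le (hε : 0 ≤ ε) (hF : ChartSmooth n F) (x : M) (i : Fin n)
    {y : EuclideanSpace ℝ (Fin n)} (hy : y ∈ (extChartAt (𝓡 n) x).target) :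
    ‖linFlux F x i y‖ ≤ (volDensity x y * ∑ j, |(gramMatrix x y)⁻¹ i j| *
      Real.sqrt (gramMatrix x y j j)) * Real.sqrt (e2 n ε F ((extChartAt (𝓡 n) x).symm y)) := by
  rw [linFlux, norm_smul, Real.norm_eq_abs, abs_of_pos (volDensity_pos hy), mul_assoc]
  refine mul_le_mul_of_nonneg_left ?_ (volDensity_pos hy).le
  refine (norm_sum_le _ _).trans ?_
  rw [Finset.sum_mul]
  refine Finset.sum_le_sum fun j _ => ?_
  rw [norm_smul, Real.norm_eq_abs, mul_assoc]
  refine mul_le_mul_of_nonneg_left ?_ (abs_nonneg _)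
  exact (norm_partial_le hF hy j).trans (mul_le_mul_of_nonneg_left
    (Real.sqrt_le_sqrt (normSqDiff_le_e2 hε F _)) (Real.sqrt_nonneg _))

theorem hasFDerivAt_flux (hn : 2 ≤ n) (hε : 0 ≤ ε) (hF : ChartSmooth n F) (x : M) (i : Fin n)
    {y : EuclideanSpace ℝ (Fin n)} (hy : y ∈ (extChartAt (𝓡 n) x).target) :
    HasFDerivAt (flux ε F x i)
      ((e2 n ε F ((extChartAt (𝓡 n) x).symm y) ^ ((n : ℝ) / 2 - 1)) • fderiv ℝ (linFlux F x i) y +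
        ((((n : ℝ) / 2 - 1) * e2 n ε F ((extChartAt (𝓡 n) x).symm y) ^ ((n : ℝ) / 2 - 1 - 1)) •
          fderiv ℝ (e2 n ε F ∘ (extChartAt (𝓡 n) x).symm) y).smulRight (linFlux F x i y)) y := by
  rw [flux_eq]
  have hs : (0 : ℝ) ≤ (n : ℝ) / 2 - 1 := by
    have : (2 : ℝ) ≤ n := by exact_mod_cast hn
    linarith
  refine hasFDerivAt_rpow_smul (e := e2 n ε F ∘ (extChartAt (𝓡 n) x).symm) hs
    ((hF.e2 ε).differentiableAt hy).hasFDerivAt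
    (((contDiffOn_linFlux hF x i).differentiableOn (by simp)).differentiableAt
      ((isOpen_extChartAt_target x).mem_nhds hy)).hasFDerivAt ?_
  intro h0
  have := norm_linFlux_le hε hF x i hy
  simp only [Function.comp] at h0
  rw [h0, Real.sqrt_zero, mul_zero] at this
  exact norm_le_zero_iff.1 this

theorem exists_bound_fderiv_flux (hn : 2 ≤ n) (hε : 0 ≤ ε) (hF : ChartSmooth n F) (x : M)
    (i : Fin n) {K : Set (EuclideanSpace ℝ (Fin n))} (hK : IsCompact K)
    (hKt : K ⊆ (extChartAt (𝓡 n) x).target) :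
    ∃ C, ∀ y ∈ K, ‖fderiv ℝ (flux ε F x i) y‖ ≤ C := by
  set s : ℝ := (n : ℝ) / 2 - 1 with hs
  set e := e2 n ε F ∘ (extChartAt (𝓡 n) x).symm with he
  have hto := isOpen_extChartAt_target (I := 𝓡 n) x
  have he0 : ∀ y, 0 ≤ e y := fun y => e2_nonneg hε F _
  have hs0 : 0 ≤ s := by
    have : (2 : ℝ) ≤ n := by exact_mod_cast hn
    linarith
  -- As n is an integer, either n = 2 and the singular term has coefficient s = 0, or s ≥ 1/2 and
  -- e₂^{s−1} √e₂ = e₂^{s−1/2} stays bounded.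
  have hs1 : s = 0 ∨ 1 / 2 ≤ s := by
    rcases hn.eq_or_lt with h | h
    · left; rw [hs, ← h]; norm_num
    · right
      have : (3 : ℝ) ≤ n := by exact_mod_cast h
      linarith
  have hec : ContinuousOn e K := ((hF.e2 ε) x).continuousOn.mono hKt
  obtain ⟨C1, hC1⟩ := hK.exists_bound_of_continuousOn (hec.rpow_const fun y _ => Or.inr hs0)
  obtain ⟨C2, hC2⟩ := hK.exists_bound_of_continuousOn
    (((contDiffOn_linFlux hF x i).continuousOn_fderiv_of_isOpen hto (by simp)).mono hKt)
  obtain ⟨C3, hC3⟩ := hK.exists_bound_of_continuousOn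
    ((((hF.e2 ε) x).continuousOn_fderiv_of_isOpen hto (by simp)).mono hKt)
  have hcont : ContinuousOn (fun y => volDensity x y * ∑ j, |(gramMatrix x y)⁻¹ i j| *
      Real.sqrt (gramMatrix x y j j)) K := by
    refine ContinuousOn.mul ((contDiffOn_volDensity x).continuousOn.mono hKt) ?_
    refine continuousOn_finsetSum _ fun j _ => ContinuousOn.mul ?_ ?_
    · exact ((contDiffOn_inv_gramMatrix x i j).continuousOn.mono hKt).abs
    · exact ((contDiffOn_gramMatrix x j j).continuousOn.mono hKt).sqrt
  obtain ⟨C4, hC4⟩ := hK.exists_bound_of_continuousOn hcont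
  have h5 : ∃ C5, 0 ≤ C5 ∧ ∀ y ∈ K, s * e y ^ (s - 1) * Real.sqrt (e y) ≤ C5 := by
    rcases hs1 with h | h
    · exact ⟨0, le_rfl, fun y _ => by rw [h]; simp⟩
    · obtain ⟨C5, hC5⟩ := hK.exists_bound_of_continuousOn
        (hec.rpow_const (p := s - 1 / 2) fun y _ => Or.inr (by linarith))
      refine ⟨s * |C5|, by positivity, fun y hy => ?_⟩
      rw [mul_assoc]
      refine mul_le_mul_of_nonneg_left ?_ hs0
      rcases (he0 y).eq_or_lt with h0 | h0
      -- At a zero of e₂ the factor √e₂ is 0, whatever value the power takes there.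
      · rw [← h0]; simp
      · rw [Real.sqrt_eq_rpow, ← Real.rpow_add h0, show s - 1 + 1 / 2 = s - 1 / 2 by ring]
        exact (le_abs_self _).trans ((hC5 y hy).trans (le_abs_self _))
  obtain ⟨C5, hC5n, hC5⟩ := h5
  refine ⟨C1 * C2 + C5 * C3 * C4, fun y hy => ?_⟩
  have hC1n : 0 ≤ C1 := (norm_nonneg _).trans (hC1 y hy)
  have hC3n : 0 ≤ C3 := (norm_nonneg _).trans (hC3 y hy)
  have hC4n : 0 ≤ C4 := (norm_nonneg _).trans (hC4 y hy)
  rw [(hasFDerivAt_flux hn hε hF x i (hKt hy)).fderiv]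
  refine (norm_add_le _ _).trans (add_le_add ?_ ?_)
  · rw [norm_smul]
    exact mul_le_mul (hC1 y hy) (hC2 y hy) (norm_nonneg _) hC1n
  · rw [ContinuousLinearMap.norm_smulRight_apply, norm_smul]
    have h6 := norm_linFlux_le hε hF x i (hKt hy)
    have h7 := (le_abs_self _).trans (hC4 y hy)
    have h8 : ‖linFlux F x i y‖ ≤ C4 * Real.sqrt (e y) :=
      h6.trans (mul_le_mul_of_nonneg_right h7 (Real.sqrt_nonneg _))
    have h9 : 0 ≤ s * e y ^ (s - 1) := mul_nonneg hs0 (Real.rpow_nonneg (he0 y) _)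
    rw [Real.norm_eq_abs]
    change |s * e y ^ (s - 1)| * ‖fderiv ℝ e y‖ * _ ≤ _
    rw [abs_of_nonneg h9]
    calc s * e y ^ (s - 1) * ‖fderiv ℝ e y‖ * ‖linFlux F x i y‖
        ≤ s * e y ^ (s - 1) * C3 * (C4 * Real.sqrt (e y)) := by
          gcongr
          exact hC3 y hy
      _ = (s * e y ^ (s - 1) * Real.sqrt (e y)) * C3 * C4 := by ring
      _ ≤ C5 * C3 * C4 := by
          gcongr
          exact hC5 y hy

theorem sum_inner_flux {ψ : M → EuclideanSpace ℝ (Fin L)} (hF : ChartSmooth n F)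
    (hψ : ChartSmooth n ψ) {x : M} {y : EuclideanSpace ℝ (Fin n)}
    (hy : y ∈ (extChartAt (𝓡 n) x).target) :
    ∑ i, inner ℝ (flux ε F x i y) (fderiv ℝ (ψ ∘ (extChartAt (𝓡 n) x).symm) y
      (EuclideanSpace.single i (1 : ℝ))) =
    volDensity x y * (e2 n ε F ((extChartAt (𝓡 n) x).symm y) ^ ((n : ℝ) / 2 - 1) *
      gradInner n F ψ ((extChartAt (𝓡 n) x).symm y)) := by
  rw [gradInner_comm, gradInner_eq_gram hy (hψ.differentiableAt hy) (hF.differentiableAt hy),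
    Finset.mul_sum, Finset.mul_sum]
  refine Finset.sum_congr rfl fun i _ => ?_
  rw [flux, real_inner_smul_left, sum_inner, Finset.mul_sum, Finset.mul_sum, Finset.mul_sum]
  refine Finset.sum_congr rfl fun j _ => ?_
  rw [real_inner_smul_left, real_inner_comm]
  ring

variable [MeasurableSpace M] [BorelSpace M] [CompactSpace M] [T2Space M]

theorem gradInner_eq_zero_of_notMem_tsupport (F : M → EuclideanSpace ℝ (Fin L))
    {ψ : M → EuclideanSpace ℝ (Fin L)} {p : M} (hp : p ∉ tsupport ψ) : gradInner n F ψ p = 0 := by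
  have h : ψ =ᶠ[nhds p] fun _ => 0 := notMem_tsupport_iff_eventuallyEq.1 hp
  have h1 : diffAt (m := n) ψ p = 0 := by
    rw [diffAt, h.mfderiv_eq, mfderiv_const]
    rfl
  rw [gradInner_eq_sum]
  refine Finset.sum_eq_zero fun k _ => ?_
  rw [frameDiff, frameDiff, h1]
  simp

theorem integrable_of_continuous {g : M → ℝ} (hg : Continuous g) :
    Integrable g (riemVolume n M) :=
  hg.integrable_of_hasCompactSupport (HasCompactSupport.of_compactSpace g)

theorem continuous_e2_rpow (hn : 2 ≤ n) (hF : ChartSmooth n F) :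
    Continuous fun p => e2 n ε F p ^ ((n : ℝ) / 2 - 1) :=
  (hF.e2 ε).continuous.rpow_const fun _ => Or.inr (by
    have : (2 : ℝ) ≤ n := by exact_mod_cast hn
    linarith)

/-- The weak form of the regularized Laplacian, for test maps supported in a chart. -/
theorem integral_inner_regLaplacian_of_tsupport (hn : 2 ≤ n) (hε : 0 ≤ ε) (hF : ChartSmooth n F)
    {T : M → EuclideanSpace ℝ (Fin L)} (hT : Continuous T) {x : M}
    (hTx : ∀ p ∈ (extChartAt (𝓡 n) x).source, T p = regLaplacian (n := n) ε F x p)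
    {ψ : M → EuclideanSpace ℝ (Fin L)} (hψ : ChartSmooth n ψ)
    (hsupp : tsupport ψ ⊆ (extChartAt (𝓡 n) x).source) :
    ∫ p, inner ℝ (T p) (ψ p) ∂(riemVolume n M) =
      - ∫ p, e2 n ε F p ^ ((n : ℝ) / 2 - 1) * gradInner n F ψ p ∂(riemVolume n M) := by
  set φ := extChartAt (𝓡 n) x with hφ
  have hto : IsOpen φ.target := isOpen_extChartAt_target x
  have hout : ∀ p, p ∉ φ.source → p ∉ tsupport ψ := fun p hp h => hp (hsupp h)
  rw [integral_riemVolume_eq (x := x), integral_riemVolume_eq (x := x), eq_neg_iff_add_eq_zero]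
  rotate_left
  · exact ((continuous_e2_rpow hn hF).mul (hF.gradInner hψ).continuous).aestronglyMeasurable
  · intro p hp
    rw [gradInner_eq_zero_of_notMem_tsupport F (hout p hp), mul_zero]
  · exact (hT.inner hψ.continuous).aestronglyMeasurable
  · intro p hp
    rw [image_eq_zero_of_notMem_tsupport (hout p hp), inner_zero_right]
  set K : Set (EuclideanSpace ℝ (Fin n)) := φ '' tsupport ψ with hKdef
  have hK : IsCompact K := (isClosed_tsupport ψ).isCompact.image_of_continuousOn
    ((continuousOn_extChartAt x).mono hsupp)
  have hKt : K ⊆ φ.target := by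
    rintro _ ⟨p, hp, rfl⟩; exact φ.map_source (hsupp hp)
  -- The inverse chart has meaningless values off its target, so the test map is cut to 0 there; it
  -- is already 0 on the target outside the compact set K.
  set H : EuclideanSpace ℝ (Fin n) → EuclideanSpace ℝ (Fin L) :=
    φ.target.indicator (ψ ∘ φ.symm) with hH
  have hHeq : ∀ y ∈ φ.target, H =ᶠ[nhds y] ψ ∘ φ.symm := by
    intro y hy
    filter_upwards [hto.mem_nhds hy] with z hz using indicator_of_mem hz _
  have hHc : ContDiffOn ℝ 1 H φ.target :=
    ((hψ x).of_le (by simp)).congr fun y hy => indicator_of_mem hy _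
  have hHK : ∀ y ∉ K, H y = 0 := by
    intro y hy
    by_cases hyt : y ∈ φ.target
    · rw [hH, indicator_of_mem hyt]
      change ψ (φ.symm y) = 0
      refine image_eq_zero_of_notMem_tsupport fun h => hy ⟨_, h, φ.right_inv hyt⟩
    · exact indicator_of_notMem hyt _
  choose C hC using fun i => exists_bound_fderiv_flux (ε := ε) hn hε hF x i hK hKt
  have key := fun i : Fin n => integral_inner_fderiv_add (μ := volume) hto hK hKt
    (fun y hy => (hasFDerivAt_flux (ε := ε) hn hε hF x i hy).differentiableAt) (hC i) hHc hHK
    (EuclideanSpace.single i (1 : ℝ))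
  have hsum : ∫ y in φ.target, ∑ i, (inner ℝ (fderiv ℝ (flux ε F x i) y
      (EuclideanSpace.single i (1 : ℝ))) (H y) + inner ℝ (flux ε F x i y)
      (fderiv ℝ H y (EuclideanSpace.single i (1 : ℝ)))) = 0 := by
    rw [integral_finsetSum _ fun i _ => (key i).1]
    exact Finset.sum_eq_zero fun i _ => (key i).2
  have hA : ∀ y ∈ φ.target, ∑ i, inner ℝ (fderiv ℝ (flux ε F x i) y
      (EuclideanSpace.single i (1 : ℝ))) (H y) =
      volDensity x y * inner ℝ (T (φ.symm y)) (ψ (φ.symm y)) := by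
    intro y hy
    rw [hTx _ (φ.map_target hy), regLaplacian, φ.right_inv hy, real_inner_smul_left,
      ← mul_assoc, mul_inv_cancel₀ (volDensity_pos hy).ne', one_mul, sum_inner,
      (hHeq y hy).self_of_nhds]
    rfl
  have hB : ∀ y ∈ φ.target, ∑ i, inner ℝ (flux ε F x i y)
      (fderiv ℝ H y (EuclideanSpace.single i (1 : ℝ))) =
      volDensity x y * (e2 n ε F (φ.symm y) ^ ((n : ℝ) / 2 - 1) *
        gradInner n F ψ (φ.symm y)) := by
    intro y hy
    rw [(hHeq y hy).fderiv_eq]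
    exact sum_inner_flux hF hψ hy
  have hzero : ∀ y ∈ φ.target, y ∉ K → ψ (φ.symm y) = 0 ∧ gradInner n F ψ (φ.symm y) = 0 := by
    intro y hyt hy
    have : φ.symm y ∉ tsupport ψ := fun h => hy ⟨_, h, φ.right_inv hyt⟩
    exact ⟨image_eq_zero_of_notMem_tsupport this, gradInner_eq_zero_of_notMem_tsupport F this⟩
  have hsym : ContinuousOn φ.symm φ.target := continuousOn_extChartAt_symm x
  have hvol : ContinuousOn (volDensity x) φ.target := (contDiffOn_volDensity x).continuousOn
  have hint : ∀ g : M → ℝ, Continuous g → (∀ y ∈ φ.target, y ∉ K → g (φ.symm y) = 0) →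
      IntegrableOn (fun y => volDensity x y * g (φ.symm y)) φ.target := by
    intro g hg hg0
    have h1 : IntegrableOn (fun y => volDensity x y * g (φ.symm y)) K :=
      ((hvol.mul (hg.comp_continuousOn hsym)).mono hKt).integrableOn_compact hK
    refine (h1.of_forall_sdiff_eq_zero hto.measurableSet fun y hy => ?_)
    rw [hg0 y hy.1 hy.2, mul_zero]
  rw [← integral_add (hint (fun p => inner ℝ (T p) (ψ p)) (hT.inner hψ.continuous)
      fun y hy hyK => by rw [(hzero y hy hyK).1, inner_zero_right])
    (hint (fun p => e2 n ε F p ^ ((n : ℝ) / 2 - 1) * gradInner n F ψ p)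
      ((continuous_e2_rpow hn hF).mul (hF.gradInner hψ).continuous)
      fun y hy hyK => by rw [(hzero y hy hyK).2, mul_zero]), ← hsum]
  refine setIntegral_congr_fun hto.measurableSet fun y hy => ?_
  rw [Finset.sum_add_distrib, hA y hy, hB y hy]

omit [IsContMDiffRiemannianBundle (𝓡 n) ∞ (EuclideanSpace ℝ (Fin n))
        (fun x : M => TangentSpace (𝓡 n) x)] [MeasurableSpace M] [BorelSpace M] [CompactSpace M]
  [T2Space M] in
theorem gradInner_sum {κ : Type*} (S : Finset κ) {ψ : κ → M → EuclideanSpace ℝ (Fin L)}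
    (hF : ChartSmooth n F) (hψ : ∀ i, ChartSmooth n (ψ i)) (p : M) :
    gradInner n F (fun q => ∑ i ∈ S, ψ i q) p = ∑ i ∈ S, gradInner n F (ψ i) p := by
  have hy := mem_extChartAt_target (I := 𝓡 n) p
  have hs : ChartSmooth n (fun q => ∑ i ∈ S, ψ i q) := fun x =>
    ContDiffOn.sum fun i _ => hψ i x
  have h1 : ∀ G : M → EuclideanSpace ℝ (Fin L), ChartSmooth n G → gradInner n F G p = _ := fun G hG =>
    (congrArg (gradInner n F G) (extChartAt_to_inv (I := 𝓡 n) p).symm).trans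
    (gradInner_eq_gram hy (hF.differentiableAt hy) (hG.differentiableAt hy))
  rw [h1 _ hs]
  simp only [fun i => h1 _ (hψ i)]
  rw [Finset.sum_comm (s := S)]
  simp only [Finset.sum_comm (s := S)]
  refine Finset.sum_congr rfl fun i _ => Finset.sum_congr rfl fun j _ => ?_
  have h2 : ((fun q => ∑ i ∈ S, ψ i q) ∘ (extChartAt (𝓡 n) p).symm) =
      fun y => ∑ i ∈ S, (ψ i ∘ (extChartAt (𝓡 n) p).symm) y := rfl
  rw [h2, fderiv_fun_sum fun i _ => (hψ i).differentiableAt hy, _root_.sum_apply,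
    inner_sum, Finset.mul_sum]

/-- The weak form of the regularized Laplacian on a closed manifold. -/
theorem integral_inner_regLaplacian (hn : 2 ≤ n) (hε : 0 ≤ ε) (hF : ChartSmooth n F)
    {T : M → EuclideanSpace ℝ (Fin L)} (hT : Continuous T)
    (hTx : ∀ x, ∀ p ∈ (extChartAt (𝓡 n) x).source, T p = regLaplacian (n := n) ε F x p)
    {ψ : M → EuclideanSpace ℝ (Fin L)} (hψ : ChartSmooth n ψ) :
    ∫ p, inner ℝ (T p) (ψ p) ∂(riemVolume n M) =
      - ∫ p, e2 n ε F p ^ ((n : ℝ) / 2 - 1) * gradInner n F ψ p ∂(riemVolume n M) := by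
  obtain ⟨S, hS⟩ := isCompact_univ.elim_finite_subcover
    (fun x : M => (extChartAt (𝓡 n) x).source) (fun x => isOpen_extChartAt_source x)
    (fun p _ => mem_iUnion.2 ⟨p, mem_extChartAt_source p⟩)
  obtain ⟨ρ, hρ⟩ := SmoothPartitionOfUnity.exists_isSubordinate (𝓡 n) isClosed_univ
    (fun x : S => (extChartAt (𝓡 n) (x : M)).source) (fun x => isOpen_extChartAt_source _)
    (fun p hp => by
      obtain ⟨x, hx, hpx⟩ := mem_iUnion₂.1 (hS hp)
      exact mem_iUnion.2 ⟨⟨x, hx⟩, hpx⟩)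
  have hone : ∀ p, ∑ i, ρ i p = 1 := fun p => by
    rw [← finsum_eq_sum_of_fintype]; exact ρ.sum_eq_one (mem_univ p)
  -- A finite partition of unity subordinate to chart domains reduces to test maps supported in one
  -- chart, both sides being linear in ψ.
  have hdec : ψ = fun p => ∑ i, ρ i p • ψ p := by
    funext p; rw [← Finset.sum_smul, hone, one_smul]
  have hψi : ∀ i, ChartSmooth n (fun p => ρ i p • ψ p) := fun i x =>
    (chartSmooth_of_contMDiff (ρ i).contMDiff x).smul (hψ x)
  have hi : ∀ i, ∫ p, inner ℝ (T p) (ρ i p • ψ p) ∂(riemVolume n M) =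
      - ∫ p, e2 n ε F p ^ ((n : ℝ) / 2 - 1) * gradInner n F (fun p => ρ i p • ψ p) p
        ∂(riemVolume n M) := fun i =>
    integral_inner_regLaplacian_of_tsupport hn hε hF hT (hTx i) (hψi i)
      ((closure_mono (Function.support_smul_subset_left _ _)).trans (hρ i))
  have h1 : ∀ p, inner ℝ (T p) (ψ p) = ∑ i, inner ℝ (T p) (ρ i p • ψ p) := fun p => by
    conv_lhs => rw [hdec]
    rw [inner_sum]
  have h2 : ∀ p, e2 n ε F p ^ ((n : ℝ) / 2 - 1) * gradInner n F ψ p =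
      ∑ i, e2 n ε F p ^ ((n : ℝ) / 2 - 1) * gradInner n F (fun p => ρ i p • ψ p) p := fun p => by
    conv_lhs => rw [hdec]
    rw [gradInner_sum _ hF hψi, Finset.mul_sum]
  simp only [h1, h2]
  rw [integral_finsetSum, integral_finsetSum, ← Finset.sum_neg_distrib]
  · exact Finset.sum_congr rfl fun i _ => hi i
  · exact fun i _ => integrable_of_continuous
      ((continuous_e2_rpow hn hF).mul (hF.gradInner (hψi i)).continuous)
  · exact fun i _ => integrable_of_continuous (hT.inner (hψi i).continuous)

end Divergence

/-! ### Derivatives of slices and exchange of time and space derivatives -/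

section MixedPartials

variable {X V : Type*} [NormedAddCommGroup X] [NormedSpace ℝ X] [NormedAddCommGroup V]
  [NormedSpace ℝ V]

/-- The time set I need not be open: it will be [0, t₂) when continuity at the initial time is
needed, hence `fderivWithin`. -/
theorem hasFDerivAt_slice {I : Set ℝ} {U : Set X} (hU : IsOpen U) {g : ℝ × X → V}
    (hg : ContDiffOn ℝ ∞ g (I ×ˢ U)) {t : ℝ} {y : X} (ht : t ∈ I) (hy : y ∈ U) :
    HasFDerivAt (fun z => g (t, z))
      ((fderivWithin ℝ g (I ×ˢ U) (t, y)).comp (ContinuousLinearMap.inr ℝ ℝ X)) y := by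
  have h1 := (hg.differentiableOn (by simp) (t, y) ⟨ht, hy⟩).hasFDerivWithinAt
  have h2 : HasFDerivWithinAt (fun z : X => (t, z)) (ContinuousLinearMap.inr ℝ ℝ X) U y :=
    (hasFDerivAt_prodMk_right t y).hasFDerivWithinAt
  exact (h1.comp y h2 fun z hz => ⟨ht, hz⟩).hasFDerivAt (hU.mem_nhds hy)

theorem contDiffOn_fderiv_slice {I : Set ℝ} (hI : UniqueDiffOn ℝ I) {U : Set X} (hU : IsOpen U)
    {g : ℝ × X → V} (hg : ContDiffOn ℝ ∞ g (I ×ˢ U)) (v : X) :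
    ContDiffOn ℝ ∞ (fun z : ℝ × X => fderiv ℝ (fun y => g (z.1, y)) z.2 v) (I ×ˢ U) := by
  have h := (hg.fderivWithin (hI.prod hU.uniqueDiffOn) (m := ∞) (by simp)).clm_apply
    (contDiffOn_const (c := ((0 : ℝ), v)))
  refine h.congr fun z hz => ?_
  rw [(hasFDerivAt_slice hU hg hz.1 hz.2).fderiv]
  simp

theorem hasDerivAt_slice {I : Set ℝ} (hI : IsOpen I) {U : Set X} (hU : IsOpen U) {g : ℝ × X → V}
    (hg : ContDiffOn ℝ ∞ g (I ×ˢ U)) {t : ℝ} {y : X} (ht : t ∈ I) (hy : y ∈ U) :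
    HasDerivAt (fun s => g (s, y)) (fderiv ℝ g (t, y) (1, 0)) t := by
  have hmem : (t, y) ∈ I ×ˢ U := ⟨ht, hy⟩
  have h1 := ((hg.differentiableOn (by simp)).differentiableAt
    ((hI.prod hU).mem_nhds hmem)).hasFDerivAt
  have h2 : HasDerivAt (fun s : ℝ => (s, y)) ((1 : ℝ), (0 : X)) t :=
    (hasDerivAt_id t).prodMk (hasDerivAt_const t y)
  exact h1.comp_hasDerivAt t h2

theorem contDiffOn_deriv_slice {I : Set ℝ} (hI : IsOpen I) {U : Set X} (hU : IsOpen U)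
    {g : ℝ × X → V} (hg : ContDiffOn ℝ ∞ g (I ×ˢ U)) :
    ContDiffOn ℝ ∞ (fun z : ℝ × X => deriv (fun s => g (s, z.2)) z.1) (I ×ˢ U) := by
  have h := (hg.fderiv_of_isOpen (hI.prod hU) (m := ∞) (by simp)).clm_apply
    (contDiffOn_const (c := ((1 : ℝ), (0 : X))))
  exact h.congr fun z hz => (hasDerivAt_slice hI hU hg hz.1 hz.2).deriv

/-- Symmetry of the second derivative of g on space-time, evaluated on the pair (1, 0), (0, v). -/
theorem hasDerivAt_fderiv_slice {I : Set ℝ} (hI : IsOpen I) {U : Set X} (hU : IsOpen U)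
    {g : ℝ × X → V} (hg : ContDiffOn ℝ ∞ g (I ×ˢ U)) {t : ℝ} {y : X} (ht : t ∈ I) (hy : y ∈ U)
    (v : X) : HasDerivAt (fun s => fderiv ℝ (fun z => g (s, z)) y v)
      (fderiv ℝ (fun z => deriv (fun s => g (s, z)) t) y v) t := by
  have hIU := hI.prod hU
  have hmem : I ×ˢ U ∈ nhds (t, y) := hIU.mem_nhds ⟨ht, hy⟩
  have hga : ContDiffAt ℝ ∞ g (t, y) := hg.contDiffAt hmem
  have hd : HasFDerivAt (fderiv ℝ g) (fderiv ℝ (fderiv ℝ g) (t, y)) (t, y) :=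
    ((hg.fderiv_of_isOpen hIU (m := ∞) (by simp)).differentiableOn (by simp)).differentiableAt
      hmem |>.hasFDerivAt
  have hsymm : IsSymmSndFDerivAt ℝ g (t, y) := hga.isSymmSndFDerivAt (by
    rw [minSmoothness_of_isRCLikeNormedField]
    exact WithTop.coe_le_coe.2 (le_top : (2 : ℕ∞) ≤ ⊤))
  have h2 : HasDerivAt (fun s : ℝ => (s, y)) ((1 : ℝ), (0 : X)) t :=
    (hasDerivAt_id t).prodMk (hasDerivAt_const t y)
  have hev : ∀ c : ℝ × X, HasFDerivAt (fun z => fderiv ℝ g z c)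
      ((fderiv ℝ (fderiv ℝ g) (t, y)).flip c) (t, y) := fun c => by
    have h := hd.clm_apply (hasFDerivAt_const c (t, y))
    rwa [ContinuousLinearMap.comp_zero, zero_add] at h
  have h3 : HasDerivAt (fun s => fderiv ℝ g (s, y) (0, v))
      (fderiv ℝ (fderiv ℝ g) (t, y) (1, 0) (0, v)) t := by
    have h := HasFDerivAt.comp_hasDerivAt (f := fun s : ℝ => (s, y)) t (hev (0, v)) h2
    exact h
  have h4 : HasFDerivAt (fun z => fderiv ℝ g (t, z) (1, 0))
      (((fderiv ℝ (fderiv ℝ g) (t, y)).flip (1, 0)).comp (ContinuousLinearMap.inr ℝ ℝ X)) y :=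
    (hev (1, 0)).comp y (hasFDerivAt_prodMk_right t y)
  have h6 : (fun z => deriv (fun s => g (s, z)) t) =ᶠ[nhds y] fun z => fderiv ℝ g (t, z) (1, 0) := by
    filter_upwards [hU.mem_nhds hy] with z hz using (hasDerivAt_slice hI hU hg ht hz).deriv
  have h7 : (((fderiv ℝ (fderiv ℝ g) (t, y)).flip (1, 0)).comp
      (ContinuousLinearMap.inr ℝ ℝ X)) v = fderiv ℝ (fderiv ℝ g) (t, y) (1, 0) (0, v) :=
    hsymm (0, v) (1, 0)
  rw [h6.fderiv_eq, h4.fderiv, h7]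
  refine h3.congr_of_eventuallyEq ?_
  filter_upwards [hI.mem_nhds ht] with s hs
  rw [(hasFDerivAt_slice hU hg hs hy).fderiv, fderivWithin_of_isOpen hIU ⟨hs, hy⟩]
  simp

end MixedPartials

/-! ### Smooth one-parameter families on M -/

section Families

variable {n : ℕ} {M : Type*} [TopologicalSpace M] [ChartedSpace (EuclideanSpace ℝ (Fin n)) M]

/-- A family of maps on `M`, smooth in time `t ∈ I` and space jointly, in the preferred charts. -/
def SmoothFam (n : ℕ) {M V : Type*} [TopologicalSpace M]
    [ChartedSpace (EuclideanSpace ℝ (Fin n)) M] [NormedAddCommGroup V] [NormedSpace ℝ V]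
    (I : Set ℝ) (F : ℝ → M → V) : Prop :=
  ∀ x : M, ContDiffOn ℝ ∞ (fun z : ℝ × EuclideanSpace ℝ (Fin n) =>
    F z.1 ((extChartAt (𝓡 n) x).symm z.2)) (I ×ˢ (extChartAt (𝓡 n) x).target)

variable {V : Type*} [NormedAddCommGroup V] [NormedSpace ℝ V] {I : Set ℝ} {F : ℝ → M → V}

theorem SmoothFam.mono {J : Set ℝ} (hF : SmoothFam n I F) (hJ : J ⊆ I) : SmoothFam n J F :=
  fun x => (hF x).mono (prod_mono_left hJ)

theorem SmoothFam.chartSmooth (hF : SmoothFam n I F) {t : ℝ} (ht : t ∈ I) : ChartSmooth n (F t) :=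
  fun x => (hF x).comp (contDiff_const.prodMk contDiff_id).contDiffOn fun _ hy => ⟨ht, hy⟩

theorem SmoothFam.hasDerivAt (hI : IsOpen I) (hF : SmoothFam n I F) {t : ℝ} (ht : t ∈ I) (p : M) :
    HasDerivAt (fun s => F s p) (deriv (fun s => F s p) t) t := by
  have h := hasDerivAt_slice hI (isOpen_extChartAt_target p) (hF p) ht (mem_extChartAt_target p)
  simp only [extChartAt_to_inv] at h
  exact h.differentiableAt.hasDerivAt

theorem SmoothFam.deriv (hI : IsOpen I) (hF : SmoothFam n I F) :
    SmoothFam n I (fun t p => deriv (fun s => F s p) t) :=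
  fun x => contDiffOn_deriv_slice hI (isOpen_extChartAt_target x) (hF x)

theorem SmoothFam.continuousOn (hF : SmoothFam n I F) :
    ContinuousOn (fun z : ℝ × M => F z.1 z.2) (I ×ˢ univ) := by
  rintro ⟨t, p⟩ ⟨ht, -⟩
  have h1 := (hF p).continuousOn (t, extChartAt (𝓡 n) p p) ⟨ht, mem_extChartAt_target p⟩
  have h2 : ContinuousWithinAt (fun z : ℝ × M => (z.1, extChartAt (𝓡 n) p z.2))
      (I ×ˢ (extChartAt (𝓡 n) p).source) (t, p) :=
    (continuous_fst.continuousWithinAt).prodMk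
      (ContinuousAt.comp (f := Prod.snd) (x := (t, p)) (continuousAt_extChartAt p)
      continuousAt_snd).continuousWithinAt
  have h3 := ContinuousWithinAt.comp (x := (t, p)) (f := fun z : ℝ × M => (z.1, extChartAt (𝓡 n) p z.2))
    h1 h2 fun z hz => ⟨hz.1, (extChartAt (𝓡 n) p).map_source hz.2⟩
  have h4 : ContinuousWithinAt (fun z : ℝ × M => F z.1 z.2)
      (I ×ˢ (extChartAt (𝓡 n) p).source) (t, p) := by
    refine h3.congr (fun z hz => ?_) ?_
    · simp only [Function.comp]; rw [(extChartAt (𝓡 n) p).left_inv hz.2]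
    · simp only [Function.comp]; rw [extChartAt_to_inv]
  refine h4.mono_of_mem_nhdsWithin ?_
  rw [nhdsWithin_prod_eq, nhdsWithin_univ]
  exact Filter.prod_mem_prod self_mem_nhdsWithin (extChartAt_source_mem_nhds p)

variable [IsManifold (𝓡 n) ∞ M]

theorem diffAt_eq_fderiv {L : ℕ} {F : M → EuclideanSpace ℝ (Fin L)} (hF : ChartSmooth n F) (p : M)
    (v : TangentSpace (𝓡 n) p) : diffAt F p v =
      fderiv ℝ (F ∘ (extChartAt (𝓡 n) p).symm) (extChartAt (𝓡 n) p p) v := by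
  have h := (hF.mdifferentiableAt p).mfderiv
  simp only [ModelWithCorners.range_eq_univ, fderivWithin_univ] at h
  exact congrArg (fun T : EuclideanSpace ℝ (Fin n) →L[ℝ] EuclideanSpace ℝ (Fin L) => T v) h

theorem hasDerivAt_diffAt {L : ℕ} {F : ℝ → M → EuclideanSpace ℝ (Fin L)} (hI : IsOpen I)
    (hF : SmoothFam n I F) {t : ℝ} (ht : t ∈ I) (p : M) (v : TangentSpace (𝓡 n) p) :
    HasDerivAt (fun s => diffAt (F s) p v) (diffAt (fun q => deriv (fun s => F s q) t) p v) t := by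
  have h := hasDerivAt_fderiv_slice hI (isOpen_extChartAt_target p) (hF p) ht
    (mem_extChartAt_target p) v
  rw [diffAt_eq_fderiv ((hF.deriv hI).chartSmooth ht)]
  refine h.congr_of_eventuallyEq ?_
  filter_upwards [hI.mem_nhds ht] with s hs
  exact diffAt_eq_fderiv (hF.chartSmooth hs) p v

variable [RiemannianBundle (fun x : M => TangentSpace (𝓡 n) x)] {L : ℕ}

theorem hasDerivAt_gradInner {F G : ℝ → M → EuclideanSpace ℝ (Fin L)} (hI : IsOpen I)
    (hF : SmoothFam n I F) (hG : SmoothFam n I G) {t : ℝ} (ht : t ∈ I) (p : M) :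
    HasDerivAt (fun s => gradInner n (F s) (G s) p)
      (gradInner n (fun q => deriv (fun s => F s q) t) (G t) p +
        gradInner n (F t) (fun q => deriv (fun s => G s q) t) p) t := by
  simp only [gradInner_eq_sum]
  rw [← Finset.sum_add_distrib]
  refine HasDerivAt.fun_sum fun k _ => ?_
  have : FiniteDimensional ℝ (TangentSpace (𝓡 n) p) :=
    inferInstanceAs (FiniteDimensional ℝ (EuclideanSpace ℝ (Fin n)))
  have h := (hasDerivAt_diffAt hI hF ht p
    (stdOrthonormalBasis ℝ (TangentSpace (𝓡 n) p) k)).inner ℝ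
    (hasDerivAt_diffAt hI hG ht p (stdOrthonormalBasis ℝ (TangentSpace (𝓡 n) p) k))
  convert! h using 1
  rw [add_comm]
  rfl

variable [IsContMDiffRiemannianBundle (𝓡 n) ∞ (EuclideanSpace ℝ (Fin n))
        (fun x : M => TangentSpace (𝓡 n) x)]

theorem SmoothFam.gradInner {F G : ℝ → M → EuclideanSpace ℝ (Fin L)} (hI : UniqueDiffOn ℝ I)
    (hF : SmoothFam n I F) (hG : SmoothFam n I G) :
    SmoothFam n I (fun t => gradInner n (F t) (G t)) := by
  intro x
  have hto := isOpen_extChartAt_target (I := 𝓡 n) x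
  have hinv : ∀ i j, ContDiffOn ℝ ∞ (fun z : ℝ × EuclideanSpace ℝ (Fin n) =>
      (gramMatrix x z.2)⁻¹ i j) (I ×ˢ (extChartAt (𝓡 n) x).target) := fun i j =>
    (contDiffOn_inv_gramMatrix x i j).comp contDiff_snd.contDiffOn fun _ hz => hz.2
  have h := ContDiffOn.sum (s := Finset.univ) fun i (_ : i ∈ Finset.univ) =>
    ContDiffOn.sum (s := Finset.univ) fun j (_ : j ∈ Finset.univ) => (hinv i j).mul
      ((contDiffOn_fderiv_slice hI hto (hF x) (EuclideanSpace.single i (1 : ℝ))).inner ℝ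
        (contDiffOn_fderiv_slice hI hto (hG x) (EuclideanSpace.single j (1 : ℝ))))
  exact h.congr fun z hz => gradInner_eq_gram hz.2 ((hF.chartSmooth hz.1).differentiableAt hz.2)
    ((hG.chartSmooth hz.1).differentiableAt hz.2)

end Families

/-! ### Integrals over M depending on time -/

section Integrals

variable {M : Type*} [TopologicalSpace M] [CompactSpace M] [MeasurableSpace M] [BorelSpace M]
  {μ : Measure M} [IsFiniteMeasure μ]

theorem exists_bound_of_continuousOn_prod {I : Set ℝ} {g : ℝ → M → ℝ}
    (hg : ContinuousOn (fun z : ℝ × M => g z.1 z.2) (I ×ˢ univ)) {J : Set ℝ} (hJ : IsCompact J)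
    (hJI : J ⊆ I) : ∃ C, ∀ t ∈ J, ∀ p, |g t p| ≤ C := by
  obtain ⟨C, hC⟩ := (hJ.prod isCompact_univ).exists_bound_of_continuousOn
    (hg.mono (prod_mono_left hJI))
  exact ⟨C, fun t ht p => hC (t, p) ⟨ht, mem_univ _⟩⟩

/-- The derivative g' is only asked to be measurable in space and bounded on compact time sets,
since `fluxDeriv` need not be continuous where e₂ vanishes. -/
theorem hasDerivAt_integral_of_bound {I : Set ℝ} (hI : IsOpen I) {g g' : ℝ → M → ℝ}
    (hg : ∀ t ∈ I, Continuous (g t)) (hd : ∀ t ∈ I, ∀ p, HasDerivAt (fun s => g s p) (g' t p) t)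
    (hm : ∀ t ∈ I, AEStronglyMeasurable (g' t) μ)
    (hb : ∀ J : Set ℝ, IsCompact J → J ⊆ I → ∃ C, ∀ t ∈ J, ∀ p, |g' t p| ≤ C)
    {t : ℝ} (ht : t ∈ I) : HasDerivAt (fun s => ∫ p, g s p ∂μ) (∫ p, g' t p ∂μ) t := by
  obtain ⟨K, hK, hKI, hKc⟩ := local_compact_nhds (hI.mem_nhds ht)
  obtain ⟨C, hC⟩ := hb K hKc hKI
  refine (hasDerivAt_integral_of_dominated_loc_of_deriv_le (F := g) (F' := g')
    (bound := fun _ => C) hK ?_ ?_ (hm t ht) ?_ (integrable_const C) ?_).2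
  · filter_upwards [hI.mem_nhds ht] with s hs using (hg s hs).aestronglyMeasurable
  · exact (hg t ht).integrable_of_hasCompactSupport (HasCompactSupport.of_compactSpace _)
  · exact Filter.Eventually.of_forall fun p s hs => hC s hs p
  · exact Filter.Eventually.of_forall fun p s hs => hd s (hKI hs) p

theorem continuousOn_integral_of_continuousOn {I : Set ℝ} {g : ℝ → M → ℝ}
    (hg : ContinuousOn (fun z : ℝ × M => g z.1 z.2) (I ×ˢ univ)) {t : ℝ} (hI : I ∈ nhdsWithin t (Ici t))
    (hIt : ∃ T, t < T ∧ Icc t T ⊆ I) :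
    ContinuousWithinAt (fun s => ∫ p, g s p ∂μ) (Ici t) t := by
  obtain ⟨T, hT, hTI⟩ := hIt
  obtain ⟨C, hC⟩ := exists_bound_of_continuousOn_prod hg isCompact_Icc hTI
  have hmem : Icc t T ∈ nhdsWithin t (Ici t) := Icc_mem_nhdsGE hT
  refine continuousWithinAt_of_dominated (bound := fun _ => C) ?_ ?_ (integrable_const C) ?_
  · filter_upwards [hmem] with s hs
    have : Continuous (g s) := by
      rw [← continuousOn_univ]
      exact hg.comp (continuous_const.prodMk continuous_id).continuousOn fun p _ => ⟨hTI hs, mem_univ _⟩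
    exact this.aestronglyMeasurable
  · filter_upwards [hmem] with s hs
    exact Filter.Eventually.of_forall fun p => hC s hs p
  · refine Filter.Eventually.of_forall fun p => ?_
    have h1 : ContinuousWithinAt (fun s => g s p) I t :=
      (ContinuousWithinAt.comp (x := t) (f := fun s : ℝ => (s, p))
        (hg (t, p) ⟨hTI (left_mem_Icc.2 hT.le), mem_univ _⟩)
        (continuous_id.prodMk continuous_const).continuousWithinAt fun s hs => ⟨hs, mem_univ _⟩)
    exact h1.mono_of_mem_nhdsWithin hI

end Integrals

/-! ### Algebraic inequalities: coercivity and the test-function bound -/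

section Pointwise

/-- The scalar inequality behind the coercivity of the linearized operator. -/
theorem coercivity_aux {h h' γ σ B ζ X Y e m : ℝ} (hh : 0 < h) (hσ : 0 ≤ σ) (hγ : 0 ≤ γ)
    (hγ1 : γ ≤ 17 / 16) (hh' : h' * (1 + σ) = γ * h) (hB : 0 ≤ B) (hζ0 : 0 ≤ ζ) (hζ : ζ ≤ σ * B)
    (hY : Y ^ 2 ≤ ζ * (σ * e)) (he : 0 < e) (hm : 0 ≤ m) (hm2 : m ≤ 2) :
    1 / 2 * (h * B) ≤ (h * B + 2 * h' * ζ) + m * e⁻¹ * (X * (h * X + 2 * h' * Y)) := by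
  have hσ1 : 0 < 1 + σ := by linarith
  have hh'0 : 0 ≤ h' := by
    by_contra hc
    push Not at hc
    nlinarith [mul_nonneg hγ hh.le]
  have h1 : h' * σ ≤ γ * h := by nlinarith
  -- Complete the square: h X (h X + 2 h' Y) = (h X + h' Y)² − h'² Y².
  have h2 : -(h' ^ 2 * (ζ * (σ * e))) ≤ h * (X * (h * X + 2 * h' * Y)) := by
    nlinarith [sq_nonneg (h * X + h' * Y), mul_le_mul_of_nonneg_left hY (sq_nonneg h')]
  have h3 : -(17 / 16 * h' * ζ * e) ≤ X * (h * X + 2 * h' * Y) := by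
    have h4 : h' ^ 2 * (ζ * (σ * e)) ≤ h * (17 / 16 * h' * ζ * e) := by
      have h5 : h' * σ ≤ 17 / 16 * h := h1.trans (mul_le_mul_of_nonneg_right hγ1 hh.le)
      have h6 : 0 ≤ h' * ζ * e := by positivity
      nlinarith [mul_le_mul_of_nonneg_left h5 h6]
    have h7 : h * (-(17 / 16 * h' * ζ * e)) ≤ h * (X * (h * X + 2 * h' * Y)) := by linarith
    exact le_of_mul_le_mul_left h7 hh
  have h8 : -(2 * (17 / 16) * h' * ζ) ≤ m * e⁻¹ * (X * (h * X + 2 * h' * Y)) := by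
    have h9 : 0 ≤ m * e⁻¹ := by positivity
    have h10 := mul_le_mul_of_nonneg_left h3 h9
    have h11 : m * e⁻¹ * -(17 / 16 * h' * ζ * e) = -(m * (17 / 16 * h' * ζ)) := by
      field_simp
    rw [h11] at h10
    have h12 : m * (17 / 16 * h' * ζ) ≤ 2 * (17 / 16 * h' * ζ) :=
      mul_le_mul_of_nonneg_right hm2 (by positivity)
    linarith
  have h13 : h' * ζ ≤ 17 / 16 * (h * B) := by
    calc h' * ζ ≤ h' * (σ * B) := mul_le_mul_of_nonneg_left hζ hh'0
      _ = (h' * σ) * B := by ring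
      _ ≤ (γ * h) * B := mul_le_mul_of_nonneg_right h1 hB
      _ = γ * (h * B) := by ring
      _ ≤ 17 / 16 * (h * B) := mul_le_mul_of_nonneg_right hγ1 (by positivity)
  have h14 : 0 ≤ h' * ζ := by positivity
  have h15 : 0 ≤ h * B := by positivity
  -- The net coefficient of h' ζ is 2 − 17/8 = −1/8, and h' ζ ≤ (17/16) h B, which leaves (1 −
  -- 17/128) h B ≥ h B / 2.
  nlinarith

variable {κ W : Type*} [Fintype κ] [NormedAddCommGroup W] [InnerProductSpace ℝ W]

theorem abs_sum_inner_le (α β : κ → W) :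
    |∑ k, inner ℝ (α k) (β k)| ≤ Real.sqrt (∑ k, ‖α k‖ ^ 2) * Real.sqrt (∑ k, ‖β k‖ ^ 2) := by
  refine (Finset.abs_sum_le_sum_abs _ _).trans ?_
  refine (Finset.sum_le_sum fun k _ => abs_real_inner_le_norm (α k) (β k)).trans ?_
  exact Real.sum_mul_le_sqrt_mul_sqrt _ _ _

theorem sum_inner_sq_le (β : κ → W) (w : W) :
    ∑ k, (inner ℝ w (β k)) ^ 2 ≤ ‖w‖ ^ 2 * ∑ k, ‖β k‖ ^ 2 := by
  rw [Finset.mul_sum]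
  refine Finset.sum_le_sum fun k _ => ?_
  rw [← mul_pow, ← sq_abs]
  exact pow_le_pow_left₀ (abs_nonneg _) (abs_real_inner_le_norm _ _) 2

/-- Coercivity: the quadratic form obtained from testing with `h(|w|²) w`. -/
theorem coercivity {α β : κ → W} {w : W} {h h' γ e s m : ℝ} (hh : 0 < h) (hγ : 0 ≤ γ)
    (hγ1 : γ ≤ 17 / 16) (hh' : h' * (1 + ‖w‖ ^ 2) = γ * h) (he : ∑ k, ‖α k‖ ^ 2 ≤ e)
    (hm : 0 ≤ m) (hm2 : m ≤ 2) :
    1 / 2 * (e ^ s * (h * ∑ k, ‖β k‖ ^ 2)) ≤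
      e ^ s * ∑ k, inner ℝ (β k) (h • β k + (2 * h' * inner ℝ w (β k)) • w) +
        m * e ^ (s - 1) * ((∑ k, inner ℝ (α k) (β k)) *
          ∑ k, inner ℝ (α k) (h • β k + (2 * h' * inner ℝ w (β k)) • w)) := by
  set B := ∑ k, ‖β k‖ ^ 2 with hB
  set ζ := ∑ k, (inner ℝ w (β k)) ^ 2 with hζ
  set X := ∑ k, inner ℝ (α k) (β k) with hX
  set Y := ∑ k, inner ℝ w (β k) * inner ℝ (α k) w with hY
  have hB0 : 0 ≤ B := Finset.sum_nonneg fun k _ => sq_nonneg _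
  have hA0 : 0 ≤ ∑ k, ‖α k‖ ^ 2 := Finset.sum_nonneg fun k _ => sq_nonneg _
  have h1 : ∑ k, inner ℝ (β k) (h • β k + (2 * h' * inner ℝ w (β k)) • w) = h * B + 2 * h' * ζ := by
    rw [hB, hζ, Finset.mul_sum, Finset.mul_sum, ← Finset.sum_add_distrib]
    refine Finset.sum_congr rfl fun k _ => ?_
    rw [inner_add_right, real_inner_smul_right, real_inner_smul_right, real_inner_self_eq_norm_sq,
      real_inner_comm]
    ring
  have h2 : ∑ k, inner ℝ (α k) (h • β k + (2 * h' * inner ℝ w (β k)) • w) = h * X + 2 * h' * Y := by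
    rw [hX, hY, Finset.mul_sum, Finset.mul_sum, ← Finset.sum_add_distrib]
    refine Finset.sum_congr rfl fun k _ => ?_
    rw [inner_add_right, real_inner_smul_right, real_inner_smul_right]
    ring
  rw [h1, h2]
  have hσ : 0 ≤ ‖w‖ ^ 2 := sq_nonneg _
  have hζ0 : 0 ≤ ζ := Finset.sum_nonneg fun k _ => sq_nonneg _
  have hζB : ζ ≤ ‖w‖ ^ 2 * B := sum_inner_sq_le β w
  have hh'0 : 0 ≤ h' := by
    by_contra hc
    push Not at hc
    nlinarith [mul_nonneg hγ hh.le]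
  rcases (hA0.trans he).eq_or_lt with h0 | hpos
  -- If e = 0 then every α k is 0, so the term with the possibly negative power of e drops out.
  · have hα : ∀ k, α k = 0 := by
      have h3 : ∑ k, ‖α k‖ ^ 2 = 0 := le_antisymm (he.trans h0.symm.le) hA0
      intro k
      have := (Finset.sum_eq_zero_iff_of_nonneg fun k _ => sq_nonneg _).1 h3 k (Finset.mem_univ k)
      exact norm_eq_zero.1 (pow_eq_zero_iff (two_ne_zero) |>.1 this)
    have hX0 : X = 0 := Finset.sum_eq_zero fun k _ => by rw [hα k, inner_zero_left]
    rw [hX0, zero_mul, mul_zero, add_zero]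
    have h4 : 0 ≤ e ^ s := Real.rpow_nonneg (hA0.trans he) _
    have h5 : 1 / 2 * (h * B) ≤ h * B + 2 * h' * ζ := by
      have : 0 ≤ h * B := by positivity
      have : 0 ≤ h' * ζ := by positivity
      linarith
    calc _ = e ^ s * (1 / 2 * (h * B)) := by ring
      _ ≤ _ := mul_le_mul_of_nonneg_left h5 h4
  · have hYsq : Y ^ 2 ≤ ζ * (‖w‖ ^ 2 * e) := by
      have h3 := Finset.sum_mul_sq_le_sq_mul_sq Finset.univ (fun k => inner ℝ w (β k))
        (fun k => inner ℝ (α k) w)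
      refine h3.trans (mul_le_mul_of_nonneg_left ?_ hζ0)
      have h4 := sum_inner_sq_le α w
      simp only [real_inner_comm w] at h4 ⊢
      exact h4.trans (mul_le_mul_of_nonneg_left he hσ)
    have key := coercivity_aux (X := X) hh hσ hγ hγ1 hh' hB0 hζ0 hζB hYsq hpos hm hm2
    rw [Real.rpow_sub hpos, Real.rpow_one, div_eq_mul_inv]
    have h4 : 0 ≤ e ^ s := Real.rpow_nonneg hpos.le _
    have := mul_le_mul_of_nonneg_left key h4
    calc _ = e ^ s * (1 / 2 * (h * B)) := by ring
      _ ≤ _ := this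
      _ = _ := by ring

/-- The bound on the flux tested with `h(|w|²) w`. -/
theorem sum_inner_test_le {α β : κ → W} {w : W} {h h' γ h₀ h₁ e : ℝ} (hh : 0 ≤ h)
    (hγ2 : γ ≤ 5 / 2) (hh'0 : 0 ≤ h') (hh' : h' * (1 + ‖w‖ ^ 2) = γ * h) (he : ∑ k, ‖α k‖ ^ 2 ≤ e)
    (hh₀ : 0 ≤ h₀) (hh₁ : 0 ≤ h₁) (hsq : h ^ 2 = h₀ * h₁) :
    |∑ k, inner ℝ (α k) (h • β k + (2 * h' * inner ℝ w (β k)) • w)| ≤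
      3 * (h₀ * ∑ k, ‖β k‖ ^ 2 + h₁ * e) := by
  have hk : ∀ k, |inner ℝ (α k) (h • β k + (2 * h' * inner ℝ w (β k)) • w)| ≤
      3 * (h₀ * ‖β k‖ ^ 2 + h₁ * ‖α k‖ ^ 2) := by
    intro k
    have h1 : h' * ‖w‖ ^ 2 ≤ γ * h := by nlinarith
    -- The constant is 6 = 1 + 2 · 5/2, from h' |w|² ≤ γ h and γ ≤ 5/2. Half of it survives the
    -- inequality 2 h x y ≤ h₀ y² + h₁ x², valid as h² = h₀ h₁.
    have h2 : ‖h • β k + (2 * h' * inner ℝ w (β k)) • w‖ ≤ 6 * h * ‖β k‖ := by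
      refine (norm_add_le _ _).trans ?_
      rw [norm_smul, norm_smul, Real.norm_eq_abs, Real.norm_eq_abs, abs_of_nonneg hh, abs_mul,
        abs_of_nonneg (by positivity : 0 ≤ 2 * h')]
      have h3 : 2 * h' * |inner ℝ w (β k)| * ‖w‖ ≤ 2 * (h' * ‖w‖ ^ 2) * ‖β k‖ := by
        have := mul_le_mul_of_nonneg_left (abs_real_inner_le_norm w (β k))
          (by positivity : 0 ≤ 2 * h' * ‖w‖)
        nlinarith
      have h4 : 2 * (h' * ‖w‖ ^ 2) * ‖β k‖ ≤ 5 * h * ‖β k‖ := by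
        refine mul_le_mul_of_nonneg_right ?_ (norm_nonneg _)
        nlinarith
      linarith
    have h5 : |inner ℝ (α k) (h • β k + (2 * h' * inner ℝ w (β k)) • w)| ≤
        ‖α k‖ * (6 * h * ‖β k‖) :=
      (abs_real_inner_le_norm _ _).trans (mul_le_mul_of_nonneg_left h2 (norm_nonneg _))
    refine h5.trans ?_
    have h6 : 2 * (h * (‖α k‖ * ‖β k‖)) ≤ h₀ * ‖β k‖ ^ 2 + h₁ * ‖α k‖ ^ 2 := by
      refine le_of_sq_le_sq ?_ (by positivity)
      have : (2 * (h * (‖α k‖ * ‖β k‖))) ^ 2 = 4 * (h₀ * ‖β k‖ ^ 2) * (h₁ * ‖α k‖ ^ 2) := by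
        rw [mul_pow, mul_pow, hsq]; ring
      rw [this]
      nlinarith [sq_nonneg (h₀ * ‖β k‖ ^ 2 - h₁ * ‖α k‖ ^ 2)]
    nlinarith
  refine (Finset.abs_sum_le_sum_abs _ _).trans ((Finset.sum_le_sum fun k _ => hk k).trans ?_)
  rw [← Finset.mul_sum, Finset.sum_add_distrib, ← Finset.mul_sum, ← Finset.mul_sum]
  gcongr

end Pointwise

/-! ### The weights (1 + σ)^γ and their primitives -/

section Weights

/-- The primitive `∫₀^σ (1 + x)^γ dx`. -/
noncomputable def wPrim (γ σ : ℝ) : ℝ := ((1 + σ) ^ (γ + 1) - 1) / (γ + 1)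

theorem hasDerivAt_wPrim {γ σ : ℝ} (hγ : 0 ≤ γ) (hσ : 0 ≤ σ) :
    HasDerivAt (wPrim γ) ((1 + σ) ^ γ) σ := by
  have h1 : HasDerivAt (fun x : ℝ => 1 + x) 1 σ := (hasDerivAt_id σ).const_add 1
  have h2 := ((h1.rpow_const (p := γ + 1) (Or.inl (by positivity))).sub_const 1).div_const (γ + 1)
  convert! h2 using 1
  rw [add_sub_cancel_right]
  field_simp

theorem hasDerivAt_weight {γ σ : ℝ} (hσ : 0 ≤ σ) :
    HasDerivAt (fun x : ℝ => (1 + x) ^ γ) (γ * (1 + σ) ^ (γ - 1)) σ := by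
  have h1 : HasDerivAt (fun x : ℝ => 1 + x) 1 σ := (hasDerivAt_id σ).const_add 1
  have h2 := h1.rpow_const (p := γ) (Or.inl (by positivity))
  convert! h2 using 1
  ring

theorem wPrim_le {γ σ : ℝ} (hγ : 0 ≤ γ) (hσ : 0 ≤ σ) : wPrim γ σ ≤ σ * (1 + σ) ^ γ := by
  have hp : (1 + σ) ^ (γ + 1) = (1 + σ) * (1 + σ) ^ γ := by
    rw [Real.rpow_add_one (by positivity), mul_comm]
  rw [wPrim, div_le_iff₀ (by positivity), hp]
  -- After clearing the denominator the claim is (1 + σ)^γ (1 − γσ) ≤ 1; the two factors are at most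
  -- e^{γσ} and e^{−γσ}.
  have h1 : (1 + σ) ^ γ ≤ Real.exp (γ * σ) := by
    rw [mul_comm, Real.exp_mul]
    exact Real.rpow_le_rpow (by positivity) (by linarith [Real.add_one_le_exp σ]) hγ
  have h2 : 1 - γ * σ ≤ Real.exp (-(γ * σ)) := by linarith [Real.add_one_le_exp (-(γ * σ))]
  have h3 : (1 + σ) ^ γ * (1 - γ * σ) ≤ 1 := by
    calc (1 + σ) ^ γ * (1 - γ * σ) ≤ (1 + σ) ^ γ * Real.exp (-(γ * σ)) :=
          mul_le_mul_of_nonneg_left h2 (by positivity)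
      _ ≤ Real.exp (γ * σ) * Real.exp (-(γ * σ)) :=
          mul_le_mul_of_nonneg_right h1 (Real.exp_pos _).le
      _ = 1 := by rw [← Real.exp_add]; simp
  nlinarith

theorem one_le_weight {γ σ : ℝ} (hγ : 0 ≤ γ) (hσ : 0 ≤ σ) : 1 ≤ (1 + σ) ^ γ :=
  Real.one_le_rpow (by linarith) hγ

/-- Here (1 + γ) times the primitive equals σ (1 + σ)^γ plus (1 + σ)^γ − 1 ≥ 0. With `wPrim_le` this
makes `velMass` and `velPrim` comparable. -/
theorem le_wPrim {γ σ : ℝ} (hγ : 0 ≤ γ) (hσ : 0 ≤ σ) : σ * (1 + σ) ^ γ ≤ (1 + γ) * wPrim γ σ := by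
  have hp : (1 + σ) ^ (γ + 1) = (1 + σ) * (1 + σ) ^ γ := by
    rw [Real.rpow_add_one (by positivity), mul_comm]
  have h1 : (1 + γ) * wPrim γ σ = (1 + σ) ^ (γ + 1) - 1 := by
    rw [wPrim, add_comm 1 γ]; field_simp
  rw [h1, hp]
  linarith [one_le_weight hγ hσ]

theorem wPrim_nonneg {γ σ : ℝ} (hγ : 0 ≤ γ) (hσ : 0 ≤ σ) : 0 ≤ wPrim γ σ :=
  div_nonneg (sub_nonneg.2 (one_le_weight (by linarith) hσ)) (by linarith)

theorem weight_mul_weight_deriv {γ σ : ℝ} (hσ : 0 ≤ σ) :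
    γ * (1 + σ) ^ (γ - 1) * (1 + σ) = γ * (1 + σ) ^ γ := by
  rw [mul_assoc, ← Real.rpow_add_one (by positivity), sub_add_cancel]

theorem weight_add_half_sq {γ σ : ℝ} (hσ : 0 ≤ σ) :
    ((1 + σ) ^ (γ + 1 / 2)) ^ 2 = (1 + σ) ^ γ * (1 + σ) ^ (γ + 1) := by
  rw [← Real.rpow_natCast, ← Real.rpow_mul (by positivity), ← Real.rpow_add (by positivity)]
  congr 1
  push_cast
  ring

/-- For σ ≥ 1 use 1 + σ ≤ 2σ; for σ ≤ 1 use (1 + σ)^γ ≤ 2² on the term not containing σ. -/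
theorem weight_succ_le {γ σ : ℝ} (hγ : 0 ≤ γ) (hγ2 : γ ≤ 2) (hσ : 0 ≤ σ) :
    (1 + σ) ^ (γ + 1) ≤ 2 * (σ * (1 + σ) ^ γ) + 4 := by
  have hp : (1 + σ) ^ (γ + 1) = (1 + σ) * (1 + σ) ^ γ := by
    rw [Real.rpow_add_one (by positivity), mul_comm]
  have h0 : 0 ≤ (1 + σ) ^ γ := by positivity
  rw [hp]
  rcases le_total 1 σ with h | h
  · nlinarith
  · have h1 : (1 + σ) ^ γ ≤ 4 := by
      calc (1 + σ) ^ γ ≤ (2 : ℝ) ^ γ := Real.rpow_le_rpow (by positivity) (by linarith) hγ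
        _ ≤ (2 : ℝ) ^ (2 : ℝ) := Real.rpow_le_rpow_of_exponent_le (by norm_num) hγ2
        _ = 4 := by norm_num
    nlinarith [mul_nonneg hσ h0]

end Weights

/-! ### The weighted velocity (1 + |w|²)^γ w -/

section Weighted

variable {W : Type*} [NormedAddCommGroup W] [InnerProductSpace ℝ W]

/-- The weighted vector `(1 + |w|²)^γ w`. -/
noncomputable def wVec (γ : ℝ) (w : W) : W := (1 + ‖w‖ ^ 2) ^ γ • w

theorem contDiff_wVec (γ : ℝ) : ContDiff ℝ ∞ (wVec γ : W → W) :=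
  ((contDiff_const.add (contDiff_norm_sq ℝ)).rpow_const_of_ne fun w => by positivity).smul contDiff_id

theorem hasFDerivAt_wVec (γ : ℝ) (w : W) :
    HasFDerivAt (wVec γ) ((1 + ‖w‖ ^ 2) ^ γ • ContinuousLinearMap.id ℝ W +
      (((2 * (γ * (1 + ‖w‖ ^ 2) ^ (γ - 1))) • innerSL ℝ w).smulRight w)) w := by
  have h1 : HasFDerivAt (fun w : W => ‖w‖ ^ 2) (2 • innerSL ℝ w) w :=
    (hasStrictFDerivAt_norm_sq w).hasFDerivAt
  have h2 := (hasDerivAt_weight (γ := γ) (sq_nonneg ‖w‖)).comp_hasFDerivAt w h1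
  have h3 := h2.smul (hasFDerivAt_id w)
  convert! h3 using 1
  ext v
  simp only [Function.comp, add_apply, smul_apply, ContinuousLinearMap.id_apply,
    ContinuousLinearMap.smulRight_apply, innerSL_apply_apply, smul_eq_mul, nsmul_eq_mul, id]
  congr 2
  push_cast
  ring

theorem inner_wVec (γ : ℝ) (w v : W) :
    inner ℝ v (wVec γ w) = (1 + ‖w‖ ^ 2) ^ γ * inner ℝ v w := real_inner_smul_right _ _ _

theorem inner_self_wVec (γ : ℝ) (w : W) :
    inner ℝ w (wVec γ w) = ‖w‖ ^ 2 * (1 + ‖w‖ ^ 2) ^ γ := by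
  rw [inner_wVec, real_inner_self_eq_norm_sq, mul_comm]

end Weighted

/-! ### The flow in extrinsic form and the energy identity -/

section Flow

variable {n : ℕ} {M : Type*} [TopologicalSpace M] [ChartedSpace (EuclideanSpace ℝ (Fin n)) M]

section Families

variable {I : Set ℝ} {V W : Type*} [NormedAddCommGroup V] [NormedSpace ℝ V]
  [NormedAddCommGroup W] [NormedSpace ℝ W]

theorem SmoothFam.comp {F : ℝ → M → V} (hF : SmoothFam n I F) {g : V → W} (hg : ContDiff ℝ ∞ g) :
    SmoothFam n I (fun t p => g (F t p)) := fun x => hg.comp_contDiffOn (hF x)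

theorem SmoothFam.mul {F G : ℝ → M → ℝ} (hF : SmoothFam n I F) (hG : SmoothFam n I G) :
    SmoothFam n I (fun t p => F t p * G t p) := fun x => (hF x).mul (hG x)

theorem SmoothFam.inner {H : Type*} [NormedAddCommGroup H] [InnerProductSpace ℝ H]
    {F G : ℝ → M → H} (hF : SmoothFam n I F) (hG : SmoothFam n I G) :
    SmoothFam n I (fun t p => inner ℝ (F t p) (G t p)) := fun x => (hF x).inner ℝ (hG x)

end Families

variable [IsManifold (𝓡 n) ∞ M] [RiemannianBundle (fun x : M => TangentSpace (𝓡 n) x)] {L : ℕ}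

theorem frameDiff_wVec (γ : ℝ) {G : M → EuclideanSpace ℝ (Fin L)} (hG : ChartSmooth n G) (p : M)
    (k : Fin (Module.finrank ℝ (TangentSpace (𝓡 n) p))) :
    frameDiff n (fun q => wVec γ (G q)) p k = (1 + ‖G p‖ ^ 2) ^ γ • frameDiff n G p k +
      (2 * (γ * (1 + ‖G p‖ ^ 2) ^ (γ - 1)) * inner ℝ (G p) (frameDiff n G p k)) • G p := by
  have h := HasMFDerivAt.comp p (hasFDerivAt_wVec γ (G p)).hasMFDerivAt
    (hG.mdifferentiableAt p).hasMFDerivAt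
  rw [frameDiff, diffAt, show (fun q => wVec γ (G q)) = wVec γ ∘ G from rfl, h.mfderiv]
  rfl

theorem abs_gradInner_le (F G : M → EuclideanSpace ℝ (Fin L)) (p : M) :
    |gradInner n F G p| ≤ Real.sqrt (normSqDiff (n := n) F p) *
      Real.sqrt (normSqDiff (n := n) G p) := by
  have h := abs_sum_inner_le (frameDiff n F p) (frameDiff n G p)
  rw [gradInner_eq_sum, normSqDiff_eq_gradInner, normSqDiff_eq_gradInner, gradInner_eq_sum,
    gradInner_eq_sum]
  simpa only [real_inner_self_eq_norm_sq] using h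

theorem sum_norm_frameDiff_sq (F : M → EuclideanSpace ℝ (Fin L)) (p : M) :
    ∑ k, ‖frameDiff n F p k‖ ^ 2 = normSqDiff (n := n) F p := by
  rw [normSqDiff_eq_gradInner, gradInner_eq_sum]
  exact Finset.sum_congr rfl fun k _ => (real_inner_self_eq_norm_sq _).symm

theorem e2_rpow_sub_one_mul_le {ε : ℝ} (hε : 0 ≤ ε) (F : M → EuclideanSpace ℝ (Fin L)) (p : M)
    (s : ℝ) :
    e2 n ε F p ^ (s - 1) * normSqDiff (n := n) F p ≤ e2 n ε F p ^ s := by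
  have h0 := normSqDiff_nonneg (n := n) F p
  have h1 := normSqDiff_le_e2 (n := n) hε F p
  rcases (h0.trans h1).eq_or_lt with h | h
  · have : normSqDiff (n := n) F p = 0 := le_antisymm (h1.trans h.symm.le) h0
    rw [this, mul_zero]
    exact Real.rpow_nonneg (h0.trans h1) _
  · calc _ ≤ e2 n ε F p ^ (s - 1) * e2 n ε F p :=
          mul_le_mul_of_nonneg_left h1 (Real.rpow_nonneg h.le _)
      _ = _ := by rw [← Real.rpow_add_one h.ne', sub_add_cancel]

theorem e2_rpow_mul_e2 {ε : ℝ} (hε : 0 ≤ ε) (F : M → EuclideanSpace ℝ (Fin L)) (p : M)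
    (hn : 2 ≤ n) :
    e2 n ε F p ^ ((n : ℝ) / 2 - 1) * e2 n ε F p = e2 n ε F p ^ ((n : ℝ) / 2) := by
  have : (2 : ℝ) ≤ n := by exact_mod_cast hn
  rw [← Real.rpow_add_one' (e2_nonneg hε F p) (by linarith), sub_add_cancel]

/-- The flow in extrinsic form: `F = ι ∘ f` and `A` is the curvature term `A(f)(df, df)`, of which
only the properties used for the integral estimates are recorded. -/
structure RegFlow (n : ℕ) {L : ℕ} {M : Type*} [TopologicalSpace M]
    [ChartedSpace (EuclideanSpace ℝ (Fin n)) M]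
    [RiemannianBundle (fun x : M => TangentSpace (𝓡 n) x)] (a b ε C t₂ : ℝ)
    (F : ℝ → M → EuclideanSpace ℝ (Fin L)) (u : ℝ → M → ℝ)
    (A : ℝ → M → EuclideanSpace ℝ (Fin L)) : Prop where
  smooth_F : SmoothFam n (Ioo 0 t₂) F
  smooth_u : SmoothFam n (Ioo 0 t₂) u
  continuous_A : ∀ t ∈ Ioo 0 t₂, Continuous (A t)
  eq_F : ∀ t ∈ Ioo 0 t₂, ∀ x, ∀ p ∈ (extChartAt (𝓡 n) x).source,
    Real.exp (n * u t p) • deriv (fun s => F s p) t = regLaplacian (n := n) ε (F t) x p +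
      e2 n ε (F t) p ^ ((n : ℝ) / 2 - 1) • A t p
  eq_u : ∀ t ∈ Ioo 0 t₂, ∀ p, Real.exp (n * u t p) * deriv (fun s => u s p) t =
    b * e2 n ε (F t) p ^ ((n : ℝ) / 2) - a * Real.exp (n * u t p)
  inner_A : ∀ t ∈ Ioo 0 t₂, ∀ p, inner ℝ (A t p) (deriv (fun s => F s p) t) = 0
  accel_A : ∀ t ∈ Ioo 0 t₂, ∀ p,
    |inner ℝ (A t p) (deriv (fun s => deriv (fun s => F s p) s) t)| ≤
      C ^ 2 * normSqDiff (n := n) (F t) p * ‖deriv (fun s => F s p) t‖ ^ 2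

variable [IsContMDiffRiemannianBundle (𝓡 n) ∞ (EuclideanSpace ℝ (Fin n))
        (fun x : M => TangentSpace (𝓡 n) x)]
  [MeasurableSpace M] [BorelSpace M] [CompactSpace M] [T2Space M]
  {a b ε C t₂ : ℝ} {F : ℝ → M → EuclideanSpace ℝ (Fin L)} {u : ℝ → M → ℝ}
  {A : ℝ → M → EuclideanSpace ℝ (Fin L)}

theorem hasDerivAt_integral_smoothFam {I : Set ℝ} (hI : IsOpen I) {g : ℝ → M → ℝ}
    (hg : SmoothFam n I g) {t : ℝ} (ht : t ∈ I) :
    HasDerivAt (fun s => ∫ p, g s p ∂(riemVolume n M))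
      (∫ p, deriv (fun s => g s p) t ∂(riemVolume n M)) t :=
  hasDerivAt_integral_of_bound hI (fun _ hs => (hg.chartSmooth hs).continuous)
    (fun _ hs p => hg.hasDerivAt hI hs p)
    (fun _ hs => ((hg.deriv hI).chartSmooth hs).continuous.aestronglyMeasurable)
    (fun _ hJ hJI => exists_bound_of_continuousOn_prod (hg.deriv hI).continuousOn hJ hJI) ht

/-- The equation exhibits the regularized Laplacian as e^{nu} F_t − e₂^{n/2−1} A, which is visibly
continuous and independent of the chart, as the divergence theorem on M requires. -/
theorem RegFlow.weak (hf : RegFlow n a b ε C t₂ F u A) (hn : 2 ≤ n) (hε : 0 ≤ ε) {t : ℝ}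
    (ht : t ∈ Ioo 0 t₂) {ψ : M → EuclideanSpace ℝ (Fin L)} (hψ : ChartSmooth n ψ) :
    ∫ p, inner ℝ (Real.exp (n * u t p) • deriv (fun s => F s p) t -
        e2 n ε (F t) p ^ ((n : ℝ) / 2 - 1) • A t p) (ψ p) ∂(riemVolume n M) =
      - ∫ p, e2 n ε (F t) p ^ ((n : ℝ) / 2 - 1) * gradInner n (F t) ψ p ∂(riemVolume n M) := by
  have hF := hf.smooth_F.chartSmooth ht
  refine integral_inner_regLaplacian hn hε hF ?_ (fun x p hp => ?_) hψ
  · have h1 : Continuous fun p => Real.exp (n * u t p) :=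
      Real.continuous_exp.comp (continuous_const.mul (hf.smooth_u.chartSmooth ht).continuous)
    have h2 : Continuous fun p => deriv (fun s => F s p) t :=
      ((hf.smooth_F.deriv isOpen_Ioo).chartSmooth ht).continuous
    exact (h1.smul h2).sub ((continuous_e2_rpow hn hF).smul (hf.continuous_A t ht))
  · rw [hf.eq_F t ht x p hp, add_sub_cancel_right]

theorem continuousOn_e2 {I : Set ℝ} (hI : UniqueDiffOn ℝ I) (hF : SmoothFam n I F) :
    ContinuousOn (fun z : ℝ × M => e2 n ε (F z.1) z.2) (I ×ˢ univ) :=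
  continuousOn_const.add (hF.gradInner hI hF).continuousOn

theorem hasDerivAt_e2 {I : Set ℝ} (hI : IsOpen I) (hF : SmoothFam n I F) {t : ℝ} (ht : t ∈ I)
    (p : M) : HasDerivAt (fun s => e2 n ε (F s) p)
      (2 * gradInner n (F t) (fun q => deriv (fun s => F s q) t) p) t := by
  have h := (hasDerivAt_gradInner hI hF hF ht p).const_add ε
  convert! h using 1
  rw [gradInner_comm _ (F t), two_mul]

/-- The energy identity. -/
theorem RegFlow.hasDerivAt_energy (hf : RegFlow n a b ε C t₂ F u A) (hn : 2 ≤ n) (hε : 0 ≤ ε)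
    {t : ℝ} (ht : t ∈ Ioo 0 t₂) :
    HasDerivAt (fun s => energy n ε (F s))
      (-∫ p, Real.exp (n * u t p) * ‖deriv (fun s => F s p) t‖ ^ 2 ∂(riemVolume n M)) t := by
  have hn0 : (2 : ℝ) ≤ n := by exact_mod_cast hn
  have hI : IsOpen (Ioo 0 t₂) := isOpen_Ioo
  have hw := hf.smooth_F.deriv hI
  have hint := hasDerivAt_integral_of_bound (μ := riemVolume n M) hI
    (g := fun s p => e2 n ε (F s) p ^ ((n : ℝ) / 2))
    (g' := fun s p => n * (e2 n ε (F s) p ^ ((n : ℝ) / 2 - 1) *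
      gradInner n (F s) (fun q => deriv (fun s => F s q) s) p))
    (fun s hs => ((hf.smooth_F.chartSmooth hs).e2 ε).continuous.rpow_const
      fun _ => Or.inr (by linarith))
    (fun s hs p => by
      have h := (hasDerivAt_e2 (ε := ε) hI hf.smooth_F hs p).rpow_const (p := (n : ℝ) / 2)
        (Or.inr (by linarith))
      convert! h using 1
      ring)
    (fun s hs => (continuous_const.mul ((continuous_e2_rpow hn (hf.smooth_F.chartSmooth hs)).mul
      ((hf.smooth_F.chartSmooth hs).gradInner (hw.chartSmooth hs)).continuous)).aestronglyMeasurable)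
    (fun J hJ hJI => exists_bound_of_continuousOn_prod (continuousOn_const.mul
      (((continuousOn_e2 hI.uniqueDiffOn hf.smooth_F).rpow_const fun _ _ => Or.inr (by linarith)).mul
      (hf.smooth_F.gradInner hI.uniqueDiffOn hw).continuousOn)) hJ hJI) ht
  have h := hint.const_mul (1 / (n : ℝ))
  convert! h using 1
  rw [integral_const_mul, ← mul_assoc, one_div, inv_mul_cancel₀ (by linarith), one_mul]
  have hweak := hf.weak hn hε ht (hw.chartSmooth ht)
  rw [← neg_eq_iff_eq_neg] at hweak
  rw [← hweak]
  congr 1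
  refine integral_congr_ae (Filter.Eventually.of_forall fun p => ?_)
  simp only
  rw [inner_sub_left, real_inner_smul_left, real_inner_smul_left, hf.inner_A t ht, mul_zero, sub_zero,
    real_inner_self_eq_norm_sq]

end Flow

theorem contDiff_wPrim_norm_sq {W : Type*} [NormedAddCommGroup W] [InnerProductSpace ℝ W] (γ : ℝ) :
    ContDiff ℝ ∞ (fun w : W => wPrim γ (‖w‖ ^ 2)) :=
  ((((contDiff_const.add (contDiff_norm_sq ℝ)).rpow_const_of_ne fun w => by positivity).sub
    contDiff_const).div_const _)

/-! ### Differentiating the weak equation in time -/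

section Flow

variable {n : ℕ} {M : Type*} [TopologicalSpace M] [ChartedSpace (EuclideanSpace ℝ (Fin n)) M]
  [IsManifold (𝓡 n) ∞ M] [RiemannianBundle (fun x : M => TangentSpace (𝓡 n) x)] {L : ℕ}
  [IsContMDiffRiemannianBundle (𝓡 n) ∞ (EuclideanSpace ℝ (Fin n))
        (fun x : M => TangentSpace (𝓡 n) x)]
  [MeasurableSpace M] [BorelSpace M] [CompactSpace M] [T2Space M]
  {a b ε C t₂ : ℝ} {F : ℝ → M → EuclideanSpace ℝ (Fin L)} {u : ℝ → M → ℝ}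
  {A : ℝ → M → EuclideanSpace ℝ (Fin L)}

/-- The time derivative of `e₂^s ⟨dF, dG⟩`. -/
noncomputable def fluxDeriv (n : ℕ) {L : ℕ} {M : Type*} [TopologicalSpace M]
    [ChartedSpace (EuclideanSpace ℝ (Fin n)) M]
    [RiemannianBundle (fun x : M => TangentSpace (𝓡 n) x)] (ε : ℝ)
    (F w G G' : M → EuclideanSpace ℝ (Fin L)) (p : M) : ℝ :=
  e2 n ε F p ^ ((n : ℝ) / 2 - 1) * (gradInner n w G p + gradInner n F G' p) +
    (n - 2) * e2 n ε F p ^ ((n : ℝ) / 2 - 1 - 1) * (gradInner n F w p * gradInner n F G p)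

theorem hasDerivAt_e2_rpow_mul_gradInner (hn : 2 ≤ n) (hε : 0 ≤ ε) {I : Set ℝ} (hI : IsOpen I)
    {G : ℝ → M → EuclideanSpace ℝ (Fin L)} (hF : SmoothFam n I F) (hG : SmoothFam n I G) {t : ℝ}
    (ht : t ∈ I) (p : M) :
    HasDerivAt (fun s => e2 n ε (F s) p ^ ((n : ℝ) / 2 - 1) * gradInner n (F s) (G s) p)
      (fluxDeriv n ε (F t) (fun q => deriv (fun s => F s q) t) (G t)
        (fun q => deriv (fun s => G s q) t) p) t := by
  have hn0 : (2 : ℝ) ≤ n := by exact_mod_cast hn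
  -- Where e₂ vanishes dF does too, so the degenerate product rule applies.
  have hz : e2 n ε (F t) p = 0 → gradInner n (F t) (G t) p = 0 := fun h => by
    have h1 := abs_gradInner_le (n := n) (F t) (G t) p
    have h2 : normSqDiff (n := n) (F t) p = 0 :=
      le_antisymm ((normSqDiff_le_e2 hε _ _).trans h.le) (normSqDiff_nonneg _ _)
    rw [h2, Real.sqrt_zero, zero_mul] at h1
    exact abs_eq_zero.1 (le_antisymm h1 (abs_nonneg _))
  have h := (hasFDerivAt_rpow_smul (s := (n : ℝ) / 2 - 1) (by linarith)
    (hasDerivAt_e2 (ε := ε) hI hF ht p).hasFDerivAt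
    (hasDerivAt_gradInner hI hF hG ht p).hasFDerivAt hz).hasDerivAt
  convert! h using 1
  simp [fluxDeriv]
  ring

/-- Cauchy–Schwarz produces |dF|², and e₂^{s−1} |dF|² ≤ e₂^s, with s = n/2 − 1, removes the power
that may be negative. The resulting bound is continuous in space and time, hence locally bounded. -/
theorem abs_fluxDeriv_le (hn : 2 ≤ n) (hε : 0 ≤ ε) (F w G G' : M → EuclideanSpace ℝ (Fin L))
    (p : M) : |fluxDeriv n ε F w G G' p| ≤
      e2 n ε F p ^ ((n : ℝ) / 2 - 1) * (|gradInner n w G p + gradInner n F G' p| +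
        (n - 2) * (Real.sqrt (gradInner n w w p) * Real.sqrt (gradInner n G G p))) := by
  have hn0 : (2 : ℝ) ≤ n := by exact_mod_cast hn
  have he := e2_nonneg (n := n) hε F p
  have h0 : 0 ≤ e2 n ε F p ^ ((n : ℝ) / 2 - 1 - 1) := Real.rpow_nonneg he _
  have h1 : |gradInner n F w p * gradInner n F G p| ≤ normSqDiff (n := n) F p *
      (Real.sqrt (gradInner n w w p) * Real.sqrt (gradInner n G G p)) := by
    rw [abs_mul]
    refine (mul_le_mul (abs_gradInner_le F w p) (abs_gradInner_le F G p) (abs_nonneg _)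
      (by positivity)).trans (le_of_eq ?_)
    rw [mul_mul_mul_comm, Real.mul_self_sqrt (normSqDiff_nonneg F p)]
    rfl
  have h2 := e2_rpow_sub_one_mul_le (n := n) hε F p ((n : ℝ) / 2 - 1)
  refine (abs_add_le _ _).trans ?_
  rw [abs_mul, abs_mul, abs_mul, abs_of_nonneg (Real.rpow_nonneg he _), abs_of_nonneg h0,
    abs_of_nonneg (by linarith : (0 : ℝ) ≤ n - 2), mul_add]
  refine add_le_add le_rfl ?_
  calc (n - 2 : ℝ) * e2 n ε F p ^ ((n : ℝ) / 2 - 1 - 1) * |gradInner n F w p * gradInner n F G p|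
      ≤ (n - 2 : ℝ) * e2 n ε F p ^ ((n : ℝ) / 2 - 1 - 1) * (normSqDiff (n := n) F p *
        (Real.sqrt (gradInner n w w p) * Real.sqrt (gradInner n G G p))) :=
        mul_le_mul_of_nonneg_left h1 (mul_nonneg (by linarith) h0)
    _ = (n - 2 : ℝ) * (Real.sqrt (gradInner n w w p) * Real.sqrt (gradInner n G G p)) *
        (e2 n ε F p ^ ((n : ℝ) / 2 - 1 - 1) * normSqDiff (n := n) F p) := by ring
    _ ≤ (n - 2 : ℝ) * (Real.sqrt (gradInner n w w p) * Real.sqrt (gradInner n G G p)) *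
        (e2 n ε F p ^ ((n : ℝ) / 2 - 1)) :=
        mul_le_mul_of_nonneg_left h2 (mul_nonneg (by linarith) (by positivity))
    _ = _ := by ring

theorem hasDerivAt_integral_e2_rpow_mul_gradInner (hn : 2 ≤ n) (hε : 0 ≤ ε) {I : Set ℝ}
    (hI : IsOpen I) {G : ℝ → M → EuclideanSpace ℝ (Fin L)} (hF : SmoothFam n I F)
    (hG : SmoothFam n I G) {t : ℝ} (ht : t ∈ I) :
    Integrable (fluxDeriv n ε (F t) (fun q => deriv (fun s => F s q) t) (G t)
        (fun q => deriv (fun s => G s q) t)) (riemVolume n M) ∧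
    HasDerivAt (fun s => ∫ p, e2 n ε (F s) p ^ ((n : ℝ) / 2 - 1) * gradInner n (F s) (G s) p
        ∂(riemVolume n M))
      (∫ p, fluxDeriv n ε (F t) (fun q => deriv (fun s => F s q) t) (G t)
        (fun q => deriv (fun s => G s q) t) p ∂(riemVolume n M)) t := by
  have hn0 : (2 : ℝ) ≤ n := by exact_mod_cast hn
  have hw := hF.deriv hI
  have hG' := hG.deriv hI
  have hm : ∀ t ∈ I, AEStronglyMeasurable (fluxDeriv n ε (F t) (fun q => deriv (fun s => F s q) t)
      (G t) (fun q => deriv (fun s => G s q) t)) (riemVolume n M) := fun t ht => by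
    have cF := hF.chartSmooth ht
    have cw := hw.chartSmooth ht
    have cG := hG.chartSmooth ht
    have cG' := hG'.chartSmooth ht
    have h1 := (continuous_e2_rpow (ε := ε) hn cF).mul
      ((cw.gradInner cG).continuous.add (cF.gradInner cG').continuous)
    -- For n = 3 this exponent is −1/2, so the factor need not be continuous at zeros of e₂;
    -- measurability is enough.
    have h2 := ((cF.e2 ε).continuous.measurable.pow_const ((n : ℝ) / 2 - 1 - 1)).const_mul
      ((n : ℝ) - 2)
    have h3 := (cF.gradInner cw).continuous.mul (cF.gradInner cG).continuous
    exact h1.aestronglyMeasurable.add (h2.mul h3.measurable).aestronglyMeasurable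
  have hb : ∀ J : Set ℝ, IsCompact J → J ⊆ I → ∃ C, ∀ t ∈ J, ∀ p,
      |fluxDeriv n ε (F t) (fun q => deriv (fun s => F s q) t)
        (G t) (fun q => deriv (fun s => G s q) t) p| ≤ C := fun J hJ hJI => by
    have hu : UniqueDiffOn ℝ I := hI.uniqueDiffOn
    obtain ⟨C, hC⟩ := exists_bound_of_continuousOn_prod (I := I) (g := fun t p =>
      e2 n ε (F t) p ^ ((n : ℝ) / 2 - 1) *
        (|gradInner n (fun q => deriv (fun s => F s q) t) (G t) p +
          gradInner n (F t) (fun q => deriv (fun s => G s q) t) p| +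
        (n - 2) * (Real.sqrt (gradInner n (fun q => deriv (fun s => F s q) t)
          (fun q => deriv (fun s => F s q) t) p) *
          Real.sqrt (gradInner n (G t) (G t) p))))
      (((continuousOn_e2 hu hF).rpow_const fun _ _ => Or.inr (by linarith)).mul
        ((((hw.gradInner hu hG).continuousOn.add (hF.gradInner hu hG').continuousOn).abs).add
          ((continuousOn_const (c := (n : ℝ) - 2)).mul ((hw.gradInner hu hw).continuousOn.sqrt.mul
            (hG.gradInner hu hG).continuousOn.sqrt)))) hJ hJI
    exact ⟨C, fun t ht p => (abs_fluxDeriv_le hn hε _ _ _ _ p).trans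
      ((le_abs_self _).trans (hC t ht p))⟩
  constructor
  · obtain ⟨C, hC⟩ := hb {t} isCompact_singleton (singleton_subset_iff.2 ht)
    exact (integrable_const C).mono' (hm t ht)
      (Filter.Eventually.of_forall fun p => by rw [Real.norm_eq_abs]; exact hC t rfl p)
  · exact hasDerivAt_integral_of_bound hI
      (fun s hs => (continuous_e2_rpow hn (hF.chartSmooth hs)).mul
        ((hF.chartSmooth hs).gradInner (hG.chartSmooth hs)).continuous)
      (fun s hs p => hasDerivAt_e2_rpow_mul_gradInner hn hε hI hF hG hs p) hm hb ht

theorem RegFlow.smooth_exp (hf : RegFlow n a b ε C t₂ F u A) :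
    SmoothFam n (Ioo 0 t₂) (fun t p => Real.exp (n * u t p)) :=
  hf.smooth_u.comp (Real.contDiff_exp.comp (contDiff_const.mul contDiff_id))

theorem RegFlow.smooth_vel (hf : RegFlow n a b ε C t₂ F u A) :
    SmoothFam n (Ioo 0 t₂) (fun t p => deriv (fun s => F s p) t) := hf.smooth_F.deriv isOpen_Ioo

theorem RegFlow.smooth_wVec (hf : RegFlow n a b ε C t₂ F u A) (γ : ℝ) :
    SmoothFam n (Ioo 0 t₂) (fun t p => wVec γ (deriv (fun s => F s p) t)) :=
  hf.smooth_vel.comp (contDiff_wVec γ)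

theorem RegFlow.smooth_wPrim (hf : RegFlow n a b ε C t₂ F u A) (γ : ℝ) :
    SmoothFam n (Ioo 0 t₂) (fun t p => Real.exp (n * u t p) *
      wPrim γ (‖deriv (fun s => F s p) t‖ ^ 2)) :=
  hf.smooth_exp.mul (hf.smooth_vel.comp (contDiff_wPrim_norm_sq γ))

theorem RegFlow.hasDerivAt_exp (hf : RegFlow n a b ε C t₂ F u A) {t : ℝ} (ht : t ∈ Ioo 0 t₂)
    (p : M) : HasDerivAt (fun s => Real.exp (n * u s p))
      (n * (b * e2 n ε (F t) p ^ ((n : ℝ) / 2) - a * Real.exp (n * u t p))) t := by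
  have h := ((hf.smooth_u.hasDerivAt isOpen_Ioo ht p).const_mul (n : ℝ)).exp
  rw [← hf.eq_u t ht p]
  convert! h using 1
  ring

/-- Testing the equation with `h w` at varying times. -/
theorem RegFlow.integral_deriv_inner_wVec (hf : RegFlow n a b ε C t₂ F u A) (hn : 2 ≤ n)
    (hε : 0 ≤ ε) (γ : ℝ) {t : ℝ} (ht : t ∈ Ioo 0 t₂) :
    ∫ p, deriv (fun s => Real.exp (n * u s p) * inner ℝ (deriv (fun s => F s p) s)
        (wVec γ (deriv (fun s => F s p) s))) t ∂(riemVolume n M) =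
      -∫ p, fluxDeriv n ε (F t) (fun q => deriv (fun s => F s q) t)
        (fun q => wVec γ (deriv (fun s => F s q) t))
        (fun q => deriv (fun s => wVec γ (deriv (fun s => F s q) s)) t) p ∂(riemVolume n M) := by
  have h1 := hasDerivAt_integral_smoothFam isOpen_Ioo
    (hf.smooth_exp.mul (hf.smooth_vel.inner (hf.smooth_wVec γ))) ht
  have h2 := (hasDerivAt_integral_e2_rpow_mul_gradInner hn hε isOpen_Ioo hf.smooth_F
    (hf.smooth_wVec γ) ht).2.neg
  refine (h1.congr_of_eventuallyEq ?_).unique h2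
  -- At each time the weak equation tested with the weighted velocity holds, A dropping out by
  -- orthogonality. The two sides, as functions of time, have the same derivative; neither A nor the
  -- strong equation is ever differentiated.
  filter_upwards [isOpen_Ioo.mem_nhds ht] with s hs
  rw [Pi.neg_apply, ← hf.weak hn hε hs ((hf.smooth_wVec γ).chartSmooth hs)]
  refine integral_congr_ae (Filter.Eventually.of_forall fun p => ?_)
  simp only
  rw [inner_sub_left, real_inner_smul_left, real_inner_smul_left, inner_wVec γ _ (A s p),
    hf.inner_A s hs, mul_zero, mul_zero, sub_zero]

end Flow

/-! ### The dissipation inequality and the gain of integrability -/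

section Flow

section Defs

variable (n : ℕ) {M : Type*} [TopologicalSpace M] [ChartedSpace (EuclideanSpace ℝ (Fin n)) M]
  [RiemannianBundle (fun x : M => TangentSpace (𝓡 n) x)] {L : ℕ} [MeasurableSpace M]
  (F : ℝ → M → EuclideanSpace ℝ (Fin L)) (u : ℝ → M → ℝ)

/-- `∫ e^{nu} |F_t|² (1 + |F_t|²)^γ`. -/
noncomputable def velMass (γ t : ℝ) : ℝ :=
  ∫ p, Real.exp (n * u t p) * (‖deriv (fun s => F s p) t‖ ^ 2 *
    (1 + ‖deriv (fun s => F s p) t‖ ^ 2) ^ γ) ∂(riemVolume n M)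

/-- `∫ e^{nu} ∫₀^{|F_t|²} (1 + σ)^γ dσ`. -/
noncomputable def velPrim (γ t : ℝ) : ℝ :=
  ∫ p, Real.exp (n * u t p) * wPrim γ (‖deriv (fun s => F s p) t‖ ^ 2) ∂(riemVolume n M)

/-- The quantity dissipated by `velPrim`. -/
noncomputable def velDissip (ε γ t : ℝ) : ℝ :=
  ∫ p, (e2 n ε (F t) p ^ ((n : ℝ) / 2) * (‖deriv (fun s => F s p) t‖ ^ 2 *
    (1 + ‖deriv (fun s => F s p) t‖ ^ 2) ^ γ) +
    e2 n ε (F t) p ^ ((n : ℝ) / 2 - 1) * ((1 + ‖deriv (fun s => F s p) t‖ ^ 2) ^ γ *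
      normSqDiff (n := n) (fun q => deriv (fun s => F s q) t) p)) ∂(riemVolume n M)

end Defs

variable {n : ℕ} {M : Type*} [TopologicalSpace M] [ChartedSpace (EuclideanSpace ℝ (Fin n)) M]
  [IsManifold (𝓡 n) ∞ M] [RiemannianBundle (fun x : M => TangentSpace (𝓡 n) x)] {L : ℕ}
  [IsContMDiffRiemannianBundle (𝓡 n) ∞ (EuclideanSpace ℝ (Fin n))
        (fun x : M => TangentSpace (𝓡 n) x)]
  [MeasurableSpace M] [BorelSpace M] [CompactSpace M] [T2Space M]
  {a b ε C t₂ : ℝ} {F : ℝ → M → EuclideanSpace ℝ (Fin L)} {u : ℝ → M → ℝ}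
  {A : ℝ → M → EuclideanSpace ℝ (Fin L)}

theorem RegFlow.deriv_wVec (hf : RegFlow n a b ε C t₂ F u A) (γ : ℝ) {t : ℝ} (ht : t ∈ Ioo 0 t₂)
    (p : M) : HasDerivAt (fun s => wVec γ (deriv (fun s => F s p) s))
      ((1 + ‖deriv (fun s => F s p) t‖ ^ 2) ^ γ • deriv (fun s => deriv (fun s => F s p) s) t +
        (2 * (γ * (1 + ‖deriv (fun s => F s p) t‖ ^ 2) ^ (γ - 1)) *
          inner ℝ (deriv (fun s => F s p) t) (deriv (fun s => deriv (fun s => F s p) s) t)) •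
          deriv (fun s => F s p) t) t :=
  (hasFDerivAt_wVec γ (deriv (fun s => F s p) t)).comp_hasDerivAt t
    (hf.smooth_vel.hasDerivAt isOpen_Ioo ht p)

theorem RegFlow.continuous_dissip (hf : RegFlow n a b ε C t₂ F u A) (hn : 2 ≤ n) (γ : ℝ) {t : ℝ}
    (ht : t ∈ Ioo 0 t₂) : Continuous fun p =>
      (e2 n ε (F t) p ^ ((n : ℝ) / 2) * (‖deriv (fun s => F s p) t‖ ^ 2 *
    (1 + ‖deriv (fun s => F s p) t‖ ^ 2) ^ γ) +
    e2 n ε (F t) p ^ ((n : ℝ) / 2 - 1) * ((1 + ‖deriv (fun s => F s p) t‖ ^ 2) ^ γ *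
      normSqDiff (n := n) (fun q => deriv (fun s => F s q) t) p)) := by
  have cF := hf.smooth_F.chartSmooth ht
  have cw := hf.smooth_vel.chartSmooth ht
  have c1 : Continuous fun p => e2 n ε (F t) p ^ ((n : ℝ) / 2) :=
    (cF.e2 ε).continuous.rpow_const fun _ => Or.inr (div_nonneg (Nat.cast_nonneg n) zero_le_two)
  have c2 : Continuous fun p => ‖deriv (fun s => F s p) t‖ ^ 2 := cw.continuous.norm.pow 2
  have c3 : Continuous fun p => (1 + ‖deriv (fun s => F s p) t‖ ^ 2) ^ γ :=
    (continuous_const.add c2).rpow_const fun p =>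
      Or.inl (ne_of_gt (add_pos_of_pos_of_nonneg one_pos (sq_nonneg _)))
  have c4 : Continuous (normSqDiff (n := n) (fun q => deriv (fun s => F s q) t)) :=
    (cw.gradInner cw).continuous
  exact (c1.mul (c2.mul c3)).add ((continuous_e2_rpow hn cF).mul (c3.mul c4))

/-- The pointwise form of the dissipation inequality. -/
theorem RegFlow.dissipation_pointwise (hf : RegFlow n a b ε C t₂ F u A) (hn : 2 ≤ n) (hn4 : n ≤ 4)
    (hε : 0 ≤ ε) (ha : 0 < a) (hC : 0 ≤ C) {c : ℝ} (hc0 : 0 < c) (hc : n * b / 2 - C - 2 * C ^ 2 = c)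
    {γ : ℝ} (hγ : 0 ≤ γ) (hγ1 : γ ≤ 17 / 16) {t : ℝ} (ht : t ∈ Ioo 0 t₂) (p : M) :
    deriv (fun s => Real.exp (n * u s p) * wPrim γ (‖deriv (fun s => F s p) s‖ ^ 2)) t -
      2 * deriv (fun s => Real.exp (n * u s p) * inner ℝ (deriv (fun s => F s p) s)
        (wVec γ (deriv (fun s => F s p) s))) t -
      2 * fluxDeriv n ε (F t) (fun q => deriv (fun s => F s q) t)
        (fun q => wVec γ (deriv (fun s => F s q) t))
        (fun q => deriv (fun s => wVec γ (deriv (fun s => F s q) s)) t) p +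
      2 * inner ℝ (Real.exp (n * u t p) • deriv (fun s => F s p) t -
        e2 n ε (F t) p ^ ((n : ℝ) / 2 - 1) • A t p)
        (deriv (fun s => wVec γ (deriv (fun s => F s p) s)) t) +
      2 * (e2 n ε (F t) p ^ ((n : ℝ) / 2 - 1) * gradInner n (F t)
        (fun q => deriv (fun s => wVec γ (deriv (fun s => F s q) s)) t) p) ≤
    4 * n * a * (Real.exp (n * u t p) * wPrim γ (‖deriv (fun s => F s p) t‖ ^ 2)) -
      min 1 (2 * c) * (e2 n ε (F t) p ^ ((n : ℝ) / 2) * (‖deriv (fun s => F s p) t‖ ^ 2 *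
    (1 + ‖deriv (fun s => F s p) t‖ ^ 2) ^ γ) +
    e2 n ε (F t) p ^ ((n : ℝ) / 2 - 1) * ((1 + ‖deriv (fun s => F s p) t‖ ^ 2) ^ γ *
      normSqDiff (n := n) (fun q => deriv (fun s => F s q) t) p)) := by
  have hn0 : (2 : ℝ) ≤ n := by exact_mod_cast hn
  have hn4' : (n : ℝ) ≤ 4 := by exact_mod_cast hn4
  set w := deriv (fun s => F s p) t with hw
  set w' := deriv (fun s => deriv (fun s => F s p) s) t with hw'
  have dw : HasDerivAt (fun s => deriv (fun s => F s p) s) w' t :=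
    hf.smooth_vel.hasDerivAt isOpen_Ioo ht p
  have dψ := hf.deriv_wVec γ ht p
  have dE := hf.hasDerivAt_exp ht p
  have dσ : HasDerivAt (fun s => ‖deriv (fun s => F s p) s‖ ^ 2) (2 * inner ℝ w w') t := dw.norm_sq
  have dΦ := (hasDerivAt_wPrim hγ (sq_nonneg ‖w‖)).comp t dσ
  have d1 := dE.mul dΦ
  have d2 := dE.mul (dw.inner ℝ dψ)
  -- Coercivity with α = dF, β = dw and m = n − 2, which lies in [0, 2] because n ≤ 4.
  have coer := coercivity (α := frameDiff n (F t) p)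
    (β := frameDiff n (fun q => deriv (fun s => F s q) t) p) (w := w)
    (h := (1 + ‖w‖ ^ 2) ^ γ) (h' := γ * (1 + ‖w‖ ^ 2) ^ (γ - 1)) (γ := γ) (e := e2 n ε (F t) p)
    (s := (n : ℝ) / 2 - 1) (m := n - 2) (by positivity) hγ hγ1
    (weight_mul_weight_deriv (sq_nonneg _))
    ((sum_norm_frameDiff_sq (F t) p).le.trans (normSqDiff_le_e2 hε _ _)) (by linarith)
    (by linarith)
  have gw : gradInner n (fun q => deriv (fun s => F s q) t)
      (fun q => wVec γ (deriv (fun s => F s q) t)) p =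
      ∑ k, inner ℝ (frameDiff n (fun q => deriv (fun s => F s q) t) p k)
        ((1 + ‖w‖ ^ 2) ^ γ • frameDiff n (fun q => deriv (fun s => F s q) t) p k +
          (2 * (γ * (1 + ‖w‖ ^ 2) ^ (γ - 1)) *
            inner ℝ w (frameDiff n (fun q => deriv (fun s => F s q) t) p k)) • w) := by
    rw [gradInner_eq_sum]
    exact Finset.sum_congr rfl fun k _ => by
      rw [frameDiff_wVec γ (hf.smooth_vel.chartSmooth ht)]
  have gF : gradInner n (F t) (fun q => wVec γ (deriv (fun s => F s q) t)) p =
      ∑ k, inner ℝ (frameDiff n (F t) p k)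
        ((1 + ‖w‖ ^ 2) ^ γ • frameDiff n (fun q => deriv (fun s => F s q) t) p k +
          (2 * (γ * (1 + ‖w‖ ^ 2) ^ (γ - 1)) *
            inner ℝ w (frameDiff n (fun q => deriv (fun s => F s q) t) p k)) • w) := by
    rw [gradInner_eq_sum]
    exact Finset.sum_congr rfl fun k _ => by
      rw [frameDiff_wVec γ (hf.smooth_vel.chartSmooth ht)]
  rw [← gw, ← gF, ← gradInner_eq_sum, sum_norm_frameDiff_sq] at coer
  have accel := hf.accel_A t ht p
  have hAw := hf.inner_A t ht p
  have he := e2_rpow_mul_e2 (n := n) hε (F t) p hn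
  have hen := normSqDiff_le_e2 (n := n) hε (F t) p
  have he0 : 0 ≤ e2 n ε (F t) p ^ ((n : ℝ) / 2 - 1) := Real.rpow_nonneg (e2_nonneg hε _ _) _
  have hE0 : 0 ≤ e2 n ε (F t) p ^ ((n : ℝ) / 2) := Real.rpow_nonneg (e2_nonneg hε _ _) _
  have hP0 := wPrim_nonneg hγ (sq_nonneg ‖w‖)
  have hP1 := wPrim_le hγ (sq_nonneg ‖w‖)
  have hP2 := le_wPrim hγ (sq_nonneg ‖w‖)
  have hh0 : 0 ≤ (1 + ‖w‖ ^ 2) ^ γ := by positivity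
  have hx0 := (Real.exp_pos (n * u t p)).le
  have e1 := d1.deriv
  have e2' := d2.deriv
  have e3 := dψ.deriv
  simp only [Function.comp_def, Pi.mul_def] at e1 e2'
  rw [e1, e2', e3]
  have hB0 := normSqDiff_nonneg (n := n) (fun q => deriv (fun s => F s q) t) p
  rw [← hw, ← hw'] at accel
  rw [← hw] at hAw
  -- With ψ the weighted velocity, the terms e^{nu} ⟨w, w_t⟩, e^{nu} ⟨w, ψ_t⟩ and ⟨dF, dψ_t⟩ all
  -- cancel on the left. There remain the terms with the time derivative of e^{nu}, the quadratic
  -- form of `coer`, and −2 e₂^{n/2−1} h ⟨A, w_t⟩.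
  simp only [fluxDeriv, inner_wVec, inner_add_right, inner_sub_left, real_inner_smul_left,
    real_inner_smul_right, real_inner_self_eq_norm_sq, hAw, ← hw, ← hw'] at coer ⊢
  rw [real_inner_comm w w'] at *
  generalize Real.exp (n * u t p) = x at *
  generalize (1 + ‖w‖ ^ 2) ^ γ = h at *
  generalize wPrim γ (‖w‖ ^ 2) = Φ at *
  generalize (1 + ‖w‖ ^ 2) ^ (γ - 1) = h' at *
  generalize ‖w‖ ^ 2 = σ at *
  generalize inner ℝ w w' = ww at *
  generalize inner ℝ (A t p) w' = α at *
  generalize e2 n ε (F t) p ^ ((n : ℝ) / 2 - 1 - 1) = S' at *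
  generalize e2 n ε (F t) p ^ ((n : ℝ) / 2 - 1) = S at *
  generalize e2 n ε (F t) p ^ ((n : ℝ) / 2) = E at *
  generalize normSqDiff (n := n) (fun q => deriv (fun s => F s q) t) p = N at *
  have hσ0 : 0 ≤ h * σ := hP0.trans (hP1.trans_eq (mul_comm _ _))
  have i2 : -(2 * (S * (h * α))) ≤ 2 * C ^ 2 * (E * (h * σ)) := by
    have j1 : -α ≤ C ^ 2 * normSqDiff (n := n) (F t) p * σ := (neg_le_abs α).trans accel
    have j2 : S * normSqDiff (n := n) (F t) p ≤ E :=
      (mul_le_mul_of_nonneg_left hen he0).trans_eq he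
    have j3 := mul_le_mul_of_nonneg_left j1 (mul_nonneg he0 hh0)
    have j4 := mul_le_mul_of_nonneg_right j2 (mul_nonneg (sq_nonneg C) hσ0)
    linarith
  have hb : 0 ≤ n * b := by linarith [sq_nonneg C]
  -- The growth b e₂^{n/2} of the conformal factor acts as damping: it multiplies Φ − 2hσ, which is
  -- at most −hσ since Φ ≤ hσ.
  have i3 : n * b * E * (Φ - 2 * (h * σ)) ≤ -(n * b * E * (h * σ)) := by
    have := mul_le_mul_of_nonneg_left hP1 (mul_nonneg hb hE0)
    linarith
  -- From hσ ≤ (1 + γ) Φ and γ ≤ 17/16, 2hσ − Φ ≤ (25/8) Φ ≤ 4Φ; this is the source of 4na.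
  have i4 : n * a * x * (2 * (h * σ) - Φ) ≤ 4 * n * a * (x * Φ) := by
    have j1 : 2 * (h * σ) - Φ ≤ 4 * Φ := by
      linarith [mul_le_mul_of_nonneg_right hγ1 hP0]
    have := mul_le_mul_of_nonneg_left j1
      (mul_nonneg (mul_nonneg (by linarith : (0 : ℝ) ≤ n) ha.le) hx0)
    linarith
  have i5 : min 1 (2 * c) * (E * (h * σ)) ≤ 2 * c * (E * (h * σ)) :=
    mul_le_mul_of_nonneg_right (min_le_right _ _) (mul_nonneg hE0 hσ0)
  have i6 : min 1 (2 * c) * (S * (h * N)) ≤ 1 * (S * (h * N)) :=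
    mul_le_mul_of_nonneg_right (min_le_left _ _) (mul_nonneg he0 (mul_nonneg hh0 hB0))
  have i7 : 0 ≤ (C + C ^ 2) * (E * (h * σ)) :=
    mul_nonneg (by positivity) (mul_nonneg hE0 hσ0)
  -- Of nb = 2c + 2C + 4C², the curvature term uses 2C², the dissipation uses 2c, and the remainder
  -- is nonnegative.
  have i8 : n * b * (E * (h * σ)) = 2 * (c + C + 2 * C ^ 2) * (E * (h * σ)) := by
    rw [← hc]; ring
  linarith

/-- The dissipation inequality `Z' ≤ 4naZ - cG`. -/
theorem RegFlow.exists_hasDerivAt_velPrim (hf : RegFlow n a b ε C t₂ F u A) (hn : 2 ≤ n)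
    (hn4 : n ≤ 4) (hε : 0 ≤ ε) (ha : 0 < a) (hC : 0 ≤ C) {c : ℝ} (hc0 : 0 < c)
    (hc : n * b / 2 - C - 2 * C ^ 2 = c) {γ : ℝ} (hγ : 0 ≤ γ) (hγ1 : γ ≤ 17 / 16) {t : ℝ}
    (ht : t ∈ Ioo 0 t₂) : ∃ Z', HasDerivAt (velPrim n F u γ) Z' t ∧
      Z' ≤ 4 * n * a * velPrim n F u γ t - min 1 (2 * c) * velDissip n F ε γ t := by
  have hI : IsOpen (Ioo 0 t₂) := isOpen_Ioo
  have hΦ := hf.smooth_wPrim γ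
  refine ⟨_, hasDerivAt_integral_smoothFam hI hΦ ht, ?_⟩
  have hψ := hf.smooth_wVec γ
  have hd := hf.smooth_exp.mul (hf.smooth_vel.inner hψ)
  have cψ' := (hψ.deriv hI).chartSmooth ht
  have cF := hf.smooth_F.chartSmooth ht
  have i1 := integrable_of_continuous (n := n) ((hΦ.deriv hI).chartSmooth ht).continuous
  have i2 := (integrable_of_continuous (n := n) ((hd.deriv hI).chartSmooth ht).continuous).const_mul 2
  have i3 := (hasDerivAt_integral_e2_rpow_mul_gradInner hn hε hI hf.smooth_F hψ ht).1.const_mul 2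
  have i4 : Integrable (fun p => 2 * inner ℝ (Real.exp (n * u t p) • deriv (fun s => F s p) t -
        e2 n ε (F t) p ^ ((n : ℝ) / 2 - 1) • A t p)
        (deriv (fun s => wVec γ (deriv (fun s => F s p) s)) t)) (riemVolume n M) := by
    have h1 : Continuous fun p => Real.exp (n * u t p) • deriv (fun s => F s p) t :=
      (hf.smooth_exp.chartSmooth ht).continuous.smul (hf.smooth_vel.chartSmooth ht).continuous
    exact (integrable_of_continuous ((h1.sub ((continuous_e2_rpow hn cF).smul
      (hf.continuous_A t ht))).inner cψ'.continuous)).const_mul 2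
  have i5 : Integrable (fun p => 2 * (e2 n ε (F t) p ^ ((n : ℝ) / 2 - 1) * gradInner n (F t)
      (fun q => deriv (fun s => wVec γ (deriv (fun s => F s q) s)) t) p)) (riemVolume n M) :=
    (integrable_of_continuous (n := n) ((continuous_e2_rpow (ε := ε) hn cF).mul
    (cF.gradInner cψ').continuous)).const_mul 2
  have i6 := (integrable_of_continuous (n := n) (hΦ.chartSmooth ht).continuous).const_mul (4 * n * a)
  have i7 := (integrable_of_continuous (n := n) (hf.continuous_dissip hn γ ht)).const_mul (min 1 (2 * c))
  -- The four extra terms on the left integrate to zero: the first pair by the differentiated weak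
  -- equation, the second by the weak equation tested with the time derivative of the weighted
  -- velocity.
  have key := integral_mono ((((i1.sub i2).sub i3).add i4).add i5) (i6.sub i7)
    fun p => hf.dissipation_pointwise hn hn4 hε ha hC hc0 hc hγ hγ1 ht p
  rw [integral_add' (((i1.sub i2).sub i3).add i4) i5, integral_add' ((i1.sub i2).sub i3) i4,
    integral_sub' (i1.sub i2) i3, integral_sub' i1 i2, integral_sub' i6 i7, integral_const_mul,
    integral_const_mul, integral_const_mul, integral_const_mul, integral_const_mul,
    integral_const_mul, hf.integral_deriv_inner_wVec hn hε γ ht, hf.weak hn hε ht cψ'] at key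
  rw [velPrim, velDissip]
  linarith

/-- Integrability gain: testing the equation with `(1 + |w|²)^{γ + 1/2} w`. -/
theorem RegFlow.velMass_add_half_le (hf : RegFlow n a b ε C t₂ F u A) (hn : 2 ≤ n)
    (hε : 0 ≤ ε) {γ : ℝ} (hγ : 0 ≤ γ) (hγ2 : γ ≤ 2) {t : ℝ} (ht : t ∈ Ioo 0 t₂) :
    velMass n F u (γ + 1 / 2) t ≤ 6 * velDissip n F ε γ t + 12 * n * energy n ε (F t) := by
  have hn0 : (2 : ℝ) ≤ n := by exact_mod_cast hn
  have cF := hf.smooth_F.chartSmooth ht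
  have cψ := (hf.smooth_wVec (γ + 1 / 2)).chartSmooth ht
  have hweak := hf.weak hn hε ht cψ
  have h1 : velMass n F u (γ + 1 / 2) t =
      ∫ p, inner ℝ (Real.exp (n * u t p) • deriv (fun s => F s p) t -
        e2 n ε (F t) p ^ ((n : ℝ) / 2 - 1) • A t p) (wVec (γ + 1 / 2) (deriv (fun s => F s p) t))
        ∂(riemVolume n M) := by
    refine integral_congr_ae (Filter.Eventually.of_forall fun p => ?_)
    simp only
    rw [inner_sub_left, real_inner_smul_left, real_inner_smul_left, inner_wVec _ _ (A t p),
      hf.inner_A t ht, inner_self_wVec, mul_zero, mul_zero, sub_zero]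
  have h2 : 12 * n * energy n ε (F t) =
      ∫ p, 12 * e2 n ε (F t) p ^ ((n : ℝ) / 2) ∂(riemVolume n M) := by
    rw [energy, integral_const_mul]
    field_simp
  have c1 : Continuous fun p => e2 n ε (F t) p ^ ((n : ℝ) / 2) :=
    (cF.e2 ε).continuous.rpow_const fun _ => Or.inr (by linarith)
  rw [h1, hweak, h2, velDissip, ← integral_const_mul, ← integral_neg, ← integral_add
    ((integrable_of_continuous (hf.continuous_dissip hn γ ht)).const_mul 6)
    ((integrable_of_continuous c1).const_mul 12)]
  refine integral_mono (integrable_of_continuous ((continuous_e2_rpow hn cF).mul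
    (cF.gradInner cψ).continuous)).neg
    (((integrable_of_continuous (hf.continuous_dissip hn γ ht)).const_mul 6).add
    ((integrable_of_continuous c1).const_mul 12)) fun p => ?_
  simp only
  set w := deriv (fun s => F s p) t with hw
  have hσ := sq_nonneg ‖w‖
  have key := sum_inner_test_le (α := frameDiff n (F t) p)
    (β := frameDiff n (fun q => deriv (fun s => F s q) t) p) (w := w)
    (h := (1 + ‖w‖ ^ 2) ^ (γ + 1 / 2)) (h' := (γ + 1 / 2) * (1 + ‖w‖ ^ 2) ^ (γ + 1 / 2 - 1))
    (γ := γ + 1 / 2) (h₀ := (1 + ‖w‖ ^ 2) ^ γ) (h₁ := (1 + ‖w‖ ^ 2) ^ (γ + 1))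
    (e := e2 n ε (F t) p) (by positivity) (by linarith) (by positivity)
    (weight_mul_weight_deriv hσ)
    ((sum_norm_frameDiff_sq (F t) p).le.trans (normSqDiff_le_e2 hε _ _)) (by positivity)
    (by positivity) (weight_add_half_sq hσ)
  have gF : gradInner n (F t) (fun q => wVec (γ + 1 / 2) (deriv (fun s => F s q) t)) p =
      ∑ k, inner ℝ (frameDiff n (F t) p k)
        ((1 + ‖w‖ ^ 2) ^ (γ + 1 / 2) • frameDiff n (fun q => deriv (fun s => F s q) t) p k +
          (2 * ((γ + 1 / 2) * (1 + ‖w‖ ^ 2) ^ (γ + 1 / 2 - 1)) *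
            inner ℝ w (frameDiff n (fun q => deriv (fun s => F s q) t) p k)) • w) := by
    rw [gradInner_eq_sum]
    exact Finset.sum_congr rfl fun k _ => by
      rw [frameDiff_wVec _ (hf.smooth_vel.chartSmooth ht)]
  rw [← gF, sum_norm_frameDiff_sq] at key
  have he := e2_rpow_mul_e2 (n := n) hε (F t) p hn
  have he0 : 0 ≤ e2 n ε (F t) p ^ ((n : ℝ) / 2 - 1) := Real.rpow_nonneg (e2_nonneg hε _ _) _
  have hE0 : 0 ≤ e2 n ε (F t) p ^ ((n : ℝ) / 2) := Real.rpow_nonneg (e2_nonneg hε _ _) _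
  -- The bound 3 (e₂^{n/2−1} h |dw|² + e₂^{n/2} (1 + σ)^{γ+1}), with the last weight at most 2σh +
  -- 4, gives the constants 6 and 12.
  have hs := mul_le_mul_of_nonneg_left (weight_succ_le hγ hγ2 hσ) hE0
  have hk := mul_le_mul_of_nonneg_left ((neg_le_abs _).trans key) he0
  have hB := mul_nonneg he0 (mul_nonneg (Real.rpow_nonneg (by positivity) γ :
    0 ≤ (1 + ‖w‖ ^ 2) ^ γ) (normSqDiff_nonneg (n := n) (fun q => deriv (fun s => F s q) t) p))
  have he' : e2 n ε (F t) p ^ ((n : ℝ) / 2 - 1) * ((1 + ‖w‖ ^ 2) ^ (γ + 1) * e2 n ε (F t) p) =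
    e2 n ε (F t) p ^ ((n : ℝ) / 2) * (1 + ‖w‖ ^ 2) ^ (γ + 1) := by rw [← he]; ring
  linarith

end Flow

/-! ### The abstract iteration of time-weighted bounds -/

section Gain

/-- A weighted space-time bound for `X` from a Lyapunov function: `B' ≤ D - (t - s)^j X`. -/
def GainBound (X : ℝ → ℝ) (s T : ℝ) (j : ℕ) (C D : ℝ) : Prop :=
  ∃ B : ℝ → ℝ, B s ≤ C ∧ ∀ t ∈ Ico s T, 0 ≤ B t ∧
    ∃ B', HasDerivAt B B' t ∧ B' ≤ D - (t - s) ^ j * X t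

theorem GainBound.mono {X Y : ℝ → ℝ} {s T : ℝ} {j : ℕ} {C D : ℝ} (h : GainBound X s T j C D)
    (hXY : ∀ t ∈ Ico s T, Y t ≤ X t) : GainBound Y s T j C D := by
  obtain ⟨B, h1, h2⟩ := h
  refine ⟨B, h1, fun t ht => ⟨(h2 t ht).1, ?_⟩⟩
  obtain ⟨B', h3, h4⟩ := (h2 t ht).2
  exact ⟨B', h3, h4.trans (sub_le_sub_left (mul_le_mul_of_nonneg_left (hXY t ht)
    (pow_nonneg (sub_nonneg.2 ht.1) j)) D)⟩

theorem le_of_hasDerivAt_le {B : ℝ → ℝ} {s T D : ℝ}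
    (h : ∀ t ∈ Ico s T, ∃ B', HasDerivAt B B' t ∧ B' ≤ D) {t : ℝ} (ht : t ∈ Ico s T) :
    B t ≤ B s + D * (t - s) := by
  have hsub : Icc s t ⊆ Ico s T := fun x hx => ⟨hx.1, hx.2.trans_lt ht.2⟩
  have h1 := (convex_Icc s t).image_sub_le_mul_sub_of_deriv_le (f := B) (C := D)
    (fun x hx => by
      obtain ⟨B', hB, -⟩ := h x (hsub hx)
      exact hB.continuousAt.continuousWithinAt)
    (fun x hx => by
      obtain ⟨B', hB, -⟩ := h x (hsub (interior_subset hx))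
      exact hB.differentiableAt.differentiableWithinAt)
    (fun x hx => by
      obtain ⟨B', hB, hB'⟩ := h x (hsub (interior_subset hx))
      rw [hB.deriv]; exact hB')
    s (left_mem_Icc.2 ht.1) t (right_mem_Icc.2 ht.1) ht.1
  linarith

/-- One step of the iteration: `Z' ≤ lZ - cG` and a weighted bound for `X ≥ Z` give a pointwise
bound for `Z`, and a weighted bound for any `Y ≤ 6G + K`. -/
theorem GainBound.step {X Y Z G : ℝ → ℝ} {s T C D l c K : ℝ} {j : ℕ} (hc : 0 < c) (hl : 0 ≤ l)
    (hK : 0 ≤ K) (h : GainBound X s T j C D)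
    (hZ : ∀ t ∈ Ico s T, ∃ Z', HasDerivAt Z Z' t ∧ Z' ≤ l * Z t - c * G t)
    (hZ0 : ∀ t ∈ Ico s T, 0 ≤ Z t) (hG0 : ∀ t ∈ Ico s T, 0 ≤ G t)
    (hZX : ∀ t ∈ Ico s T, Z t ≤ X t) (hY : ∀ t ∈ Ico s T, Y t ≤ 6 * G t + K) :
    (∀ t ∈ Ico s T, (t - s) ^ (j + 1) * Real.exp (-(l * (t - s))) * Z t ≤
      (j + 1) * (C + D * (t - s))) ∧
    GainBound Y s T (j + 1) (C / (c * Real.exp (-(l * (T - s))) / (6 * (j + 1))))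
      (D / (c * Real.exp (-(l * (T - s))) / (6 * (j + 1))) + K * (T - s) ^ (j + 1)) := by
  obtain ⟨B, hBs, hB⟩ := h
  -- A lower bound on [s, T) for the coefficient of (t − s)^{j+1} G in −B₁', divided by the 6 of
  -- `hY`; dividing B₁ by κ then normalises the coefficient of Y.
  set κ := c * Real.exp (-(l * (T - s))) / (6 * (j + 1)) with hκ
  have hj : (0 : ℝ) < j + 1 := by positivity
  have hκ0 : 0 < κ := by positivity
  -- The exponential cancels the growth l Z. Differentiating (t − s)^{j+1} / (j + 1) produces (t −
  -- s)^j Z ≤ (t − s)^j X, which is paid for by B'. The added term vanishes at t = s, so nothing is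
  -- assumed about the initial size of Z.
  set B₁ : ℝ → ℝ := fun t => B t + (t - s) ^ (j + 1) * Real.exp (-(l * (t - s))) * Z t / (j + 1)
    with hB₁
  have hd : ∀ t ∈ Ico s T, ∃ B', HasDerivAt B₁ B' t ∧
      B' ≤ D - 6 * κ * ((t - s) ^ (j + 1) * G t) := by
    intro t ht
    obtain ⟨hB0, B', hB1, hB2⟩ := hB t ht
    obtain ⟨Z', hZ1, hZ2⟩ := hZ t ht
    have hτ : 0 ≤ t - s := sub_nonneg.2 ht.1
    have e1 : HasDerivAt (fun t => t - s) 1 t := (hasDerivAt_id t).sub_const s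
    have e2 := e1.pow (j + 1)
    have e3 := ((e1.const_mul l).neg).exp
    have e4 := ((e2.mul e3).mul hZ1).div_const ((j : ℝ) + 1)
    refine ⟨_, hB1.add e4, ?_⟩
    simp only [Pi.mul_apply, Pi.pow_apply, Pi.neg_apply, Nat.add_sub_cancel, mul_one]
    have hx0 := (Real.exp_pos (-(l * (t - s)))).le
    have hx1 : Real.exp (-(l * (t - s))) ≤ 1 :=
      Real.exp_le_one_iff.2 (neg_nonpos.2 (mul_nonneg hl hτ))
    have hxT : Real.exp (-(l * (T - s))) ≤ Real.exp (-(l * (t - s))) := by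
      refine Real.exp_le_exp.2 (neg_le_neg (mul_le_mul_of_nonneg_left ?_ hl))
      linarith [ht.2]
    have hp0 := pow_nonneg hτ j
    have hp1 := pow_nonneg hτ (j + 1)
    set x := Real.exp (-(l * (t - s)))
    have i1 : (t - s) ^ j * (x * Z t) ≤ (t - s) ^ j * X t :=
      mul_le_mul_of_nonneg_left ((mul_le_of_le_one_left (hZ0 t ht) hx1).trans (hZX t ht)) hp0
    have i2 : (t - s) ^ (j + 1) * x / (j + 1) * Z' ≤
        (t - s) ^ (j + 1) * x / (j + 1) * (l * Z t - c * G t) :=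
      mul_le_mul_of_nonneg_left hZ2 (by positivity)
    have i3 : 6 * κ * ((t - s) ^ (j + 1) * G t) ≤
        (t - s) ^ (j + 1) * x / (j + 1) * (c * G t) := by
      have : 6 * κ = c * Real.exp (-(l * (T - s))) / (j + 1) := by rw [hκ]; field_simp
      rw [this]
      calc c * Real.exp (-(l * (T - s))) / (j + 1) * ((t - s) ^ (j + 1) * G t)
          ≤ c * x / (j + 1) * ((t - s) ^ (j + 1) * G t) :=
            mul_le_mul_of_nonneg_right (by gcongr) (mul_nonneg hp1 (hG0 t ht))
        _ = _ := by ring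
    have i4 : ((((j + 1 : ℕ) : ℝ) * (t - s) ^ j * x + (t - s) ^ (j + 1) * (x * -l)) * Z t +
        (t - s) ^ (j + 1) * x * Z') / (j + 1) = (t - s) ^ j * (x * Z t) -
        (t - s) ^ (j + 1) * x / (j + 1) * (l * Z t) + (t - s) ^ (j + 1) * x / (j + 1) * Z' := by
      push_cast
      field_simp
      ring
    rw [i4]
    linarith
  have hB₁0 : ∀ t ∈ Ico s T, B t ≤ B₁ t := fun t ht => by
    have := hZ0 t ht
    have hτ : 0 ≤ t - s := sub_nonneg.2 ht.1
    exact le_add_of_nonneg_right (by positivity)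
  have hB₁s : B₁ s ≤ C := by simp [hB₁, hBs]
  constructor
  · intro t ht
    have h1 := le_of_hasDerivAt_le (B := B₁) (D := D) (fun t ht => by
      obtain ⟨B', h1, h2⟩ := hd t ht
      refine ⟨B', h1, h2.trans (sub_le_self _ ?_)⟩
      have := hG0 t ht
      have hτ : 0 ≤ t - s := sub_nonneg.2 ht.1
      positivity) ht
    have h2 : (t - s) ^ (j + 1) * Real.exp (-(l * (t - s))) * Z t / (j + 1) ≤ C + D * (t - s) := by
      have h3 := (hB t ht).1
      have h4 : B₁ t = B t + (t - s) ^ (j + 1) * Real.exp (-(l * (t - s))) * Z t / (j + 1) := rfl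
      linarith
    rwa [div_le_iff₀' hj] at h2
  · refine ⟨fun t => B₁ t / κ, (div_le_div_iff_of_pos_right hκ0).2 hB₁s, fun t ht =>
      ⟨div_nonneg ((hB t ht).1.trans (hB₁0 t ht)) hκ0.le, ?_⟩⟩
    obtain ⟨B', h1, h2⟩ := hd t ht
    refine ⟨_, h1.div_const κ, ?_⟩
    have hτ : 0 ≤ t - s := sub_nonneg.2 ht.1
    have hp1 := pow_nonneg hτ (j + 1)
    have j1 : (t - s) ^ (j + 1) * Y t ≤ (t - s) ^ (j + 1) * (6 * G t + K) :=
      mul_le_mul_of_nonneg_left (hY t ht) hp1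
    have j2 : (t - s) ^ (j + 1) * K ≤ K * (T - s) ^ (j + 1) := by
      rw [mul_comm]
      exact mul_le_mul_of_nonneg_left (pow_le_pow_left₀ hτ (by linarith [ht.2]) _) hK
    have j3 : B' / κ ≤ (D - 6 * κ * ((t - s) ^ (j + 1) * G t)) / κ := by gcongr
    have j4 : (D - 6 * κ * ((t - s) ^ (j + 1) * G t)) / κ =
        D / κ - 6 * ((t - s) ^ (j + 1) * G t) := by field_simp
    linarith

/-- The iteration `0, 1/2, 1, 17/16` of the exponent. -/
theorem exists_bound_of_gain {l c K E₀ s t' T : ℝ} (hc : 0 < c) (hl : 0 ≤ l) (hK : 0 ≤ K)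
    (hst : s < t') : ∃ C : ℝ, ∀ (E : ℝ → ℝ) (X Z G : ℝ → ℝ → ℝ),
      E s ≤ E₀ → (∀ t ∈ Ico s T, 0 ≤ E t ∧ HasDerivAt E (-X 0 t) t) →
      (∀ γ, 0 ≤ γ → γ ≤ 17 / 16 → ∀ t ∈ Ico s T, ∃ Z', HasDerivAt (Z γ) Z' t ∧
        Z' ≤ l * Z γ t - c * G γ t) →
      (∀ γ, 0 ≤ γ → γ ≤ 17 / 16 → ∀ t ∈ Ico s T, 0 ≤ Z γ t ∧ 0 ≤ G γ t ∧ Z γ t ≤ X γ t) →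
      (∀ γ, 0 ≤ γ → γ ≤ 17 / 16 → ∀ t ∈ Ico s T, X (γ + 1 / 2) t ≤ 6 * G γ t + K) →
      (∀ t ∈ Ico s T, X (17 / 16) t ≤ X (3 / 2) t) →
      ∀ t ∈ Ico t' T, Z (17 / 16) t ≤ C := by
  set κ : ℕ → ℝ := fun j => c * Real.exp (-(l * (T - s))) / (6 * (j + 1)) with hκ
  set D₁ := 0 / κ 0 + K * (T - s) ^ (0 + 1) with hD₁
  set D₂ := D₁ / κ 1 + K * (T - s) ^ (1 + 1) with hD₂
  set D₃ := D₂ / κ 2 + K * (T - s) ^ (2 + 1) with hD₃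
  set C₃ := E₀ / κ 0 / κ 1 / κ 2 with hC₃
  -- Three gains raise the weight to (t − s)³ and the last step adds one power. Dividing by the
  -- smallest values of (t − s)⁴ and of the exponential on [t', T) gives this constant; absolute
  -- values are taken because the signs of E₀ and D₃ are not fixed.
  refine ⟨(3 + 1) * (|C₃| + |D₃| * (T - s)) / ((t' - s) ^ (3 + 1) * Real.exp (-(l * (T - s)))),
    fun E X Z G hE hE' hZ hpos hX hXX t ht => ?_⟩
  have g0 : GainBound (X 0) s T 0 E₀ 0 := ⟨E, hE, fun t ht =>
    ⟨(hE' t ht).1, _, (hE' t ht).2, by simp⟩⟩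
  have step : ∀ γ, 0 ≤ γ → γ ≤ 17 / 16 → ∀ (j : ℕ) (C D : ℝ), GainBound (X γ) s T j C D → _ :=
    fun γ h0 h1 j C D h => h.step (Y := X (γ + 1 / 2)) hc hl hK (hZ γ h0 h1)
      (fun t ht => (hpos γ h0 h1 t ht).1) (fun t ht => (hpos γ h0 h1 t ht).2.1)
      (fun t ht => (hpos γ h0 h1 t ht).2.2) (hX γ h0 h1)
  have g1 := (step 0 le_rfl (by norm_num) 0 _ _ g0).2
  rw [show (0 : ℝ) + 1 / 2 = 1 / 2 by norm_num] at g1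
  have g2 := (step (1 / 2) (by norm_num) (by norm_num) _ _ _ g1).2
  rw [show (1 / 2 : ℝ) + 1 / 2 = 1 by norm_num] at g2
  have g3 := (step 1 (by norm_num) (by norm_num) _ _ _ g2).2
  rw [show (1 : ℝ) + 1 / 2 = 3 / 2 by norm_num] at g3
  -- The last step starts from exponent 3/2 lowered to 17/16, because coercivity stops there, and
  -- keeps only the pointwise bound.
  have key := (step (17 / 16) (by norm_num) le_rfl _ _ _ (g3.mono hXX)).1 t ⟨hst.le.trans ht.1, ht.2⟩
  change (t - s) ^ (3 + 1) * Real.exp (-(l * (t - s))) * Z (17 / 16) t ≤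
    ((3 : ℕ) + 1) * (C₃ + D₃ * (t - s)) at key
  have hZ0 := (hpos (17 / 16) (by norm_num) le_rfl t ⟨hst.le.trans ht.1, ht.2⟩).1
  have ht' : 0 < t' - s := sub_pos.2 hst
  have hexp : Real.exp (-(l * (T - s))) ≤ Real.exp (-(l * (t - s))) := by
    refine Real.exp_le_exp.2 (neg_le_neg (mul_le_mul_of_nonneg_left ?_ hl))
    linarith [ht.2]
  rw [le_div_iff₀' (by positivity)]
  calc (t' - s) ^ (3 + 1) * Real.exp (-(l * (T - s))) * Z (17 / 16) t
      ≤ (t - s) ^ (3 + 1) * Real.exp (-(l * (t - s))) * Z (17 / 16) t := by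
        have h1 : t' - s ≤ t - s := by linarith [ht.1]
        exact mul_le_mul_of_nonneg_right (mul_le_mul (pow_le_pow_left₀ ht'.le h1 _) hexp
          (Real.exp_pos _).le (pow_nonneg (ht'.le.trans h1) _)) hZ0
    _ ≤ _ := key
    _ ≤ (3 + 1) * (|C₃| + |D₃| * (T - s)) := by
        have h1 : D₃ * (t - s) ≤ |D₃| * (T - s) :=
          mul_le_mul (le_abs_self _) (by linarith [ht.2]) (by linarith [ht.1]) (abs_nonneg _)
        push_cast
        linarith [le_abs_self C₃]

end Gain

/-! ### Energy monotonicity and the global bound before the final time -/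

section Flow

variable {n : ℕ} {M : Type*} [TopologicalSpace M] [ChartedSpace (EuclideanSpace ℝ (Fin n)) M]
  [IsManifold (𝓡 n) ∞ M] [RiemannianBundle (fun x : M => TangentSpace (𝓡 n) x)] {L : ℕ}
  [IsContMDiffRiemannianBundle (𝓡 n) ∞ (EuclideanSpace ℝ (Fin n))
        (fun x : M => TangentSpace (𝓡 n) x)]
  [MeasurableSpace M] [BorelSpace M] [CompactSpace M] [T2Space M]
  {a b ε C t₂ : ℝ} {F : ℝ → M → EuclideanSpace ℝ (Fin L)} {u : ℝ → M → ℝ}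
  {A : ℝ → M → EuclideanSpace ℝ (Fin L)}

theorem energy_nonneg (hε : 0 ≤ ε) (G : M → EuclideanSpace ℝ (Fin L)) : 0 ≤ energy n ε G :=
  mul_nonneg (by positivity) (integral_nonneg fun p => Real.rpow_nonneg (e2_nonneg hε G p) _)

theorem RegFlow.energy_le (hf : RegFlow n a b ε C t₂ F u A) (hn : 2 ≤ n) (hε : 0 ≤ ε)
    (hF : SmoothFam n (Ico 0 t₂) F) {t : ℝ} (ht : t ∈ Ioo 0 t₂) :
    energy n ε (F t) ≤ energy n ε (F 0) := by
  have ht₂ : 0 < t₂ := ht.1.trans ht.2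
  -- The energy identity holds only for positive times; right continuity at 0, from smoothness on
  -- [0, t₂), brings in the initial energy.
  have h0 : ContinuousWithinAt (fun s => energy n ε (F s)) (Ici 0) 0 := by
    refine continuousWithinAt_const.mul (continuousOn_integral_of_continuousOn (I := Ico 0 t₂)
      (g := fun s p => e2 n ε (F s) p ^ ((n : ℝ) / 2))
      ((continuousOn_e2 (uniqueDiffOn_Ico 0 t₂) hF).rpow_const
        fun _ _ => Or.inr (div_nonneg (Nat.cast_nonneg n) zero_le_two))
      (Ico_mem_nhdsGE ht₂) ⟨t, ht.1, fun s hs => ⟨hs.1, hs.2.trans_lt ht.2⟩⟩)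
  have hanti : AntitoneOn (fun s => energy n ε (F s)) (Icc 0 t) := by
    have hd : ∀ s ∈ Ioo 0 t, HasDerivAt (fun s => energy n ε (F s))
        (-∫ p, Real.exp (n * u s p) * ‖deriv (fun s => F s p) s‖ ^ 2 ∂(riemVolume n M)) s :=
      fun s hs => hf.hasDerivAt_energy hn hε ⟨hs.1, hs.2.trans ht.2⟩
    refine antitoneOn_of_deriv_nonpos (convex_Icc 0 t) (fun s hs => ?_) (fun s hs => ?_)
      (fun s hs => ?_)
    · rcases hs.1.eq_or_lt with h | h
      · rw [← h]
        exact h0.mono Icc_subset_Ici_self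
      · exact (hf.hasDerivAt_energy hn hε
          ⟨h, hs.2.trans_lt ht.2⟩).continuousAt.continuousWithinAt
    · rw [interior_Icc] at hs
      exact (hd s hs).differentiableAt.differentiableWithinAt
    · rw [interior_Icc] at hs
      rw [(hd s hs).deriv]
      exact neg_nonpos.2 (integral_nonneg fun p =>
        mul_nonneg (Real.exp_pos _).le (sq_nonneg _))
  exact hanti (left_mem_Icc.2 ht.1.le) (right_mem_Icc.2 ht.1.le) ht.1.le

theorem RegFlow.continuous_velMass (hf : RegFlow n a b ε C t₂ F u A) (γ : ℝ) {t : ℝ}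
    (ht : t ∈ Ioo 0 t₂) : Continuous fun p => Real.exp (n * u t p) *
      (‖deriv (fun s => F s p) t‖ ^ 2 * (1 + ‖deriv (fun s => F s p) t‖ ^ 2) ^ γ) := by
  have c2 : Continuous fun p => ‖deriv (fun s => F s p) t‖ ^ 2 :=
    (hf.smooth_vel.chartSmooth ht).continuous.norm.pow 2
  exact (hf.smooth_exp.chartSmooth ht).continuous.mul (c2.mul ((continuous_const.add c2).rpow_const
    fun p => Or.inl (ne_of_gt (add_pos_of_pos_of_nonneg one_pos (sq_nonneg _)))))

theorem RegFlow.velPrim_le_velMass (hf : RegFlow n a b ε C t₂ F u A) {γ : ℝ} (hγ : 0 ≤ γ) {t : ℝ}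
    (ht : t ∈ Ioo 0 t₂) : velPrim n F u γ t ≤ velMass n F u γ t :=
  integral_mono (integrable_of_continuous ((hf.smooth_wPrim γ).chartSmooth ht).continuous)
    (integrable_of_continuous (hf.continuous_velMass γ ht)) fun _ =>
    mul_le_mul_of_nonneg_left (wPrim_le hγ (sq_nonneg _)) (Real.exp_pos _).le

theorem RegFlow.velMass_le_velPrim (hf : RegFlow n a b ε C t₂ F u A) {γ : ℝ} (hγ : 0 ≤ γ) {t : ℝ}
    (ht : t ∈ Ioo 0 t₂) : velMass n F u γ t ≤ (1 + γ) * velPrim n F u γ t := by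
  rw [velPrim, ← integral_const_mul]
  refine integral_mono (integrable_of_continuous (hf.continuous_velMass γ ht))
    ((integrable_of_continuous ((hf.smooth_wPrim γ).chartSmooth ht).continuous).const_mul _)
    fun p => ?_
  have h := mul_le_mul_of_nonneg_left (le_wPrim hγ (sq_nonneg ‖deriv (fun s => F s p) t‖))
    (Real.exp_pos (n * u t p)).le
  simp only
  linarith

theorem RegFlow.velMass_mono (hf : RegFlow n a b ε C t₂ F u A) {γ γ' : ℝ} (hγ : γ ≤ γ') {t : ℝ}
    (ht : t ∈ Ioo 0 t₂) : velMass n F u γ t ≤ velMass n F u γ' t :=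
  integral_mono (integrable_of_continuous (hf.continuous_velMass γ ht))
    (integrable_of_continuous (hf.continuous_velMass γ' ht)) fun _ =>
    mul_le_mul_of_nonneg_left (mul_le_mul_of_nonneg_left (Real.rpow_le_rpow_of_exponent_le
      (le_add_of_nonneg_right (sq_nonneg _)) hγ) (sq_nonneg _)) (Real.exp_pos _).le

end Flow

/-- The global bound away from the initial time. -/
theorem exists_velMass_bound (n : ℕ) (hn : 2 ≤ n) (hn4 : n ≤ 4) (a c : ℝ) (ha : 0 < a)
    (hc : 0 < c) (E₀ t₁ t₂ : ℝ) (ht₁ : 0 ≤ t₁) (ht : t₁ < t₂) :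
    ∃ K : ℝ, ∀ (M : Type*) [TopologicalSpace M] [ChartedSpace (EuclideanSpace ℝ (Fin n)) M]
      [IsManifold (𝓡 n) ∞ M] [RiemannianBundle (fun x : M => TangentSpace (𝓡 n) x)]
      [IsContMDiffRiemannianBundle (𝓡 n) ∞ (EuclideanSpace ℝ (Fin n))
        (fun x : M => TangentSpace (𝓡 n) x)]
      [MeasurableSpace M] [BorelSpace M] [CompactSpace M] [T2Space M] (L : ℕ)
      (C b ε : ℝ) (F : ℝ → M → EuclideanSpace ℝ (Fin L)) (u : ℝ → M → ℝ)
      (A : ℝ → M → EuclideanSpace ℝ (Fin L)), 0 ≤ ε → 0 ≤ C → n * b / 2 - C - 2 * C ^ 2 = c →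
      RegFlow n a b ε C t₂ F u A → SmoothFam n (Ico 0 t₂) F → energy n ε (F 0) ≤ E₀ →
      ∀ t ∈ Ico ((t₁ + t₂) / 2) t₂, velMass n F u (17 / 16) t ≤ K := by
  -- The iteration starts a quarter of the way into [t₁, t₂]. That time is positive even if t₁ = 0,
  -- and it lies strictly before the midpoint, so the weight (t − s)⁴ is bounded below from the
  -- midpoint on.
  obtain ⟨K, hK⟩ := exists_bound_of_gain (l := 4 * n * a) (c := min 1 (2 * c))
    (K := 12 * n * |E₀|) (E₀ := E₀) (s := t₁ + (t₂ - t₁) / 4) (t' := (t₁ + t₂) / 2) (T := t₂)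
    (lt_min one_pos (by linarith)) (by positivity) (by positivity) (by linarith)
  refine ⟨(1 + 17 / 16) * K, ?_⟩
  intro M _ _ _ _ _ _ _ _ _ L C b ε F u A hε hC hcb hf hF hE t htt
  have hmem : ∀ t ∈ Ico (t₁ + (t₂ - t₁) / 4) t₂, t ∈ Ioo 0 t₂ := fun t h =>
    ⟨by linarith [h.1], h.2⟩
  have hEn : ∀ t ∈ Ioo 0 t₂, energy n ε (F t) ≤ E₀ := fun t h =>
    (hf.energy_le hn hε hF h).trans hE
  have htm : t ∈ Ioo 0 t₂ := ⟨by linarith [htt.1], htt.2⟩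
  refine (hf.velMass_le_velPrim (by norm_num) htm).trans
    (mul_le_mul_of_nonneg_left ?_ (by norm_num))
  refine hK (fun t => energy n ε (F t)) (velMass n F u) (velPrim n F u) (velDissip n F ε)
    (hEn _ (hmem _ ⟨le_rfl, by linarith⟩)) (fun t h => ⟨energy_nonneg hε _, ?_⟩)
    (fun γ h0 h1 t h => hf.exists_hasDerivAt_velPrim hn hn4 hε ha hC hc hcb h0 h1 (hmem t h))
    (fun γ h0 h1 t h => ⟨integral_nonneg fun p => mul_nonneg (Real.exp_pos _).le
      (wPrim_nonneg h0 (sq_nonneg _)), integral_nonneg fun p => add_nonneg (mul_nonneg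
        (Real.rpow_nonneg (e2_nonneg hε _ _) _) (by positivity)) (mul_nonneg
        (Real.rpow_nonneg (e2_nonneg hε _ _) _) (mul_nonneg (by positivity)
          (normSqDiff_nonneg _ _))), hf.velPrim_le_velMass h0 (hmem t h)⟩)
    (fun γ h0 h1 t h => (hf.velMass_add_half_le hn hε h0 (by linarith) (hmem t h)).trans ?_)
    (fun t h => hf.velMass_mono (by norm_num) (hmem t h)) t htt
  · have h1 := hf.hasDerivAt_energy hn hε (hmem t h)
    simpa only [velMass, Real.rpow_zero, mul_one] using h1
  · have := (hEn t (hmem t h)).trans (le_abs_self E₀)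
    gcongr

/-! ### Symmetry of the derivative of the tangent projection -/

section TangentProjection

variable {k L : ℕ} {N : Type*} [TopologicalSpace N] [ChartedSpace (EuclideanSpace ℝ (Fin k)) N]
  {ι : N → EuclideanSpace ℝ (Fin L)} [IsManifold (𝓡 k) ∞ N]

/-- The derivative of `q ↦ B (P q)` for a linear `B`. -/
theorem hasMFDerivAt_clm_tangentProj {V : Type*} [NormedAddCommGroup V] [NormedSpace ℝ V]
    (hι : Manifold.IsSmoothEmbedding (𝓡 k) 𝓘(ℝ, EuclideanSpace ℝ (Fin L)) ∞ ι) (q : N)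
    (B : (EuclideanSpace ℝ (Fin L) →L[ℝ] EuclideanSpace ℝ (Fin L)) →L[ℝ] V) :
    HasMFDerivAt (𝓡 k) 𝓘(ℝ, V) (fun q => B (tangentProj k ι q)) q
      (show TangentSpace (𝓡 k) q →L[ℝ] V from B.comp (tangentProjDiff ι q)) :=
  HasMFDerivAt.comp q B.hasFDerivAt.hasMFDerivAt (hasMFDerivAt_tangentProj hι q)

theorem inner_tangentProjDiff
    (hι : Manifold.IsSmoothEmbedding (𝓡 k) 𝓘(ℝ, EuclideanSpace ℝ (Fin L)) ∞ ι) (q : N)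
    (v : TangentSpace (𝓡 k) q) (z ξ : EuclideanSpace ℝ (Fin L)) :
    inner ℝ (tangentProjDiff ι q v z) ξ = inner ℝ z (tangentProjDiff ι q v ξ) := by
  -- This linear functional measures the failure of symmetry. It vanishes on every projection P,
  -- hence on P'.
  set B : (EuclideanSpace ℝ (Fin L) →L[ℝ] EuclideanSpace ℝ (Fin L)) →L[ℝ] ℝ :=
    (innerSL ℝ ξ).comp (ContinuousLinearMap.apply ℝ (EuclideanSpace ℝ (Fin L)) z) -
      (innerSL ℝ z).comp (ContinuousLinearMap.apply ℝ (EuclideanSpace ℝ (Fin L)) ξ) with hB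
  have h1 := hasMFDerivAt_clm_tangentProj hι q B
  have h2 : (fun q => B (tangentProj k ι q)) = fun _ => (0 : ℝ) := by
    funext q
    simp only [hB, sub_apply, ContinuousLinearMap.comp_apply, ContinuousLinearMap.apply_apply,
      innerSL_apply_apply]
    rw [← inner_tangentProj, real_inner_comm, sub_self]
  rw [h2] at h1
  have h3 := hasMFDerivAt_unique h1 (hasMFDerivAt_const (I := 𝓡 k) (I' := 𝓘(ℝ, ℝ)) (0 : ℝ) q)
  have h4 : B (tangentProjDiff ι q v) = 0 :=
    congrArg (fun T : TangentSpace (𝓡 k) q →L[ℝ] ℝ => T v) h3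
  simp only [hB, sub_apply, ContinuousLinearMap.comp_apply, ContinuousLinearMap.apply_apply,
      innerSL_apply_apply] at h4
  rw [real_inner_comm]
  linarith

end TangentProjection

/-! ### From smoothness on the product manifold to charts, slices and curves -/

section Families

variable {n : ℕ} {M : Type*} [TopologicalSpace M] [ChartedSpace (EuclideanSpace ℝ (Fin n)) M]
  [IsManifold (𝓡 n) ∞ M]

theorem smoothFam_of_contMDiffOn {V : Type*} [NormedAddCommGroup V] [NormedSpace ℝ V] {I : Set ℝ}
    {F : ℝ → M → V} (hF : ContMDiffOn (𝓘(ℝ, ℝ).prod (𝓡 n)) 𝓘(ℝ, V) ∞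
      (fun z : ℝ × M => F z.1 z.2) (I ×ˢ univ)) : SmoothFam n I F := by
  intro x
  rw [← contMDiffOn_iff_contDiffOn]
  have h1 : ContMDiffOn 𝓘(ℝ, ℝ × EuclideanSpace ℝ (Fin n)) (𝓘(ℝ, ℝ).prod (𝓡 n)) ∞
      (fun z : ℝ × EuclideanSpace ℝ (Fin n) => (z.1, (extChartAt (𝓡 n) x).symm z.2))
      (I ×ˢ (extChartAt (𝓡 n) x).target) :=
    contDiff_fst.contMDiff.contMDiffOn.prodMk
      ((contMDiffOn_extChartAt_symm x).comp contDiff_snd.contMDiff.contMDiffOn fun z hz => hz.2)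
  exact hF.comp h1 fun z hz => ⟨hz.1, mem_univ _⟩

variable {k : ℕ} {N : Type*} [TopologicalSpace N] [ChartedSpace (EuclideanSpace ℝ (Fin k)) N]
  {f : ℝ → M → N}

theorem contMDiff_slice {I : Set ℝ} (hf : ContMDiffOn (𝓘(ℝ, ℝ).prod (𝓡 n)) (𝓡 k) ∞
      (fun z : ℝ × M => f z.1 z.2) (I ×ˢ univ)) {t : ℝ} (ht : t ∈ I) :
    ContMDiff (𝓡 n) (𝓡 k) ∞ (f t) := by
  rw [← contMDiffOn_univ]
  exact hf.comp (contMDiff_const.prodMk contMDiff_id).contMDiffOn fun p _ => ⟨ht, mem_univ _⟩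

theorem contMDiffOn_curve {E' H' N' : Type*} [NormedAddCommGroup E'] [NormedSpace ℝ E']
    [TopologicalSpace H'] {J' : ModelWithCorners ℝ E' H'} [TopologicalSpace N']
    [ChartedSpace H' N'] {g : ℝ → M → N'} {Ω : Set (ℝ × M)}
    (hg : ContMDiffOn (𝓘(ℝ, ℝ).prod (𝓡 n)) J' ∞ (fun z : ℝ × M => g z.1 z.2) Ω) {I : Set ℝ} {p : M}
    (hI : ∀ t ∈ I, (t, p) ∈ Ω) : ContMDiffOn 𝓘(ℝ, ℝ) J' ∞ (fun s => g s p) I :=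
  hg.comp (contMDiff_id.prodMk contMDiff_const).contMDiffOn hI

end Families

/-! ### The curvature term A(f)(df, df) -/

section Curvature

variable {n : ℕ} {M : Type*} [TopologicalSpace M] [ChartedSpace (EuclideanSpace ℝ (Fin n)) M]
  [IsManifold (𝓡 n) ∞ M] [RiemannianBundle (fun x : M => TangentSpace (𝓡 n) x)]
  {k L : ℕ} {N : Type*} [TopologicalSpace N] [ChartedSpace (EuclideanSpace ℝ (Fin k)) N]
  {ι : N → EuclideanSpace ℝ (Fin L)} [IsManifold (𝓡 k) ∞ N] {f : M → N}

/-- The curvature term `A(f)(df, df)`. -/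
noncomputable def curvTerm (n k : ℕ) {L : ℕ} {M N : Type*} [TopologicalSpace M]
    [ChartedSpace (EuclideanSpace ℝ (Fin n)) M]
    [RiemannianBundle (fun x : M => TangentSpace (𝓡 n) x)]
    [TopologicalSpace N] [ChartedSpace (EuclideanSpace ℝ (Fin k)) N]
    (ι : N → EuclideanSpace ℝ (Fin L)) (f : M → N) (p : M) : EuclideanSpace ℝ (Fin L) :=
  metricTrace (n := n) p fun v w => secondFund (k := k) ι (f p)
    (mfderiv (𝓡 n) (𝓡 k) f p v) (mfderiv (𝓡 n) (𝓡 k) f p w)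

theorem diffAt_comp (hι : Manifold.IsSmoothEmbedding (𝓡 k) 𝓘(ℝ, EuclideanSpace ℝ (Fin L)) ∞ ι)
    {p : M} (hf : MDifferentiableAt (𝓡 n) (𝓡 k) f p) (v : TangentSpace (𝓡 n) p) :
    diffAt (fun q => ι (f q)) p v = diffAt ι (f p) (mfderiv (𝓡 n) (𝓡 k) f p v) := by
  have h := HasMFDerivAt.comp p
    ((hι.contMDiff (f p)).mdifferentiableAt (by simp)).hasMFDerivAt hf.hasMFDerivAt
  rw [diffAt, show (fun q => ι (f q)) = ι ∘ f from rfl, h.mfderiv]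
  rfl

theorem inner_curvTerm_diffAt
    (hι : Manifold.IsSmoothEmbedding (𝓡 k) 𝓘(ℝ, EuclideanSpace ℝ (Fin L)) ∞ ι) (f : M → N) (p : M)
    (z : TangentSpace (𝓡 k) (f p)) : inner ℝ (curvTerm n k ι f p) (diffAt ι (f p) z) = 0 := by
  rw [curvTerm, metricTrace, sum_inner]
  exact Finset.sum_eq_zero fun i _ => inner_secondFund_diffAt hι _ _ _ _

/-- By symmetry of P', pairing P'(df) df with ξ moves P' onto ξ, and P'(df) ξ is the differential of
P(f) ξ. The curvature term becomes a gradient product of smooth maps, which gives its continuity. -/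
theorem inner_curvTerm_eq
    (hι : Manifold.IsSmoothEmbedding (𝓡 k) 𝓘(ℝ, EuclideanSpace ℝ (Fin L)) ∞ ι)
    (hf : MDifferentiable (𝓡 n) (𝓡 k) f) (ξ : EuclideanSpace ℝ (Fin L)) (p : M) :
    inner ℝ ξ (curvTerm n k ι f p) =
      -gradInner n (fun q => ι (f q)) (fun q => tangentProj k ι (f q) ξ) p := by
  rw [curvTerm, metricTrace, inner_sum, gradInner_eq_sum, ← Finset.sum_neg_distrib]
  refine Finset.sum_congr rfl fun i _ => ?_
  rw [secondFund, inner_neg_right, real_inner_comm, inner_tangentProjDiff hι, frameDiff,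
    diffAt_comp hι (hf p)]
  congr 2
  have h := HasMFDerivAt.comp p (hasMFDerivAt_clm_tangentProj hι (f p)
    (ContinuousLinearMap.apply ℝ (EuclideanSpace ℝ (Fin L)) ξ)) (hf p).hasMFDerivAt
  rw [frameDiff, diffAt, show (fun q => tangentProj k ι (f q) ξ) =
    (fun q => ContinuousLinearMap.apply ℝ (EuclideanSpace ℝ (Fin L)) ξ (tangentProj k ι q)) ∘ f
    from rfl, h.mfderiv]
  rfl

theorem abs_inner_curvTerm_accel_le
    (hι : Manifold.IsSmoothEmbedding (𝓡 k) 𝓘(ℝ, EuclideanSpace ℝ (Fin L)) ∞ ι) {C : ℝ}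
    (hC : SecondFundBound k ι C) {f : ℝ → M → N} {t : ℝ} {p : M}
    (hf : MDifferentiableAt (𝓡 n) (𝓡 k) (f t) p)
    (hγ : ∀ᶠ s in nhds t, MDifferentiableAt 𝓘(ℝ, ℝ) (𝓡 k) (fun s => f s p) s)
    {w : ℝ → EuclideanSpace ℝ (Fin L)} (hw : ∀ᶠ s in nhds t, HasDerivAt (fun s => ι (f s p)) (w s) s)
    {w' : EuclideanSpace ℝ (Fin L)} (hw' : HasDerivAt w w' t) :
    |inner ℝ (curvTerm n k ι (f t) p) w'| ≤
      C ^ 2 * normSqDiff (n := n) (fun q => ι (f t q)) p * ‖w t‖ ^ 2 := by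
  rw [curvTerm, metricTrace, sum_inner, normSqDiff_eq_gradInner, gradInner_eq_sum, Finset.mul_sum,
    Finset.sum_mul]
  refine (Finset.abs_sum_le_sum_abs _ _).trans (Finset.sum_le_sum fun i _ => ?_)
  refine (abs_inner_secondFund_accel_le hι hC hγ hw hw' _).trans (le_of_eq ?_)
  rw [← diffAt_comp hι hf, real_inner_self_eq_norm_sq]
  rfl

variable [IsContMDiffRiemannianBundle (𝓡 n) ∞ (EuclideanSpace ℝ (Fin n))
        (fun x : M => TangentSpace (𝓡 n) x)]

theorem continuous_curvTerm
    (hι : Manifold.IsSmoothEmbedding (𝓡 k) 𝓘(ℝ, EuclideanSpace ℝ (Fin L)) ∞ ι)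
    (hf : ContMDiff (𝓡 n) (𝓡 k) ∞ f) : Continuous (curvTerm n k ι f) := by
  have h : ∀ ξ, Continuous fun p => inner ℝ ξ (curvTerm n k ι f p) := fun ξ => by
    simp only [inner_curvTerm_eq hι (hf.mdifferentiable (by simp)) ξ]
    have h1 : ContMDiff (𝓡 k) 𝓘(ℝ, EuclideanSpace ℝ (Fin L)) ∞ (fun q => tangentProj k ι q ξ) :=
      (ContinuousLinearMap.apply ℝ (EuclideanSpace ℝ (Fin L)) ξ).contDiff.contMDiff.comp
        (contMDiff_tangentProj hι)
    exact ((chartSmooth_of_contMDiff (hι.contMDiff.comp hf)).gradInner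
      (chartSmooth_of_contMDiff (h1.comp hf))).continuous.neg
  have h2 : curvTerm n k ι f = fun p => ∑ i, inner ℝ (EuclideanSpace.basisFun (Fin L) ℝ i)
      (curvTerm n k ι f p) • EuclideanSpace.basisFun (Fin L) ℝ i := by
    funext p
    exact ((EuclideanSpace.basisFun (Fin L) ℝ).sum_repr' _).symm
  rw [h2]
  exact continuous_finsetSum _ fun i _ => (h _).smul continuous_const

end Curvature

/-! ### From the flow on N to the extrinsic flow -/

section Solution

variable {n : ℕ} {M : Type*} [TopologicalSpace M] [ChartedSpace (EuclideanSpace ℝ (Fin n)) M]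
  [IsManifold (𝓡 n) ∞ M] [RiemannianBundle (fun x : M => TangentSpace (𝓡 n) x)]
  [IsContMDiffRiemannianBundle (𝓡 n) ∞ (EuclideanSpace ℝ (Fin n))
        (fun x : M => TangentSpace (𝓡 n) x)]
  {k L : ℕ} {N : Type*} [TopologicalSpace N] [ChartedSpace (EuclideanSpace ℝ (Fin k)) N]
  {ι : N → EuclideanSpace ℝ (Fin L)} [IsManifold (𝓡 k) ∞ N] {a b ε C t₂ : ℝ} {Ω : Set (ℝ × M)}
  {f : ℝ → M → N} {u : ℝ → M → ℝ}

theorem timeDeriv_eq_deriv {V : Type*} [NormedAddCommGroup V] [NormedSpace ℝ V]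
    (F : ℝ → M → V) {t : ℝ} (ht : t ∈ Ioo 0 t₂) (p : M) :
    timeDeriv t₂ F t p = deriv (fun s => F s p) t :=
  derivWithin_of_mem_nhds (Icc_mem_nhds ht.1 ht.2)

theorem IsSmoothSolution.smoothFam_f
    (hs : IsSmoothSolution n k ι a b ε t₂ Ω f u)
    (hι : Manifold.IsSmoothEmbedding (𝓡 k) 𝓘(ℝ, EuclideanSpace ℝ (Fin L)) ∞ ι)
    (hΩ : Ico 0 t₂ ×ˢ univ ⊆ Ω) : SmoothFam n (Ico 0 t₂) (fun t p => ι (f t p)) :=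
  smoothFam_of_contMDiffOn (hι.contMDiff.comp_contMDiffOn (hs.smooth_f.mono hΩ))

theorem IsSmoothSolution.regFlow
    (hs : IsSmoothSolution n k ι a b ε t₂ Ω f u)
    (hι : Manifold.IsSmoothEmbedding (𝓡 k) 𝓘(ℝ, EuclideanSpace ℝ (Fin L)) ∞ ι)
    (hC : SecondFundBound k ι C) (hΩ : Ico 0 t₂ ×ˢ univ ⊆ Ω) :
    RegFlow n a b ε C t₂ (fun t p => ι (f t p)) u (fun t => curvTerm n k ι (f t)) := by
  have hF : SmoothFam n (Ioo 0 t₂) (fun t p => ι (f t p)) :=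
    (hs.smoothFam_f hι hΩ).mono Ioo_subset_Ico_self
  have hmem : ∀ t ∈ Ioo 0 t₂, ∀ p : M, (t, p) ∈ Ω := fun t ht p =>
    hΩ ⟨Ioo_subset_Ico_self ht, mem_univ p⟩
  have hc : ∀ t ∈ Ioo 0 t₂, ContMDiff (𝓡 n) (𝓡 k) ∞ (f t) := fun t ht =>
    contMDiff_slice (hs.smooth_f.mono hΩ) (Ioo_subset_Ico_self ht)
  have hγ : ∀ p : M, ∀ t ∈ Ioo 0 t₂, MDifferentiableAt 𝓘(ℝ, ℝ) (𝓡 k) (fun s => f s p) t :=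
    fun p t ht => ((contMDiffOn_curve hs.smooth_f fun s hs => hmem s hs p).contMDiffAt
      (isOpen_Ioo.mem_nhds ht)).mdifferentiableAt (by simp)
  refine ⟨hF, (smoothFam_of_contMDiffOn (hs.smooth_u.mono hΩ)).mono Ioo_subset_Ico_self,
    fun t ht => continuous_curvTerm hι (hc t ht), fun t ht x p hp => ?_, fun t ht p => ?_,
    fun t ht p => ?_, fun t ht p => ?_⟩
  · have h := hs.eq_f t p (hmem t ht p) x (by rwa [extChartAt_source] at hp)
    rw [timeDeriv_eq_deriv _ ht] at h
    rw [h, smul_smul, ← Real.exp_add, add_neg_cancel, Real.exp_zero, one_smul]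
    rfl
  · have h := hs.eq_u t p (hmem t ht p)
    rw [timeDeriv_eq_deriv _ ht] at h
    rw [h, mul_sub, ← mul_assoc, mul_left_comm, ← Real.exp_add, add_neg_cancel, Real.exp_zero]
    ring
  · rw [(hasDerivAt_comp_curve hι (hγ p t ht)).deriv]
    exact inner_curvTerm_diffAt hι _ _ _
  · refine abs_inner_curvTerm_accel_le hι hC ((hc t ht).mdifferentiable (by simp) p)
      ?_ (w := fun s => deriv (fun s => ι (f s p)) s) ?_
      ((hF.deriv isOpen_Ioo).hasDerivAt isOpen_Ioo ht p)
    · filter_upwards [isOpen_Ioo.mem_nhds ht] with s hs using hγ p s hs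
    · filter_upwards [isOpen_Ioo.mem_nhds ht] with s hs using hF.hasDerivAt isOpen_Ioo hs p

end Solution

/-- Fatou's lemma. It yields integrability at the limit as well, which matters at t₂, where
smoothness is known only locally. -/
theorem integrable_of_tendsto_of_integral_le {X : Type*} [MeasurableSpace X] {μ : Measure X}
    {g : ℕ → X → ℝ} {g₀ : X → ℝ} {K : ℝ} (hg : ∀ j, Integrable (g j) μ) (h0 : ∀ j x, 0 ≤ g j x)
    (hK : ∀ j, ∫ x, g j x ∂μ ≤ K)
    (hlim : ∀ᵐ x ∂μ, Filter.Tendsto (fun j => g j x) Filter.atTop (nhds (g₀ x))) :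
    Integrable g₀ μ ∧ ∫ x, g₀ x ∂μ ≤ K := by
  have hm : AEStronglyMeasurable g₀ μ :=
    aestronglyMeasurable_of_tendsto_ae Filter.atTop (fun j => (hg j).1) hlim
  have hg₀ : ∀ᵐ x ∂μ, 0 ≤ g₀ x := by
    filter_upwards [hlim] with x hx
    exact ge_of_tendsto' hx fun j => h0 j x
  have hK0 : 0 ≤ K := (integral_nonneg (h0 0)).trans (hK 0)
  have hle : ∫⁻ x, ENNReal.ofReal (g₀ x) ∂μ ≤ ENNReal.ofReal K := by
    calc ∫⁻ x, ENNReal.ofReal (g₀ x) ∂μ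
        = ∫⁻ x, Filter.liminf (fun j => ENNReal.ofReal (g j x)) Filter.atTop ∂μ := by
          refine lintegral_congr_ae ?_
          filter_upwards [hlim] with x hx
          exact ((ENNReal.continuous_ofReal.tendsto _).comp hx).liminf_eq.symm
      _ ≤ Filter.liminf (fun j => ∫⁻ x, ENNReal.ofReal (g j x) ∂μ) Filter.atTop :=
          lintegral_liminf_le' fun j => (hg j).1.aemeasurable.ennreal_ofReal
      _ ≤ Filter.liminf (fun _ : ℕ => ENNReal.ofReal K) Filter.atTop := by
          refine Filter.liminf_le_liminf (Filter.Eventually.of_forall fun j => ?_)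
          rw [← ofReal_integral_eq_lintegral_ofReal (hg j) (Filter.Eventually.of_forall (h0 j))]
          exact ENNReal.ofReal_le_ofReal (hK j)
      _ = ENNReal.ofReal K := Filter.liminf_const _
  refine ⟨⟨hm, (hasFiniteIntegral_iff_ofReal hg₀).2 (hle.trans_lt ENNReal.ofReal_lt_top)⟩, ?_⟩
  rw [integral_eq_lintegral_of_nonneg_ae hg₀ hm]
  exact ENNReal.toReal_le_of_le_ofReal hK0 hle

/-- The largest exponent is 33/8 = 2 + 2 · 17/16 = 4 + 1/8; smaller ones are absorbed by the 1 in 1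
+ x². -/
theorem rpow_le_weight {x q : ℝ} (hx : 0 ≤ x) (hq : 2 ≤ q) (hq1 : q ≤ 33 / 8) :
    x ^ q ≤ x ^ 2 * (1 + x ^ 2) ^ (17 / 16 : ℝ) := by
  have h1 : x ^ q = x ^ 2 * (x ^ 2) ^ ((q - 2) / 2) := by
    rw [← Real.rpow_natCast x 2, ← Real.rpow_mul hx, ← Real.rpow_add' hx (by push_cast; linarith)]
    congr 1
    push_cast
    ring
  rw [h1]
  refine mul_le_mul_of_nonneg_left ?_ (sq_nonneg x)
  exact (Real.rpow_le_rpow (sq_nonneg x) (by linarith) (by linarith)).trans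
    (Real.rpow_le_rpow_of_exponent_le (by linarith [sq_nonneg x]) (by linarith))

/-! ### The bound up to the final time -/

section Solution

variable {n : ℕ} {M : Type*} [TopologicalSpace M] [ChartedSpace (EuclideanSpace ℝ (Fin n)) M]
  [IsManifold (𝓡 n) ∞ M] [RiemannianBundle (fun x : M => TangentSpace (𝓡 n) x)]
  [IsContMDiffRiemannianBundle (𝓡 n) ∞ (EuclideanSpace ℝ (Fin n))
        (fun x : M => TangentSpace (𝓡 n) x)]
  [MeasurableSpace M] [BorelSpace M] [CompactSpace M] [T2Space M]
  {k L : ℕ} {N : Type*} [TopologicalSpace N] [ChartedSpace (EuclideanSpace ℝ (Fin k)) N]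
  {ι : N → EuclideanSpace ℝ (Fin L)} [IsManifold (𝓡 k) ∞ N] {a b ε C t₁ t₂ : ℝ} {Ω : Set (ℝ × M)}
  {f : ℝ → M → N} {u : ℝ → M → ℝ}

theorem IsSmoothSolution.continuousOn_timeDeriv
    (hs : IsSmoothSolution n k ι a b ε t₂ Ω f u)
    (hι : Manifold.IsSmoothEmbedding (𝓡 k) 𝓘(ℝ, EuclideanSpace ℝ (Fin L)) ∞ ι)
    (ht₁ : 0 ≤ t₁) (ht : t₁ < t₂) {p : M} (hp : ∀ t ∈ Icc t₁ t₂, (t, p) ∈ Ω) :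
    ContinuousOn (fun t => timeDeriv t₂ (fun s q => ι (f s q)) t p) (Ioc t₁ t₂) := by
  have h1 : ContDiffOn ℝ ∞ (fun s => ι (f s p)) (Icc t₁ t₂) :=
    contMDiffOn_iff_contDiffOn.1
      (hι.contMDiff.comp_contMDiffOn (contMDiffOn_curve hs.smooth_f hp))
  have h2 := (h1.continuousOn_derivWithin (uniqueDiffOn_Icc ht) (by simp)).mono
    Ioc_subset_Icc_self
  refine h2.congr fun s hs => ?_
  -- The time derivative is taken within [0, t₂], but smoothness at p is used on [t₁, t₂]. The two
  -- intervals agree near any time after t₁, so t₁ itself is left out.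
  refine derivWithin_congr_set ?_
  filter_upwards [Ioi_mem_nhds hs.1] with x hx
  exact propext ⟨fun h => ⟨le_of_lt hx, h.2⟩, fun h => ⟨ht₁.trans h.1, h.2⟩⟩

/-- The local integral bound up to the final time. -/
theorem IsSmoothSolution.integrableOn_and_integral_le
    (hs : IsSmoothSolution n k ι a b ε t₂ Ω f u)
    (hι : Manifold.IsSmoothEmbedding (𝓡 k) 𝓘(ℝ, EuclideanSpace ℝ (Fin L)) ∞ ι)
    (hf : RegFlow n a b ε C t₂ (fun t p => ι (f t p)) u (fun t => curvTerm n k ι (f t)))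
    (ht₁ : 0 ≤ t₁) (ht : t₁ < t₂) {S : Set M} (hS : MeasurableSet S)
    (hp : ∀ p ∈ S, ∀ t ∈ Icc t₁ t₂, (t, p) ∈ Ω) {K : ℝ}
    (hK : ∀ t ∈ Ico ((t₁ + t₂) / 2) t₂, velMass n (fun t p => ι (f t p)) u (17 / 16) t ≤ K)
    {φ : M → ℝ} (hφ : Continuous φ) (hφ01 : ∀ p, φ p ∈ Icc (0 : ℝ) 1) {q : ℝ} (hq : 2 ≤ q)
    (hq1 : q ≤ 33 / 8) {t : ℝ} (htt : t ∈ Icc ((t₁ + t₂) / 2) t₂) :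
    IntegrableOn (fun p => Real.exp (n * u t p) *
        ‖timeDeriv t₂ (fun s q => ι (f s q)) t p‖ ^ q * φ p ^ n) S (riemVolume n M) ∧
      ∫ p in S, Real.exp (n * u t p) *
        ‖timeDeriv t₂ (fun s q => ι (f s q)) t p‖ ^ q * φ p ^ n ∂(riemVolume n M) ≤ K := by
  have hnn : ∀ s p, 0 ≤ Real.exp (n * u s p) *
      ‖timeDeriv t₂ (fun s q => ι (f s q)) s p‖ ^ q * φ p ^ n := fun s p =>
    mul_nonneg (mul_nonneg (Real.exp_pos _).le (Real.rpow_nonneg (norm_nonneg _) _))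
      (pow_nonneg (hφ01 p).1 n)
  have hlt : ∀ s ∈ Ico ((t₁ + t₂) / 2) t₂, IntegrableOn (fun p => Real.exp (n * u s p) *
        ‖timeDeriv t₂ (fun s q => ι (f s q)) s p‖ ^ q * φ p ^ n) S (riemVolume n M) ∧
      ∫ p in S, Real.exp (n * u s p) *
        ‖timeDeriv t₂ (fun s q => ι (f s q)) s p‖ ^ q * φ p ^ n ∂(riemVolume n M) ≤ K := by
    intro s hsm
    have hs0 : s ∈ Ioo 0 t₂ := ⟨by linarith [hsm.1], hsm.2⟩
    have c1 : Continuous fun p => timeDeriv t₂ (fun s q => ι (f s q)) s p := by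
      simp only [timeDeriv_eq_deriv _ hs0]
      exact (hf.smooth_vel.chartSmooth hs0).continuous
    have c2 : Continuous fun p => Real.exp (n * u s p) *
        ‖timeDeriv t₂ (fun s q => ι (f s q)) s p‖ ^ q * φ p ^ n :=
      ((hf.smooth_exp.chartSmooth hs0).continuous.mul (c1.norm.rpow_const
        fun _ => Or.inr (by linarith))).mul (hφ.pow n)
    have hi := integrable_of_continuous (n := n) c2
    refine ⟨hi.integrableOn, (setIntegral_le_integral hi
      (Filter.Eventually.of_forall (hnn s))).trans ((integral_mono hi
      (integrable_of_continuous (hf.continuous_velMass (17 / 16) hs0)) fun p => ?_).trans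
      (hK s hsm))⟩
    simp only
    rw [timeDeriv_eq_deriv _ hs0]
    have h1 := rpow_le_weight (norm_nonneg (deriv (fun s => ι (f s p)) s)) hq hq1
    refine (mul_le_of_le_one_right (mul_nonneg (Real.exp_pos _).le
      (Real.rpow_nonneg (norm_nonneg _) _)) (pow_le_one₀ (hφ01 p).1 (hφ01 p).2)).trans
      (mul_le_mul_of_nonneg_left h1 (Real.exp_pos _).le)
  rcases htt.2.lt_or_eq with h | h
  · exact hlt t ⟨htt.1, h⟩
  subst h
  -- At the final time, approach along earlier times at which the bound holds. Over the ball the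
  -- integrands converge pointwise, the solution being smooth there up to t₂.
  obtain ⟨τ, -, hτ, hτl⟩ := exists_seq_strictMono_tendsto' (show (t₁ + t) / 2 < t by linarith)
  have hτ' : ∀ j, τ j ∈ Ico ((t₁ + t) / 2) t := fun j => Ioo_subset_Ico_self (hτ j)
  refine integrable_of_tendsto_of_integral_le (fun j => (hlt _ (hτ' j)).1)
    (fun j => hnn (τ j)) (fun j => (hlt _ (hτ' j)).2) ?_
  filter_upwards [ae_restrict_mem hS] with p hpS
  have hτw : Filter.Tendsto τ Filter.atTop (nhdsWithin t (Ioc t₁ t)) :=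
    tendsto_nhdsWithin_iff.2 ⟨hτl, Filter.Eventually.of_forall fun j =>
      ⟨by linarith [(hτ j).1], (hτ j).2.le⟩⟩
  have l1 := (hs.continuousOn_timeDeriv hι ht₁ ht (hp p hpS) t ⟨ht, le_rfl⟩).tendsto.comp hτw
  have cu : ContinuousOn (fun s => u s p) (Icc t₁ t) :=
    (contMDiffOn_curve hs.smooth_u (hp p hpS)).continuousOn
  have l2 := ((cu.mono Ioc_subset_Icc_self) t ⟨ht, le_rfl⟩).tendsto.comp hτw
  exact ((Real.continuous_exp.tendsto _).comp (l2.const_mul (n : ℝ))).mul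
    (l1.norm.rpow_const (Or.inr (by linarith))) |>.mul_const _

end Solution

end RegCHF

theorem lemma4p6 (n : ℕ) (hn : 2 ≤ n) (hn4 : n ≤ 4) (a C_b : ℝ) (ha : 0 < a) (hC_b : 0 < C_b)
    (r R E₀ t₁ t₂ : ℝ) (hr : 0 < r) (hrR : r ≤ R) (ht₁ : 0 ≤ t₁) (ht : t₁ < t₂) :
    ∃ C₁₂ : ℝ, ∀ (M : Type*) [EMetricSpace M] [CompactSpace M]
      [ChartedSpace (EuclideanSpace ℝ (Fin n)) M] [IsManifold (𝓡 n) ∞ M]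
      [RiemannianBundle (fun x : M => TangentSpace (𝓡 n) x)]
      [IsContMDiffRiemannianBundle (𝓡 n) ∞ (EuclideanSpace ℝ (Fin n))
        (fun x : M => TangentSpace (𝓡 n) x)]
      [IsRiemannianManifold (𝓡 n) M] [MeasurableSpace M] [BorelSpace M]
      (k L : ℕ) (N : Type*) [TopologicalSpace N] [ChartedSpace (EuclideanSpace ℝ (Fin k)) N]
      [IsManifold (𝓡 k) ∞ N] (ι : N → EuclideanSpace ℝ (Fin L))
      (_ : Manifold.IsSmoothEmbedding (𝓡 k) 𝓘(ℝ, EuclideanSpace ℝ (Fin L)) ∞ ι)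
      (C_N b ε : ℝ) (_ : 0 ≤ C_N) (_ : RegCHF.SecondFundBound k ι C_N) (_ : 0 < b)
      (_ : n * b / 2 - C_N - 2 * C_N ^ 2 = C_b) (_ : ε ∈ Icc (0 : ℝ) 1)
      (x₀ : M) (f : ℝ → M → N) (u : ℝ → M → ℝ)
      (_ : RegCHF.IsSmoothSolution n k ι a b ε t₂
        (Ico 0 t₂ ×ˢ univ ∪ Icc t₁ t₂ ×ˢ Metric.eball x₀ (ENNReal.ofReal R)) f u)
      (_ : RegCHF.energy n ε (fun p => ι (f 0 p)) ≤ E₀)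
      (φ : M → ℝ) (_ : RegCHF.IsCutoff n x₀ r φ)
      (t : ℝ) (_ : t ∈ Icc ((t₁ + t₂) / 2) t₂),
      (IntegrableOn (fun p => Real.exp (n * u t p) *
            ‖RegCHF.timeDeriv t₂ (fun s q => ι (f s q)) t p‖ ^ n * φ p ^ n)
          (Metric.eball x₀ (ENNReal.ofReal r)) (RegCHF.riemVolume n M) ∧
        ∫ p in Metric.eball x₀ (ENNReal.ofReal r), Real.exp (n * u t p) *
            ‖RegCHF.timeDeriv t₂ (fun s q => ι (f s q)) t p‖ ^ n * φ p ^ n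
          ∂(RegCHF.riemVolume n M) ≤ C₁₂) ∧
      (IntegrableOn (fun p => Real.exp (n * u t p) *
            ‖RegCHF.timeDeriv t₂ (fun s q => ι (f s q)) t p‖ ^ ((n : ℝ) + 1 / 8) * φ p ^ n)
          (Metric.eball x₀ (ENNReal.ofReal r)) (RegCHF.riemVolume n M) ∧
        ∫ p in Metric.eball x₀ (ENNReal.ofReal r), Real.exp (n * u t p) *
            ‖RegCHF.timeDeriv t₂ (fun s q => ι (f s q)) t p‖ ^ ((n : ℝ) + 1 / 8) * φ p ^ n
          ∂(RegCHF.riemVolume n M) ≤ C₁₂) := by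
  obtain ⟨K, hK⟩ := RegCHF.exists_velMass_bound n hn hn4 a C_b ha hC_b E₀ t₁ t₂ ht₁ ht
  refine ⟨K, ?_⟩
  intro M _ _ _ _ _ _ _ _ _ k L N _ _ _ ι hι C_N b ε hC_N hC hb hcb hε x₀ f u hs hE φ hφ t htt
  have hn0 : (2 : ℝ) ≤ n := by exact_mod_cast hn
  have hn4' : (n : ℝ) ≤ 4 := by exact_mod_cast hn4
  have hf := hs.regFlow hι hC subset_union_left
  have hball : ∀ p ∈ Metric.eball x₀ (ENNReal.ofReal r), ∀ t ∈ Icc t₁ t₂, (t, p) ∈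
      (Ico 0 t₂ ×ˢ univ ∪ Icc t₁ t₂ ×ˢ Metric.eball x₀ (ENNReal.ofReal R) : Set (ℝ × M)) :=
    fun p hp t ht => Or.inr ⟨ht, Metric.eball_subset_eball (ENNReal.ofReal_le_ofReal hrR) hp⟩
  -- Both n and n + 1/8 lie between 2 and 33/8, so one bound serves for both integrals.
  have key := fun q h0 h1 => hs.integrableOn_and_integral_le hι hf ht₁ ht
    Metric.isOpen_eball.measurableSet hball
    (hK M L C_N b ε _ u _ hε.1 hC_N hcb hf (hs.smoothFam_f hι subset_union_left) hE)
    hφ.smooth.continuous hφ.mem_Icc (q := q) h0 h1 htt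
  refine ⟨?_, key _ (by linarith) (by linarith)⟩
  have h1 := key n hn0 (by linarith)
  simpa only [Real.rpow_natCast] using h1
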